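/- **Setting.** Let $J^1(S^1)=(\mathbb R/2\pi\mathbb Z)\times\mathbb R\times\mathbb R$ with coordinates $(\theta,y,z)$ and contact form $dz-y\,d\theta$; the *front* of a curve in $J^1(S^1)$ is its projection to the $(\theta,z)$-coordinates. A Legendrian knot is a smooth embedding of the circle into $J^1(S^1)$ that is tangent to $\ker(dz-y\,d\theta)$. Two closed curves in $J^1(S^1)$ are *Legendrian isotopic* if, up to orientation-preserving reparametrization, they are the ends of a smooth family of Legendrian knots parametrized by $[0,1]$ (in particular both are Legendrian knots). The *conormal knot* of an oriented immersed closed plane curve $q$ is the closed curve in $J^1(S^1)$ obtained by sending a point $q=(q_1,q_2)$ of the curve with unit tangent vector $(\cos\varphi,\sin\varphi)$ to $\theta=\varphi+\pi/2$, $y=-q_1\sin\theta+q_2\cos\theta$, $z=q_1\cos\theta+q_2\sin\theta$. **Rectilinear curves.** Let $P$ be a closed oriented polygon in the plane with edges $L_1,\dots,L_n$ (cyclically ordered), alternately horizontal and vertical, each of positive length, no two of them on the same line. An *$\varepsilon$-rectilinear curve* over $P$ is a smooth closed immersed plane curve that traverses the edges of $P$ in order, except that within distance $\varepsilon$ of each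 vertex the $90^\circ$ corner is replaced by a smooth arc whose tangent direction stays in the closed quadrant between the directions of the two edges. **Algorithm.** To an edge $L$ associate the point ("dot") of $(\mathbb R/2\pi\mathbb Z)\times\mathbb R$ equal to $(\pi/2,y)$, $(\pi,-x)$, $(3\pi/2,-y)$ or $(0,x)$ according to whether $L$ points in the direction $+x$, $+y$, $-x$ or $-y$, where $y$ (resp. $x$) is the constant coordinate of $L$. Join the dots of consecutive edges $L_i,L_{i+1}$ by a straight segment along which $\theta$ changes by $+\pi/2$ if $P$ turns left between $L_i$ and $L_{i+1}$, and by $-\pi/2$ if it turns right. An *$\varepsilon$-smoothing* of the resulting closed polygonal path is a closed immersed Legendrian curve in $J^1(S^1)$ whose front traverses these segments in order, regularly in $\theta$, except within distance $\varepsilon$ of each dot, where the corner is smoothed: if $\theta$ does not reverse direction at the dot, the corner is rounded, the front remaining a graph over $\theta$; if $\theta$ reverses direction at the dot, a single cusp is placed there, and the slope $y=dz/d\theta$ varies monotonically along the smoothed arc. **Proposition.** For every such polygon $P$: for every $\varepsilon>0$ there exist $\varepsilon$-rectilinear curves over $P$ and $\varepsilon$-smoothings of the polygonal path of $P$; and there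 is $\varepsilon_0>0$, depending only on $P$, such that every $\varepsilon_0$-smoothing of the polygonal path is Legendrian isotopic in $J^1(S^1)$ to the conormal knot of every $\varepsilon_0$-rectilinear curve over $P$. -/

import Mathlib

open scoped ContDiff

noncomputable section

namespace PlaneConormal

/-! ### The jet space of the circle and Legendrian knots in it -/

/-- The 1-jet space `J¹(S¹) = (ℝ/2πℤ) × ℝ × ℝ` with coordinates `(θ, y, z)`;
its contact form is `dz - y dθ`. -/
abbrev JetSpace : Type := Real.Angle × ℝ × ℝ

/-- The front projection `(θ, y, z) ↦ (θ, z)`. -/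
def front (p : JetSpace) : Real.Angle × ℝ := (p.1, p.2.2)

/-- `γ : ℝ → J¹(S¹)` is a smooth closed (1-periodic) immersed Legendrian curve, and `θ, y, z` are
its coordinate functions, where `θ` is a lift of the angular coordinate to `ℝ`. -/
structure IsLegendrianLift (γ : ℝ → JetSpace) (θ y z : ℝ → ℝ) : Prop where
  coords : ∀ t, γ t = ((θ t : Real.Angle), y t, z t)
  periodic : Function.Periodic γ 1
  smooth_θ : ContDiff ℝ ∞ θ
  smooth_y : ContDiff ℝ ∞ y
  smooth_z : ContDiff ℝ ∞ z
  legendrian : ∀ t, deriv z t - y t * deriv θ t = 0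
  immersed : ∀ t, (deriv θ t, deriv y t, deriv z t) ≠ 0

/-- A parametrized Legendrian knot: a Legendrian embedding of the circle `ℝ/ℤ` into `J¹(S¹)`. -/
def IsLegendrianKnot (γ : ℝ → JetSpace) : Prop :=
  (∃ θ y z : ℝ → ℝ, IsLegendrianLift γ θ y z) ∧
    ∀ s t, γ s = γ t → ∃ k : ℤ, t = s + k

/-- `φ : ℝ → ℝ` is the lift of an orientation-preserving diffeomorphism of `ℝ/ℤ`. -/
structure IsReparametrization (φ : ℝ → ℝ) : Prop where
  smooth : ContDiff ℝ ∞ φ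
  deriv_pos : ∀ t, 0 < deriv φ t
  shift : ∀ t, φ (t + 1) = φ t + 1

/-- Two closed curves in `J¹(S¹)` are Legendrian isotopic (as oriented unparametrized knots):
there is a smooth family `H s`, `0 ≤ s ≤ 1`, of Legendrian knots which starts at a
reparametrization of `γ₀` and ends at a reparametrization of `γ₁`. -/
def LegendrianIsotopic (γ₀ γ₁ : ℝ → JetSpace) : Prop :=
  ∃ H : ℝ → ℝ → JetSpace,
    (∃ Θ Y Z : ℝ × ℝ → ℝ,
      ContDiffOn ℝ ∞ Θ (Set.Icc 0 1 ×ˢ Set.univ) ∧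
      ContDiffOn ℝ ∞ Y (Set.Icc 0 1 ×ˢ Set.univ) ∧
      ContDiffOn ℝ ∞ Z (Set.Icc 0 1 ×ˢ Set.univ) ∧
      ∀ s ∈ Set.Icc (0 : ℝ) 1, ∀ t,
        H s t = ((Θ (s, t) : Real.Angle), Y (s, t), Z (s, t))) ∧
    (∀ s ∈ Set.Icc (0 : ℝ) 1, IsLegendrianKnot (H s)) ∧
    (∃ φ, IsReparametrization φ ∧ H 0 = γ₀ ∘ φ) ∧
    (∃ φ, IsReparametrization φ ∧ H 1 = γ₁ ∘ φ)

/-! ### Plane curves and their conormal knots -/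

/-- A (parametrized) oriented plane curve: an immersion of the circle `ℝ/ℤ` into the plane. -/
structure IsPlaneCurve (q : ℝ → ℝ × ℝ) : Prop where
  smooth : ContDiff ℝ ∞ q
  periodic : Function.Periodic q 1
  immersed : ∀ t, deriv q t ≠ 0

/-- The unit covector `p = p₁ dq₁ + p₂ dq₂` with `⟨p, v⟩ = 0` and `⟨p, w⟩ = 1`, where `v` is the
unit vector in the direction of the velocity `u ≠ 0` and `w` is `v` rotated by `90°`
counterclockwise. -/
def conormalCovector (u : ℝ × ℝ) : ℝ × ℝ :=
  (-u.2 / Real.sqrt (u.1 ^ 2 + u.2 ^ 2), u.1 / Real.sqrt (u.1 ^ 2 + u.2 ^ 2))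

/-- The identification of the unit cotangent bundle of the plane with `J¹(S¹)`:
`θ = arg (p₁ + i p₂)`, `y = -q₁ sin θ + q₂ cos θ`, `z = q₁ cos θ + q₂ sin θ`. -/
def cotangentToJet (q p : ℝ × ℝ) : JetSpace :=
  let θ : ℝ := Complex.arg ⟨p.1, p.2⟩
  ((θ : Real.Angle), -q.1 * Real.sin θ + q.2 * Real.cos θ,
    q.1 * Real.cos θ + q.2 * Real.sin θ)

/-- The conormal knot of a plane curve, parametrized by the curve and viewed in `J¹(S¹)`. -/
def conormal (q : ℝ → ℝ × ℝ) (t : ℝ) : JetSpace :=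
  cotangentToJet (q t) (conormalCovector (deriv q t))

/-! ### Rectilinear curves -/

/-- The directions `+x`, `+y`, `-x`, `-y`. -/
inductive Heading
  | east | north | west | south

namespace Heading

/-- The unit vector of a direction. -/
def vec : Heading → ℝ × ℝ
  | east => (1, 0)
  | north => (0, 1)
  | west => (-1, 0)
  | south => (0, -1)

/-- Is the direction parallel to the `x`-axis? -/
def IsHorizontal : Heading → Prop
  | east => True
  | north => False
  | west => True
  | south => False

/-- The `θ`-coordinate of the point associated with a segment of the given direction. -/
def dotAngle : Heading → ℝ
  | east => Real.pi / 2
  | north => Real.pi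
  | west => 3 * Real.pi / 2
  | south => 0

/-- The `z`-coordinate of the point associated with a segment of the given direction
that passes through `v`. -/
def dotHeight : Heading → ℝ × ℝ → ℝ
  | east, v => v.2
  | north, v => -v.1
  | west, v => -v.2
  | south, v => v.1

end Heading

/-- A closed oriented polygon with `n` edges, all parallel to the coordinate axes, alternately
horizontal and vertical, no two of them on the same line. Vertices and edges are
indexed by `ℤ`, periodically modulo `n`; edge `i` runs from vertex `i` to vertex `i + 1`. -/
structure RectilinearPolygon where
  n : ℕ
  n_pos : 0 < n
  vertex : ℤ → ℝ × ℝ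
  dir : ℤ → Heading
  vertex_periodic : ∀ i, vertex (i + n) = vertex i
  dir_periodic : ∀ i, dir (i + n) = dir i
  edge : ∀ i, ∃ l : ℝ, 0 < l ∧ vertex (i + 1) = vertex i + l • (dir i).vec
  right_angle : ∀ i, (dir (i + 1)).IsHorizontal ↔ ¬ (dir i).IsHorizontal
  horizontal_distinct : ∀ i j, (dir i).IsHorizontal → (dir j).IsHorizontal →
    (vertex i).2 = (vertex j).2 → (n : ℤ) ∣ i - j
  vertical_distinct : ∀ i j, ¬ (dir i).IsHorizontal → ¬ (dir j).IsHorizontal →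
    (vertex i).1 = (vertex j).1 → (n : ℤ) ∣ i - j

/-- Times `a i < b i < a (i + 1)` which cut the circle `ℝ/ℤ` into `2n` consecutive intervals. -/
structure IsSubdivision (n : ℕ) (a b : ℤ → ℝ) : Prop where
  lt : ∀ i, a i < b i
  lt_next : ∀ i, b i < a (i + 1)
  shift_a : ∀ i, a (i + n) = a i + 1
  shift_b : ∀ i, b (i + n) = b i + 1

namespace RectilinearPolygon

variable (P : RectilinearPolygon)

/-- `+1` if the polygon turns left between edge `i` and edge `i + 1`, and `-1` if it turns right
(the cross product of the two unit directions). -/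
def turn (i : ℤ) : ℝ :=
  (P.dir i).vec.1 * (P.dir (i + 1)).vec.2 - (P.dir i).vec.2 * (P.dir (i + 1)).vec.1

/-- `q` is a rectilinear plane curve with underlying polygon `P`: it runs along the edges of `P`,
except that each corner is smoothed within distance `ε` of the vertex; while it turns, its
direction stays in the closed quadrant between the directions of the two edges. -/
def IsRectilinearCurve (ε : ℝ) (q : ℝ → ℝ × ℝ) : Prop :=
  IsPlaneCurve q ∧ ∃ a b : ℤ → ℝ, IsSubdivision P.n a b ∧
    (∀ i, ∀ t ∈ Set.Icc (b i) (a (i + 1)),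
      q t ∈ segment ℝ (P.vertex i) (P.vertex (i + 1)) ∧
      ∃ r : ℝ, 0 < r ∧ deriv q t = r • (P.dir i).vec) ∧
    (∀ i, ∀ t ∈ Set.Icc (a i) (b i),
      dist (q t) (P.vertex i) < ε ∧
      ∃ r s : ℝ, 0 ≤ r ∧ 0 ≤ s ∧ deriv q t = r • (P.dir (i - 1)).vec + s • (P.dir i).vec)

/-- The point ("dot") of `(ℝ/2πℤ) × ℝ` associated with edge `i`. -/
def dot (i : ℤ) : Real.Angle × ℝ :=
  (((P.dir i).dotAngle : Real.Angle), (P.dir i).dotHeight (P.vertex i))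

/-- The straight segment, `0 ≤ u ≤ 1`, that joins dot `i` to dot `i + 1` in `(ℝ/2πℤ) × ℝ`;
`θ` changes by `π/2` along it, in the direction in which the polygon turns. -/
def chord (i : ℤ) (u : ℝ) : Real.Angle × ℝ :=
  (((P.dir i).dotAngle + u * (P.turn i * (Real.pi / 2)) : ℝ),
    (1 - u) * (P.dot i).2 + u * (P.dot (i + 1)).2)

/-- `γ` is a closed Legendrian curve whose front is obtained from the closed polygonal path through
the dots by smoothing it within distance `ε` of each dot. Elsewhere the front runs along the
chords. If the path passes through dot `i` without reversing the direction of `θ`, the corner is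
rounded: the front stays a graph over `θ`. If `θ` reverses direction there, a cusp is placed:
exactly one, at time `c`, and the slope `y = dz/dθ` of the front varies monotonically. -/
def IsSmoothedFront (ε : ℝ) (γ : ℝ → JetSpace) : Prop :=
  ∃ θ y z : ℝ → ℝ, IsLegendrianLift γ θ y z ∧ ∃ a b : ℤ → ℝ, IsSubdivision P.n a b ∧
    (∀ i, ∀ t ∈ Set.Icc (b i) (a (i + 1)),
      (∃ u ∈ Set.Icc (0 : ℝ) 1, front (γ t) = P.chord i u) ∧ 0 < P.turn i * deriv θ t) ∧
    (∀ i, ∀ t ∈ Set.Icc (a i) (b i), dist (front (γ t)) (P.dot i) < ε) ∧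
    (∀ i, P.turn (i - 1) = P.turn i →
      ∀ t ∈ Set.Icc (a i) (b i), 0 < P.turn i * deriv θ t) ∧
    (∀ i, P.turn (i - 1) ≠ P.turn i →
      (∃ c ∈ Set.Ioo (a i) (b i),
        (∀ t ∈ Set.Ico (a i) c, 0 < P.turn (i - 1) * deriv θ t) ∧
        (∀ t ∈ Set.Ioc c (b i), 0 < P.turn i * deriv θ t)) ∧
      (MonotoneOn y (Set.Icc (a i) (b i)) ∨ AntitoneOn y (Set.Icc (a i) (b i))))

end RectilinearPolygon

end PlaneConormal

end

open scoped ContDiff Topology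

noncomputable section

namespace PlaneConormal

/-! ### Normal and tangential coordinates in the plane -/

/-! Edges correspond to dots and vertices to segments. Along a straight edge both `θ` and `z` of the
conormal are constant, equal to the dot. At a vertex `v` the conormal sweeps a quarter turn of the
sinusoid `z = v₁ cos θ + v₂ sin θ` between two dots, and the algorithm replaces this arc by a chord.
The isotopy from a smoothing `γ` to the conormal of a rectilinear curve has two linear stages.

Stage one keeps the angle function `θ` of `γ`. `exists_curve_of_angle` produces a closed plane curve
near `P` whose tangent direction is given by this same `θ`. For fixed `θ` the equation `dz = y dθ`
is linear in `(y, z)`, so `γ` and the conormal of this curve are joined by convex combinations, all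
of them Legendrian. They are immersed because `θ'` vanishes only at cusps, where both slopes have
negative derivative: for the smoothing this rests on `slope_lt_of_turn_ne`, for the conormal on the
positive speed of the curve. They are embedded (`IsFrontWithCurve.embedded`) for two reasons. Near a
dot, either `θ` is strictly monotone or the slope separates the two branches of the cusp
(`eq_of_near`). Along segments, value and slope at an angle nearly determine the heights of the two
end dots (`coeff_le_of_jet_le`), and these heights determine the edges because no two edges lie on
the same line.

Stage two interpolates linearly between two plane curves near `P`, after a reparametrization has
matched their edge and corner times. The conditions `IsNearPolygon` are convex. They force point and
direction to determine the time (`IsNearPolygon.embedded`), so every intermediate conormal is a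
knot.

Existence is explicit. A rectilinear curve is a convex combination of three curves that run along
`P` with staggered stops. A smoothing is obtained by prescribing `θ` and a slope `y` that is
constant along chords, and then integrating `y dθ`. A mean-zero condition on `θ` at each dot makes
the resulting front run exactly along the chords. -/

/-- The coordinate of `q` along the covector of angle `θ`. -/
def nrm (θ : ℝ) (q : ℝ × ℝ) : ℝ := q.1 * Real.cos θ + q.2 * Real.sin θ

/-- The coordinate of `q` along the tangent direction whose covector has angle `θ`. -/
def tng (θ : ℝ) (q : ℝ × ℝ) : ℝ := q.1 * Real.sin θ - q.2 * Real.cos θ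

/-- The unit tangent vector whose covector has angle `θ`. -/
def tvec (θ : ℝ) : ℝ × ℝ := (Real.sin θ, -Real.cos θ)

lemma nrm_add (θ : ℝ) (p q : ℝ × ℝ) : nrm θ (p + q) = nrm θ p + nrm θ q := by
  simp [nrm]; ring

lemma tng_add (θ : ℝ) (p q : ℝ × ℝ) : tng θ (p + q) = tng θ p + tng θ q := by
  simp [tng]; ring

lemma nrm_sub (θ : ℝ) (p q : ℝ × ℝ) : nrm θ (p - q) = nrm θ p - nrm θ q := by
  simp [nrm]; ring

lemma tng_sub (θ : ℝ) (p q : ℝ × ℝ) : tng θ (p - q) = tng θ p - tng θ q := by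
  simp [tng]; ring

lemma nrm_smul (θ c : ℝ) (q : ℝ × ℝ) : nrm θ (c • q) = c * nrm θ q := by
  simp [nrm]; ring

lemma tng_smul (θ c : ℝ) (q : ℝ × ℝ) : tng θ (c • q) = c * tng θ q := by
  simp [tng]; ring

lemma nrm_angle_add (θ x : ℝ) (q : ℝ × ℝ) :
    nrm (θ + x) q = Real.cos x * nrm θ q - Real.sin x * tng θ q := by
  simp only [nrm, tng, Real.cos_add, Real.sin_add]; ring

lemma tng_angle_add (θ x : ℝ) (q : ℝ × ℝ) :
    tng (θ + x) q = Real.sin x * nrm θ q + Real.cos x * tng θ q := by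
  simp only [nrm, tng, Real.cos_add, Real.sin_add]; ring

lemma nrm_tvec (θ φ : ℝ) : nrm θ (tvec φ) = Real.sin (φ - θ) := by
  simp only [nrm, tvec, Real.sin_sub]; ring

lemma tng_tvec (θ φ : ℝ) : tng θ (tvec φ) = Real.cos (φ - θ) := by
  simp only [tng, tvec, Real.cos_sub]; ring

lemma eq_of_nrm_tng {θ : ℝ} {p q : ℝ × ℝ} (h1 : nrm θ p = nrm θ q) (h2 : tng θ p = tng θ q) :
    p = q := by
  have key : ∀ r : ℝ × ℝ, r = (nrm θ r * Real.cos θ + tng θ r * Real.sin θ,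
      nrm θ r * Real.sin θ - tng θ r * Real.cos θ) := by
    intro r
    have h := Real.sin_sq_add_cos_sq θ
    ext
    · simp only [nrm, tng]; linear_combination -r.1 * h
    · simp only [nrm, tng]; linear_combination -r.2 * h
  rw [key p, key q, h1, h2]

lemma abs_nrm_le (θ : ℝ) (q : ℝ × ℝ) : |nrm θ q| ≤ |q.1| + |q.2| := by
  have h1 := Real.abs_cos_le_one θ
  have h2 := Real.abs_sin_le_one θ
  calc |nrm θ q| ≤ |q.1 * Real.cos θ| + |q.2 * Real.sin θ| := abs_add_le _ _
    _ ≤ |q.1| + |q.2| := by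
      rw [abs_mul, abs_mul]
      nlinarith [abs_nonneg q.1, abs_nonneg q.2]

lemma abs_tng_le (θ : ℝ) (q : ℝ × ℝ) : |tng θ q| ≤ |q.1| + |q.2| := by
  have h1 := Real.abs_cos_le_one θ
  have h2 := Real.abs_sin_le_one θ
  calc |tng θ q| ≤ |q.1 * Real.sin θ| + |q.2 * Real.cos θ| := abs_sub _ _
    _ ≤ |q.1| + |q.2| := by
      rw [abs_mul, abs_mul]
      nlinarith [abs_nonneg q.1, abs_nonneg q.2]

lemma abs_nrm_sub_nrm_le (θ φ : ℝ) (q : ℝ × ℝ) :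
    |nrm θ q - nrm φ q| ≤ |θ - φ| * (|q.1| + |q.2|) := by
  have h1 : |Real.cos θ - Real.cos φ| ≤ |θ - φ| := by
    simpa [Real.dist_eq] using Real.lipschitzWith_cos.dist_le_mul θ φ
  have h2 : |Real.sin θ - Real.sin φ| ≤ |θ - φ| := by
    simpa [Real.dist_eq] using Real.lipschitzWith_sin.dist_le_mul θ φ
  have e : nrm θ q - nrm φ q
      = q.1 * (Real.cos θ - Real.cos φ) + q.2 * (Real.sin θ - Real.sin φ) := by
    simp only [nrm]; ring
  rw [e]
  refine (abs_add_le _ _).trans ?_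
  rw [abs_mul, abs_mul]
  nlinarith [abs_nonneg q.1, abs_nonneg q.2]

lemma cos_eq_of_coe_eq {a b : ℝ} (h : (a : Real.Angle) = b) : Real.cos a = Real.cos b := by
  simpa using congrArg Real.Angle.cos h

lemma sin_eq_of_coe_eq {a b : ℝ} (h : (a : Real.Angle) = b) : Real.sin a = Real.sin b := by
  simpa using congrArg Real.Angle.sin h

lemma nrm_congr {a b : ℝ} (h : (a : Real.Angle) = b) (q : ℝ × ℝ) : nrm a q = nrm b q := by
  simp [nrm, cos_eq_of_coe_eq h, sin_eq_of_coe_eq h]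

lemma tng_congr {a b : ℝ} (h : (a : Real.Angle) = b) (q : ℝ × ℝ) : tng a q = tng b q := by
  simp [tng, cos_eq_of_coe_eq h, sin_eq_of_coe_eq h]

lemma tvec_congr {a b : ℝ} (h : (a : Real.Angle) = b) : tvec a = tvec b := by
  simp [tvec, cos_eq_of_coe_eq h, sin_eq_of_coe_eq h]

/-! ### Headings and angles -/

namespace Heading

lemma cos_dotAngle (h : Heading) : Real.cos h.dotAngle = -h.vec.2 := by
  have e : (3 * Real.pi / 2 : ℝ) = Real.pi / 2 + Real.pi := by ring
  cases h <;> simp [dotAngle, vec, e, Real.cos_add]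

lemma sin_dotAngle (h : Heading) : Real.sin h.dotAngle = h.vec.1 := by
  have e : (3 * Real.pi / 2 : ℝ) = Real.pi / 2 + Real.pi := by ring
  cases h <;> simp [dotAngle, vec, e, Real.sin_add]

lemma tvec_dotAngle (h : Heading) : tvec h.dotAngle = h.vec := by
  simp [tvec, cos_dotAngle, sin_dotAngle]

lemma nrm_dotAngle (h : Heading) (q : ℝ × ℝ) : nrm h.dotAngle q = h.dotHeight q := by
  cases h <;> simp [nrm, cos_dotAngle, sin_dotAngle, vec, dotHeight]

lemma eq_of_coe_dotAngle_eq {h k : Heading}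
    (e : (h.dotAngle : Real.Angle) = k.dotAngle) : h = k := by
  have h1 := cos_eq_of_coe_eq e
  have h2 := sin_eq_of_coe_eq e
  rw [cos_dotAngle, cos_dotAngle] at h1
  rw [sin_dotAngle, sin_dotAngle] at h2
  cases h <;> cases k <;> 
    first | rfl | (exfalso; simp only [vec] at h1 h2; linarith)

end Heading

/-! ### Sequences that are periodic in the index -/

lemma eq_emod_of_periodic {β : Sort*} {n : ℕ} {f : ℤ → β} (h : ∀ i, f (i + n) = f i) (i : ℤ) :
    f (i % n) = f i := by
  have key : ∀ k i : ℤ, f (i + k * n) = f i := by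
    intro k
    induction k using Int.induction_on with
    | zero => simp
    | succ k ih =>
      intro i
      rw [show i + ((k : ℤ) + 1) * n = (i + k * n) + n by ring, h, ih]
    | pred k ih =>
      intro i
      rw [← h, show i + (-(k : ℤ) - 1) * n + n = i + -(k : ℤ) * n by ring, ih]
  conv_rhs => rw [← Int.emod_add_mul_ediv i n, mul_comm, key]

lemma eq_add_mul_of_periodic {β : Sort*} {n : ℕ} {f : ℤ → β} (h : ∀ i, f (i + n) = f i)
    (i k : ℤ) : f (i + k * n) = f i := by
  rw [← eq_emod_of_periodic h, Int.add_mul_emod_self_right, eq_emod_of_periodic h]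

/-- Only finitely many residues occur, so the minimum of the individual constants over one period
works. This is how constants come to depend on the polygon alone. -/
lemma exists_common_pos {n : ℕ} (hn : 0 < n) (Q : ℤ → ℝ → Prop)
    (hper : ∀ i, Q (i + n) = Q i) (hmono : ∀ i D D', D' ≤ D → Q i D → Q i D')
    (h : ∀ i, ∃ D, 0 < D ∧ Q i D) : ∃ D, 0 < D ∧ ∀ i, Q i D := by
  choose D hD hQ using h
  have hne : (Finset.range n).Nonempty := ⟨0, by simpa using hn⟩
  refine ⟨(Finset.range n).inf' hne fun i => D i, ?_, fun i => ?_⟩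
  · rw [Finset.lt_inf'_iff]
    exact fun i _ => hD i
  · rw [← eq_emod_of_periodic hper i]
    have h0 : 0 ≤ i % n := Int.emod_nonneg _ (by positivity)
    have h1 : i % n < n := Int.emod_lt_of_pos _ (by positivity)
    obtain ⟨r, hr⟩ := Int.eq_ofNat_of_zero_le h0
    refine hmono _ (D (i % n)) _ ?_ (hQ _)
    rw [hr]
    exact Finset.inf'_le (fun i : ℕ => D i) (by simp; omega)

lemma exists_common_bound {n : ℕ} (hn : 0 < n) {f : ℤ → ℝ} (hf : ∀ i, f (i + n) = f i) :
    ∃ M, 0 < M ∧ ∀ i, f i ≤ M := by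
  -- An upper bound for `f` is the reciprocal of a common lower bound for the numbers `1 / f i` over
  -- the indices with `f i > 0`.
  obtain ⟨D, hD, h⟩ := exists_common_pos hn (fun i D => f i * D ≤ 1 ∨ f i ≤ 0)
    (fun i => by simp only [hf]) (fun i D D' hDD h => by
      rcases le_or_gt (f i) 0 with h0 | h0
      · exact Or.inr h0
      · rcases h with h | h
        · exact Or.inl (by nlinarith)
        · exact Or.inr h) (fun i => by
      rcases le_or_gt (f i) 0 with h0 | h0
      · exact ⟨1, one_pos, Or.inr h0⟩
      · exact ⟨1 / f i, by positivity, Or.inl (by field_simp; exact le_rfl)⟩)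
  refine ⟨1 / D, by positivity, fun i => ?_⟩
  rcases h i with h | h
  · rw [le_div_iff₀ hD]; exact h
  · exact h.trans (by positivity)

/-! ### Basic facts on rectilinear polygons -/

namespace RectilinearPolygon

variable (P : RectilinearPolygon)

lemma turn_periodic (i : ℤ) : P.turn (i + P.n) = P.turn i := by
  simp only [turn, P.dir_periodic]
  rw [show i + (P.n : ℤ) + 1 = i + 1 + P.n by ring, P.dir_periodic]

lemma dot_periodic (i : ℤ) : P.dot (i + P.n) = P.dot i := by
  simp only [dot, P.dir_periodic, P.vertex_periodic]

lemma turn_eq_or (i : ℤ) : P.turn i = 1 ∨ P.turn i = -1 := by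
  have h := P.right_angle i
  unfold turn
  generalize P.dir i = a at *
  generalize P.dir (i + 1) = b at *
  cases a <;> cases b <;> simp [Heading.IsHorizontal, Heading.vec] at h ⊢

lemma turn_mul_self (i : ℤ) : P.turn i * P.turn i = 1 := by
  rcases P.turn_eq_or i with h | h <;> rw [h] <;> norm_num

lemma abs_turn (i : ℤ) : |P.turn i| = 1 := by
  rcases P.turn_eq_or i with h | h <;> rw [h] <;> norm_num

lemma turn_eq_neg_of_ne {i j : ℤ} (h : P.turn i ≠ P.turn j) : P.turn i = -P.turn j := by
  rcases P.turn_eq_or i with h1 | h1 <;> rcases P.turn_eq_or j with h2 | h2 <;>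
    simp_all

lemma coe_dotAngle_step (i : ℤ) :
    (((P.dir i).dotAngle + P.turn i * (Real.pi / 2) : ℝ) : Real.Angle)
      = (P.dir (i + 1)).dotAngle := by
  have h := P.right_angle i
  unfold turn
  generalize P.dir i = a at *
  generalize P.dir (i + 1) = b at *
  rw [Real.Angle.angle_eq_iff_two_pi_dvd_sub]
  cases a <;> cases b <;> simp [Heading.IsHorizontal, Heading.vec] at h ⊢ <;>
    simp only [Heading.dotAngle]
  · exact ⟨0, by push_cast; ring⟩
  · exact ⟨0, by push_cast; ring⟩
  · exact ⟨0, by push_cast; ring⟩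
  · exact ⟨0, by push_cast; ring⟩
  · exact ⟨0, by push_cast; ring⟩
  -- West and south, at `3π/2` and `0`, are the neighbours for which the chosen representatives
  -- differ by more than a quarter turn.
  · exact ⟨1, by push_cast; ring⟩
  · exact ⟨0, by push_cast; ring⟩
  · exact ⟨-1, by push_cast; ring⟩

lemma dotHeight_succ (i : ℤ) : (P.dir i).dotHeight (P.vertex (i + 1)) = (P.dot i).2 := by
  obtain ⟨l, -, h⟩ := P.edge i
  rw [h]
  simp only [dot]
  cases P.dir i <;> simp [Heading.dotHeight, Heading.vec]

/-- One edge cannot alternate with itself, and two perpendicular edges of positive length cannot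
close up. -/
lemma three_le_n : 3 ≤ P.n := by
  have h0 := P.n_pos
  by_contra hlt
  have hn : P.n = 1 ∨ P.n = 2 := by omega
  rcases hn with hn | hn
  · have h := P.right_angle 0
    have h1 := P.dir_periodic 0
    rw [hn] at h1
    norm_num at h1 h
    rw [h1] at h
    tauto
  · have h := P.right_angle 0
    have h1 := P.vertex_periodic 0
    rw [hn] at h1
    obtain ⟨l0, hl0, e0⟩ := P.edge 0
    obtain ⟨l1, hl1, e1⟩ := P.edge 1
    norm_num at h1 e0 e1 h
    rw [e1, e0] at h1
    generalize P.dir 0 = a at *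
    generalize P.dir 1 = b at *
    have h2 := congrArg Prod.fst h1
    have h3 := congrArg Prod.snd h1
    cases a <;> cases b <;> simp [Heading.IsHorizontal, Heading.vec] at h h2 h3 <;> linarith

/-- This rules out a crosswise coincidence of two corners, in which `i ≡ j + 1` and `i + 1 ≡ j`
modulo `n`. -/
lemma not_n_dvd_two : ¬ (P.n : ℤ) ∣ 2 := fun h => by
  have := Int.le_of_dvd (by norm_num) h
  have := P.three_le_n
  omega

/-- Distinct parallel edges lie on lines whose distance is bounded below. -/
lemma exists_separation : ∃ D, 0 < D ∧ ∀ i j : ℤ,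
    ((P.dir i).IsHorizontal ↔ (P.dir j).IsHorizontal) → ∀ q : ℝ × ℝ,
    |(P.dir i).dotHeight q - (P.dot i).2| < D → |(P.dir j).dotHeight q - (P.dot j).2| < D →
    (P.n : ℤ) ∣ i - j := by
  obtain ⟨D, hD, h⟩ := exists_common_pos P.n_pos (fun i D => ∀ j : ℤ,
    ((P.dir i).IsHorizontal ↔ (P.dir j).IsHorizontal) → ∀ q : ℝ × ℝ,
    |(P.dir i).dotHeight q - (P.dot i).2| < D → |(P.dir j).dotHeight q - (P.dot j).2| < D →
    (P.n : ℤ) ∣ i - j) (fun i => by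
      funext D
      simp only [P.dir_periodic, P.dot_periodic, eq_iff_iff]
      refine forall_congr' fun j => ?_
      rw [show i + (P.n : ℤ) - j = i - j + P.n by ring]
      simp)
    (fun i D D' hDD h j hij q h1 h2 =>
      h j hij q (h1.trans_le hDD) (h2.trans_le hDD)) (fun i => by
    refine exists_common_pos P.n_pos (fun j D =>
      ((P.dir i).IsHorizontal ↔ (P.dir j).IsHorizontal) → ∀ q : ℝ × ℝ,
      |(P.dir i).dotHeight q - (P.dot i).2| < D → |(P.dir j).dotHeight q - (P.dot j).2| < D →
      (P.n : ℤ) ∣ i - j) ?_ ?_ ?_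
    · intro j
      funext D
      simp only [P.dir_periodic, P.dot_periodic, eq_iff_iff]
      rw [show i - (j + (P.n : ℤ)) = i - j - P.n by ring]
      simp
    · intro j D D' hDD h hij q h1 h2
      exact h hij q (h1.trans_le hDD) (h2.trans_le hDD)
    · intro j
      by_cases hdvd : (P.n : ℤ) ∣ i - j
      · exact ⟨1, one_pos, fun _ _ _ _ => hdvd⟩
      have hh := P.horizontal_distinct i j
      have hv := P.vertical_distinct i j
      by_cases hor : (P.dir i).IsHorizontal
      · by_cases hor' : (P.dir j).IsHorizontal
        · have hne : (P.vertex i).2 ≠ (P.vertex j).2 := fun e => hdvd (hh hor hor' e)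
          refine ⟨|(P.vertex i).2 - (P.vertex j).2| / 2, by
            have := abs_pos.2 (sub_ne_zero.2 hne); linarith, fun _ q h1 h2 => ?_⟩
          exfalso
          simp only [dot] at h1 h2
          generalize P.dir i = a at *
          generalize P.dir j = b at *
          cases a <;> cases b <;> simp [Heading.IsHorizontal, Heading.dotHeight] at hor hor' h1 h2 <;>
            rcases abs_cases ((P.vertex i).2 - (P.vertex j).2) with ⟨e, _⟩ | ⟨e, _⟩ <;>
            rw [e, abs_lt] at h1 h2 <;> linarith
        · exact ⟨1, one_pos, fun e => absurd (e.1 hor) hor'⟩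
      · by_cases hor' : (P.dir j).IsHorizontal
        · exact ⟨1, one_pos, fun e => absurd (e.2 hor') hor⟩
        · have hne : (P.vertex i).1 ≠ (P.vertex j).1 := fun e => hdvd (hv hor hor' e)
          refine ⟨|(P.vertex i).1 - (P.vertex j).1| / 2, by
            have := abs_pos.2 (sub_ne_zero.2 hne); linarith, fun _ q h1 h2 => ?_⟩
          exfalso
          simp only [dot] at h1 h2
          generalize P.dir i = a at *
          generalize P.dir j = b at *
          cases a <;> cases b <;> simp [Heading.IsHorizontal, Heading.dotHeight] at hor hor' h1 h2 <;>
            rcases abs_cases ((P.vertex i).1 - (P.vertex j).1) with ⟨e, _⟩ | ⟨e, _⟩ <;>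
            rw [e, abs_lt] at h1 h2 <;> linarith)
  exact ⟨D, hD, h⟩

lemma exists_point_dotHeight (h : Heading) (x : ℝ) : ∃ q : ℝ × ℝ, h.dotHeight q = x := by
  cases h
  · exact ⟨(0, x), rfl⟩
  · exact ⟨(-x, 0), by simp [Heading.dotHeight]⟩
  · exact ⟨(0, -x), by simp [Heading.dotHeight]⟩
  · exact ⟨(x, 0), rfl⟩

lemma exists_bound : ∃ M, 0 < M ∧ ∀ i, |(P.vertex i).1| + |(P.vertex i).2| ≤ M :=
  exists_common_bound P.n_pos fun i => by rw [P.vertex_periodic]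

/-- A lift of the angles of the dots to `ℝ` which follows the polygonal path. -/
structure IsAngleLift (α : ℤ → ℝ) : Prop where
  coe : ∀ i, (α i : Real.Angle) = (P.dir i).dotAngle
  step : ∀ i, α (i + 1) = α i + P.turn i * (Real.pi / 2)

variable {P}

namespace IsAngleLift

variable {α : ℤ → ℝ}

lemma vec (hα : P.IsAngleLift α) (i : ℤ) : (P.dir i).vec = tvec (α i) := by
  rw [tvec_congr (hα.coe i), Heading.tvec_dotAngle]

lemma dotHeight (hα : P.IsAngleLift α) (i : ℤ) (q : ℝ × ℝ) :
    (P.dir i).dotHeight q = nrm (α i) q := by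
  rw [nrm_congr (hα.coe i), Heading.nrm_dotAngle]

lemma nrm_vertex (hα : P.IsAngleLift α) (i : ℤ) : nrm (α i) (P.vertex i) = (P.dot i).2 := by
  rw [← hα.dotHeight]; rfl

lemma nrm_vertex_succ (hα : P.IsAngleLift α) (i : ℤ) :
    nrm (α i) (P.vertex (i + 1)) = (P.dot i).2 := by
  rw [← hα.dotHeight, dotHeight_succ]

/-- A quarter turn exchanges normal and tangential coordinates up to sign. Hence the normal
coordinates at two consecutive dots together locate a point of the plane. -/
lemma nrm_succ (hα : P.IsAngleLift α) (i : ℤ) (q : ℝ × ℝ) :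
    nrm (α (i + 1)) q = -P.turn i * tng (α i) q := by
  rw [hα.step, nrm_angle_add]
  rcases P.turn_eq_or i with h | h <;> rw [h] <;> simp

lemma tng_succ (hα : P.IsAngleLift α) (i : ℤ) (q : ℝ × ℝ) :
    tng (α (i + 1)) q = P.turn i * nrm (α i) q := by
  rw [hα.step, tng_angle_add]
  rcases P.turn_eq_or i with h | h <;> rw [h] <;> simp

lemma dir_eq (hα : P.IsAngleLift α) {i j : ℤ} (h : (α i : Real.Angle) = α j) : P.dir i = P.dir j :=
  Heading.eq_of_coe_dotAngle_eq (by rw [← hα.coe, ← hα.coe, h])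

end IsAngleLift

end RectilinearPolygon

/-! ### Primitives -/

section Primitive

variable {E : Type*} [NormedAddCommGroup E] [NormedSpace ℝ E]

lemma sub_eq_sub_of_hasDerivAt {F G f : ℝ → E} {x y : ℝ} (hxy : x ≤ y)
    (hF : ∀ t ∈ Set.Icc x y, HasDerivAt F (f t) t)
    (hG : ∀ t ∈ Set.Icc x y, HasDerivAt G (f t) t) : F y - F x = G y - G x := by
  have h := constant_of_has_deriv_right_zero (f := F - G) (a := x) (b := y)
    (fun t ht => ((hF t ht).continuousAt.sub (hG t ht).continuousAt).continuousWithinAt)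
    (fun t ht => by
      have := (hF t ⟨ht.1, ht.2.le⟩).sub (hG t ⟨ht.1, ht.2.le⟩)
      rw [sub_self] at this
      exact this.hasDerivWithinAt) y ⟨hxy, le_rfl⟩
  simp only [Pi.sub_apply] at h
  rw [sub_eq_sub_iff_sub_eq_sub]
  exact h

lemma eq_of_hasDerivAt_zero {F : ℝ → E} {x y : ℝ} (hxy : x ≤ y)
    (hF : ∀ t ∈ Set.Icc x y, HasDerivAt F 0 t) : F y = F x := by
  have := sub_eq_sub_of_hasDerivAt (G := fun _ => (0 : E)) hxy hF
    (fun t _ => hasDerivAt_const t 0)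
  simpa [sub_eq_zero] using this

lemma exists_primitive [CompleteSpace E] {f : ℝ → E} (hf : ContDiff ℝ ∞ f) (t₀ : ℝ) (c : E) :
    ∃ F : ℝ → E, ContDiff ℝ ∞ F ∧ (∀ t, HasDerivAt F (f t) t) ∧ F t₀ = c := by
  have hd : ∀ t, HasDerivAt (fun t => c + ∫ s in t₀..t, f s) (f t) t := fun t => by
    have := intervalIntegral.integral_hasDerivAt_right (hf.continuous.intervalIntegrable t₀ t)
      (hf.continuous.stronglyMeasurableAtFilter _ _) hf.continuous.continuousAt
    exact this.const_add c
  refine ⟨_, ?_, hd, by simp⟩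
  rw [contDiff_infty_iff_deriv]
  refine ⟨fun t => (hd t).differentiableAt, ?_⟩
  rw [show deriv (fun t => c + ∫ s in t₀..t, f s) = f from funext fun t => (hd t).deriv]
  exact hf

/-- If the derivative is periodic, then the increment over a period is constant. -/
lemma shift_sub_eq {F f : ℝ → E} (hF : ∀ t, HasDerivAt F (f t) t) (hf : Function.Periodic f 1)
    (s t : ℝ) : F (t + 1) - F t = F (s + 1) - F s := by
  have h : ∀ x, HasDerivAt (fun x => F (x + 1) - F x) 0 x := fun x => by
    have h1 := (hF (x + 1)).scomp x ((hasDerivAt_id x).add_const 1)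
    have h2 := h1.sub (hF x)
    rw [one_smul, hf x, sub_self] at h2
    exact h2
  exact is_const_of_deriv_eq_zero (fun x => (h x).differentiableAt) (fun x => (h x).deriv) t s

end Primitive

lemma int_seq_const {β : Type*} {f : ℤ → β} (h : ∀ i, f (i + 1) = f i) (i : ℤ) : f i = f 0 := by
  induction i using Int.induction_on with
  | zero => rfl
  | succ k ih => rw [h, ih]
  | pred k ih => rw [← h, sub_add_cancel, ih]

/-! ### Periodic bump functions -/

/-- A smooth `1`-periodic function which is positive on `(x, y)` and vanishes on `[y, x + 1]`. -/
def bumpProfile (x y t : ℝ) : ℝ :=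
  expNegInvGlue (Real.cos (2 * Real.pi * (t - (x + y) / 2)) - Real.cos (Real.pi * (y - x)))

lemma bumpProfile_contDiff (x y : ℝ) : ContDiff ℝ ∞ (bumpProfile x y) := by
  unfold bumpProfile
  refine (expNegInvGlue.contDiff (n := ⊤)).comp ?_
  fun_prop

lemma bumpProfile_nonneg (x y t : ℝ) : 0 ≤ bumpProfile x y t := expNegInvGlue.nonneg _

lemma bumpProfile_periodic (x y : ℝ) : Function.Periodic (bumpProfile x y) 1 := by
  intro t
  unfold bumpProfile
  rw [show 2 * Real.pi * (t + 1 - (x + y) / 2)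
    = 2 * Real.pi * (t - (x + y) / 2) + 2 * Real.pi by ring, Real.cos_add_two_pi]

lemma bumpProfile_shift (x y : ℝ) : bumpProfile (x + 1) (y + 1) = bumpProfile x y := by
  funext t
  have := bumpProfile_periodic x y (t - 1)
  rw [sub_add_cancel] at this
  rw [this]
  unfold bumpProfile
  rw [show t - (x + 1 + (y + 1)) / 2 = t - 1 - (x + y) / 2 by ring,
    show y + 1 - (x + 1) = y - x by ring]

/-- The cosine decreases strictly on `[0, π]`, and `t` is closer to the midpoint than half the
length; `y < x + 1` keeps the arguments in that range. -/
lemma bumpProfile_pos {x y t : ℝ} (hy : y < x + 1) (ht : t ∈ Set.Ioo x y) :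
    0 < bumpProfile x y t := by
  refine expNegInvGlue.pos_of_pos (sub_pos.2 ?_)
  have hpi := Real.pi_pos
  obtain ⟨h1, h2⟩ := ht
  rw [← Real.cos_abs (2 * Real.pi * (t - (x + y) / 2))]
  refine Real.cos_lt_cos_of_nonneg_of_le_pi (abs_nonneg _) (by nlinarith) ?_
  rw [abs_lt]
  constructor <;> nlinarith

lemma bumpProfile_eq_zero {x y t : ℝ} (hxy : x < y) (ht : t ∈ Set.Icc y (x + 1)) :
    bumpProfile x y t = 0 := by
  refine expNegInvGlue.zero_of_nonpos (sub_nonpos.2 ?_)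
  have hpi := Real.pi_pos
  obtain ⟨h1, h2⟩ := ht
  rcases le_total (t - (x + y) / 2) (1 / 2) with h | h
  · exact Real.cos_le_cos_of_nonneg_of_le_pi (by nlinarith) (by nlinarith) (by nlinarith)
  -- Beyond the antipode of the midpoint, the distance on the circle is measured the other way
  -- round.
  · rw [← Real.cos_two_pi_sub]
    exact Real.cos_le_cos_of_nonneg_of_le_pi (by nlinarith) (by nlinarith) (by nlinarith)

/-- The normalised periodic bump function on `(x, y)`. -/
def bump (x y t : ℝ) : ℝ := (∫ s in x..y, bumpProfile x y s)⁻¹ * bumpProfile x y t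

lemma integral_bumpProfile_pos {x y : ℝ} (hxy : x < y) (hy : y < x + 1) :
    0 < ∫ s in x..y, bumpProfile x y s :=
  intervalIntegral.intervalIntegral_pos_of_pos_on
    ((bumpProfile_contDiff x y).continuous.intervalIntegrable _ _)
    (fun _ ht => bumpProfile_pos hy ht) hxy

lemma bump_contDiff (x y : ℝ) : ContDiff ℝ ∞ (bump x y) :=
  contDiff_const.mul (bumpProfile_contDiff x y)

lemma bump_periodic (x y : ℝ) : Function.Periodic (bump x y) 1 := fun t => by
  simp only [bump, bumpProfile_periodic x y t]

lemma bump_nonneg {x y : ℝ} (hxy : x < y) (t : ℝ) : 0 ≤ bump x y t :=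
  mul_nonneg (inv_nonneg.2 (intervalIntegral.integral_nonneg hxy.le
    fun s _ => bumpProfile_nonneg x y s)) (bumpProfile_nonneg x y t)

lemma bump_pos {x y t : ℝ} (hy : y < x + 1) (ht : t ∈ Set.Ioo x y) : 0 < bump x y t :=
  mul_pos (inv_pos.2 (integral_bumpProfile_pos (ht.1.trans ht.2) hy)) (bumpProfile_pos hy ht)

lemma bump_eq_zero {x y t : ℝ} (hxy : x < y) (ht : t ∈ Set.Icc y (x + 1)) : bump x y t = 0 := by
  rw [bump, bumpProfile_eq_zero hxy ht, mul_zero]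

lemma bump_eq_zero_left {x y t : ℝ} (hxy : x < y) (ht : t ∈ Set.Icc (y - 1) x) :
    bump x y t = 0 := by
  rw [← bump_periodic x y t]
  exact bump_eq_zero hxy ⟨by linarith [ht.1], by linarith [ht.2]⟩

lemma bump_shift (x y : ℝ) : bump (x + 1) (y + 1) = bump x y := by
  funext t
  unfold bump
  rw [bumpProfile_shift]
  congr 2
  rw [← intervalIntegral.integral_comp_add_right]
  exact intervalIntegral.integral_congr fun s _ => bumpProfile_periodic x y s

lemma integral_bump {x y : ℝ} (hxy : x < y) (hy : y < x + 1) : ∫ s in x..y, bump x y s = 1 := by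
  unfold bump
  rw [intervalIntegral.integral_const_mul, inv_mul_cancel₀ (integral_bumpProfile_pos hxy hy).ne']

/-- The primitive of the bump function on `(x, y)`, a smooth step from `0` to `1`. -/
def step (x y t : ℝ) : ℝ := ∫ s in x..t, bump x y s

lemma step_hasDerivAt (x y t : ℝ) : HasDerivAt (step x y) (bump x y t) t :=
  intervalIntegral.integral_hasDerivAt_right ((bump_contDiff x y).continuous.intervalIntegrable _ _)
    ((bump_contDiff x y).continuous.stronglyMeasurableAtFilter _ _)
    (bump_contDiff x y).continuous.continuousAt

lemma step_left (x y : ℝ) : step x y x = 0 := by simp [step]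

lemma step_right {x y : ℝ} (hxy : x < y) (hy : y < x + 1) : step x y y = 1 := integral_bump hxy hy

lemma step_mono {x y : ℝ} (hxy : x < y) : Monotone (step x y) :=
  monotone_of_hasDerivAt_nonneg (step_hasDerivAt x y) (fun t => bump_nonneg hxy t)

lemma step_eq_one {x y t : ℝ} (hxy : x < y) (hy : y < x + 1) (ht : t ∈ Set.Icc y (x + 1)) :
    step x y t = 1 := by
  rw [← step_right hxy hy]
  refine eq_of_hasDerivAt_zero ht.1 fun s hs => ?_
  rw [← bump_eq_zero hxy ⟨hs.1, hs.2.trans ht.2⟩]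
  exact step_hasDerivAt x y s

lemma step_nonneg {x y t : ℝ} (hxy : x < y) (ht : x ≤ t) : 0 ≤ step x y t := by
  rw [← step_left x y]; exact step_mono hxy ht

lemma step_le_one {x y t : ℝ} (hxy : x < y) (hy : y < x + 1) (ht : t ≤ x + 1) :
    step x y t ≤ 1 := by
  rw [← step_eq_one hxy hy ⟨hy.le, le_rfl⟩]; exact step_mono hxy ht

/-! ### Sums of bumps over a subdivision -/

namespace IsSubdivision

variable {n : ℕ} {a b : ℤ → ℝ}

lemma strictMono_a (h : IsSubdivision n a b) : StrictMono a :=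
  strictMono_int_of_lt_succ fun i => (h.lt i).trans (h.lt_next i)

lemma strictMono_b (h : IsSubdivision n a b) : StrictMono b :=
  strictMono_int_of_lt_succ fun i => (h.lt_next i).trans (h.lt (i + 1))

lemma lt_of_lt (h : IsSubdivision n a b) {i j : ℤ} (hij : i < j) : b i < a j :=
  (h.lt_next i).trans_le (h.strictMono_a.monotone hij)

lemma n_pos (h : IsSubdivision n a b) : 0 < n := by
  rcases Nat.eq_zero_or_pos n with h0 | h0
  · have := h.shift_a 0
    rw [h0] at this
    simp at this
  · exact h0

lemma lt_add_one (h : IsSubdivision n a b) (i : ℤ) : b i < a i + 1 := by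
  rw [← h.shift_a]
  exact h.lt_of_lt (by have := h.n_pos; omega)

lemma next_le (h : IsSubdivision n a b) (i : ℤ) : a (i + 1) ≤ a i + 1 := by
  rw [← h.shift_a]
  exact h.strictMono_a.monotone (by have := h.n_pos; omega)

lemma rotate (h : IsSubdivision n a b) : IsSubdivision n b (fun i => a (i + 1)) where
  lt := h.lt_next
  lt_next i := h.lt (i + 1)
  shift_a := h.shift_b
  shift_b i := by rw [show i + (n : ℤ) + 1 = i + 1 + n by ring, h.shift_a]

lemma shift_a_mul (h : IsSubdivision n a b) (i k : ℤ) : a (i + k * n) = a i + k := by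
  have : ∀ i, a (i + n) - ((i + n : ℤ) : ℝ) / n = a i - (i : ℝ) / n := fun i => by
    rw [h.shift_a]
    have : (n : ℝ) ≠ 0 := by exact_mod_cast h.n_pos.ne'
    push_cast
    field_simp
    ring
  have h2 := eq_add_mul_of_periodic (f := fun i => a i - (i : ℝ) / n) this i k
  have h3 : (n : ℝ) ≠ 0 := by exact_mod_cast h.n_pos.ne'
  push_cast at h2
  field_simp at h2
  have h4 : (n : ℝ) * (a (i + k * n) - (a i + k)) = 0 := by linear_combination h2
  rcases mul_eq_zero.1 h4 with h5 | h5
  · exact absurd h5 h3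
  · linarith

lemma shift_b_mul (h : IsSubdivision n a b) (i k : ℤ) : b (i + k * n) = b i + k :=
  h.rotate.shift_a_mul i k

lemma exists_mem (h : IsSubdivision n a b) (t : ℝ) : ∃ j, t ∈ Set.Ico (a j) (a (j + 1)) := by
  obtain ⟨j, hj, hmax⟩ := Int.exists_greatest_of_bdd (P := fun i => a i ≤ t)
    ⟨0 + ⌈t - a 0⌉ * n, fun i hi => by
      by_contra hlt
      push Not at hlt
      have h1 := h.strictMono_a hlt
      rw [h.shift_a_mul] at h1
      linarith [Int.le_ceil (t - a 0)]⟩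
    ⟨0 + ⌊t - a 0⌋ * n, by rw [h.shift_a_mul]; linarith [Int.floor_le (t - a 0)]⟩
  refine ⟨j, hj, ?_⟩
  by_contra hle
  push Not at hle
  have := hmax (j + 1) hle
  omega

lemma exists_mem_Icc (h : IsSubdivision n a b) (t : ℝ) :
    ∃ j, t ∈ Set.Icc (a j) (b j) ∨ t ∈ Set.Icc (b j) (a (j + 1)) := by
  obtain ⟨j, hj⟩ := h.exists_mem t
  refine ⟨j, ?_⟩
  rcases le_total t (b j) with hb | hb
  · exact Or.inl ⟨hj.1, hb⟩
  · exact Or.inr ⟨hb, hj.2.le⟩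

end IsSubdivision

section BumpSum

variable {E : Type*} [NormedAddCommGroup E] [NormedSpace ℝ E]

/-- The sum of the bumps on the intervals `(a i, b i)`, weighted by the functions `c i`. -/
def bumpSum (n : ℕ) (a b : ℤ → ℝ) (c : ℤ → ℝ → E) (t : ℝ) : E :=
  ∑ i ∈ Finset.range n, bump (a i) (b i) t • c i t

lemma bumpSum_contDiff (n : ℕ) (a b : ℤ → ℝ) {c : ℤ → ℝ → E} (hc : ∀ i, ContDiff ℝ ∞ (c i)) :
    ContDiff ℝ ∞ (bumpSum n a b c) :=
  ContDiff.sum fun i _ => (bump_contDiff _ _).smul (hc i)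

lemma bumpSum_periodic (n : ℕ) (a b : ℤ → ℝ) {c : ℤ → ℝ → E}
    (hc : ∀ i, Function.Periodic (c i) 1) : Function.Periodic (bumpSum n a b c) 1 := fun t => by
  simp only [bumpSum, bump_periodic _ _ t, hc _ t]

/-- Between the end of bump `j - 1` and the start of bump `j + 1`, bump `j` is the only one that can
be nonzero. -/
lemma bumpSum_apply' {n : ℕ} {a b : ℤ → ℝ} (h : IsSubdivision n a b) {c : ℤ → ℝ → E}
    (hc : ∀ i, c (i + n) = c i) {j : ℤ} {t : ℝ} (ht : t ∈ Set.Icc (b (j - 1)) (a (j + 1))) :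
    bumpSum n a b c t = bump (a j) (b j) t • c j t := by
  have hper : ∀ i, bump (a (i + n)) (b (i + n)) = bump (a i) (b i) := fun i => by
    rw [h.shift_a, h.shift_b, bump_shift]
  have hn : (0 : ℤ) < n := by exact_mod_cast h.n_pos
  have h0 : 0 ≤ j % n := Int.emod_nonneg _ hn.ne'
  have h1 : j % n < n := Int.emod_lt_of_pos _ hn
  obtain ⟨r, hr⟩ := Int.eq_ofNat_of_zero_le h0
  unfold bumpSum
  rw [Finset.sum_eq_single r]
  · rw [show ((r : ℕ) : ℤ) = j % n from hr.symm, eq_emod_of_periodic (f := c) hc j,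
      eq_emod_of_periodic (f := fun i => bump (a i) (b i)) hper j]
  · intro i hi hir
    have hi' : (i : ℤ) < n := by exact_mod_cast Finset.mem_range.1 hi
    -- The index `i` may be replaced by `j + d` with `0 < d < n`. That bump starts no earlier than
    -- `a (j + 1)`, and its preceding copy ends no later than `b (j - 1)`.
    set d := ((i : ℤ) - j) % n with hd
    have hd0 : 0 ≤ d := Int.emod_nonneg _ hn.ne'
    have hd1 : d < n := Int.emod_lt_of_pos _ hn
    have hdne : d ≠ 0 := by
      intro h0'
      rw [hd] at h0'
      have h2 := Int.emod_emod_of_dvd (i : ℤ) (dvd_refl (n : ℤ))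
      have h3 := (Int.emod_eq_emod_iff_emod_sub_eq_zero).2 h0'
      rw [Int.emod_eq_of_lt (by positivity) hi'] at h3
      omega
    have e : bump (a i) (b i) = bump (a (j + d)) (b (j + d)) := by
      have hdd := Int.emod_add_mul_ediv ((i : ℤ) - j) n
      have : (i : ℤ) = (j + d) + ((i : ℤ) - j) / n * n := by rw [hd]; linarith
      rw [this]
      exact eq_add_mul_of_periodic (f := fun i => bump (a i) (b i)) hper _ _
    rw [e, bump_eq_zero_left (h.lt _), zero_smul]
    refine ⟨?_, ht.2.trans (h.strictMono_a.monotone (by omega))⟩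
    have : b (j + d) = b (j + d - n) + 1 := by rw [← h.shift_b, sub_add_cancel]
    rw [this, add_sub_cancel_right]
    exact (h.strictMono_b.monotone (by omega)).trans ht.1
  · intro hr'
    exact absurd (Finset.mem_range.2 (by omega)) hr'

lemma bumpSum_apply {n : ℕ} {a b : ℤ → ℝ} (h : IsSubdivision n a b) {c : ℤ → ℝ → E}
    (hc : ∀ i, c (i + n) = c i) {j : ℤ} {t : ℝ} (ht : t ∈ Set.Icc (a j) (a (j + 1))) :
    bumpSum n a b c t = bump (a j) (b j) t • c j t :=
  bumpSum_apply' h hc ⟨(h.lt_of_lt (by omega)).le.trans ht.1, ht.2⟩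

lemma bumpSum_eq_zero {n : ℕ} {a b : ℤ → ℝ} (h : IsSubdivision n a b) {c : ℤ → ℝ → E}
    (hc : ∀ i, c (i + n) = c i) {j : ℤ} {t : ℝ} (ht : t ∈ Set.Icc (b j) (a (j + 1))) :
    bumpSum n a b c t = 0 := by
  rw [bumpSum_apply h hc ⟨(h.lt j).le.trans ht.1, ht.2⟩,
    bump_eq_zero (h.lt j) ⟨ht.1, ht.2.trans (h.next_le j)⟩, zero_smul]

end BumpSum

/-! ### Matching two subdivisions by a reparametrization -/

/-- The derivative of `φ` is a small constant `k` plus one bump of integral one per interval,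
weighted so that each increment is the prescribed one. The weights are nonnegative because `k` is at
most every target length while the source intervals have length at most one. -/
lemma exists_reparametrization {n : ℕ} {a b A B : ℤ → ℝ} (h : IsSubdivision n a b)
    (H : IsSubdivision n A B) :
    ∃ φ, IsReparametrization φ ∧ ∀ i, φ (a i) = A i ∧ φ (b i) = B i := by
  obtain ⟨k, hk, hkk⟩ := exists_common_pos h.n_pos
    (fun i k => k ≤ B i - A i ∧ k ≤ A (i + 1) - B i)
    (fun i => by
      funext k
      rw [show i + (n : ℤ) + 1 = i + 1 + n by ring, H.shift_a, H.shift_b, H.shift_a]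
      simp [add_sub_add_right_eq_sub])
    (fun i D D' hDD hD => ⟨hDD.trans hD.1, hDD.trans hD.2⟩)
    (fun i => ⟨min (B i - A i) (A (i + 1) - B i), lt_min (sub_pos.2 (H.lt i))
      (sub_pos.2 (H.lt_next i)), min_le_left _ _, min_le_right _ _⟩)
  set u : ℤ → ℝ := fun i => B i - A i - k * (b i - a i) with hu
  set w : ℤ → ℝ := fun i => A (i + 1) - B i - k * (a (i + 1) - b i) with hw
  have huper : ∀ i, (fun _ : ℝ => u (i + n)) = fun _ => u i := fun i => by
    simp only [hu, h.shift_a, h.shift_b, H.shift_a, H.shift_b, add_sub_add_right_eq_sub]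
  have hwper : ∀ i, (fun _ : ℝ => w (i + n)) = fun _ => w i := fun i => by
    simp only [hw, show i + (n : ℤ) + 1 = i + 1 + n by ring, h.shift_a, h.shift_b, H.shift_a,
      H.shift_b, add_sub_add_right_eq_sub]
  have hu0 : ∀ i, 0 ≤ u i := fun i => by
    have h1 := (hkk i).1
    have h2 := h.lt_add_one i
    simp only [hu]
    nlinarith
  have hw0 : ∀ i, 0 ≤ w i := fun i => by
    have h1 := (hkk i).2
    have h2 := h.next_le i
    have h3 := h.lt i
    simp only [hw]
    nlinarith
  set f : ℝ → ℝ := fun t => k + bumpSum n a b (fun i _ => u i) t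
    + bumpSum n b (fun i => a (i + 1)) (fun i _ => w i) t with hf
  have hfs : ContDiff ℝ ∞ f := (contDiff_const.add
    (bumpSum_contDiff _ _ _ fun i => contDiff_const)).add
    (bumpSum_contDiff _ _ _ fun i => contDiff_const)
  obtain ⟨φ, hφs, hφ, hφ0⟩ := exists_primitive hfs (a 0) (A 0)
  have hfper : Function.Periodic f 1 := fun t => by
    simp only [hf, bumpSum_periodic n a b (c := fun i _ => u i) (fun i _ => rfl) t,
      bumpSum_periodic n b (fun i => a (i + 1)) (c := fun i _ => w i) (fun i _ => rfl) t]
  have hf1 : ∀ i, ∀ t ∈ Set.Icc (a i) (b i), f t = k + bump (a i) (b i) t * u i := by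
    intro i t ht
    simp only [hf]
    rw [bumpSum_apply h huper ⟨ht.1, ht.2.trans (h.lt_next i).le⟩,
      bumpSum_eq_zero h.rotate hwper (j := i - 1) (by simpa using ht)]
    simp
  have hf2 : ∀ i, ∀ t ∈ Set.Icc (b i) (a (i + 1)),
      f t = k + bump (b i) (a (i + 1)) t * w i := by
    intro i t ht
    simp only [hf]
    rw [bumpSum_eq_zero h huper ht,
      bumpSum_apply h.rotate hwper ⟨ht.1, ht.2.trans (h.lt (i + 1)).le⟩]
    simp
  have hab : ∀ i, φ (b i) - φ (a i) = B i - A i := by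
    intro i
    have := sub_eq_sub_of_hasDerivAt (F := φ)
      (G := fun t => k * t + step (a i) (b i) t * u i) (h.lt i).le (fun t _ => hφ t)
      (fun t ht => by
        rw [hf1 i t ht]
        simpa using ((hasDerivAt_id t).const_mul k).fun_add ((step_hasDerivAt _ _ t).mul_const (u i)))
    rw [this, step_left, step_right (h.lt i) (h.lt_add_one i)]
    simp only [hu]
    ring
  have hba : ∀ i, φ (a (i + 1)) - φ (b i) = A (i + 1) - B i := by
    intro i
    have := sub_eq_sub_of_hasDerivAt (F := φ)
      (G := fun t => k * t + step (b i) (a (i + 1)) t * w i) (h.lt_next i).le (fun t _ => hφ t)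
      (fun t ht => by
        rw [hf2 i t ht]
        simpa using ((hasDerivAt_id t).const_mul k).fun_add ((step_hasDerivAt _ _ t).mul_const (w i)))
    rw [this, step_left, step_right (h.lt_next i) (h.rotate.lt_add_one i)]
    simp only [hw]
    ring
  have hA : ∀ i, φ (a i) = A i := by
    intro i
    have := int_seq_const (f := fun i => φ (a i) - A i)
      (fun i => by linarith [hab i, hba i]) i
    simp only [hφ0, sub_self] at this
    linarith
  refine ⟨φ, ⟨hφs, fun t => ?_, fun t => ?_⟩, fun i => ⟨hA i, by linarith [hab i, hA i]⟩⟩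
  · rw [(hφ t).deriv]
    obtain ⟨i, ht | ht⟩ := h.exists_mem_Icc t
    · rw [hf1 i t ht]
      have := mul_nonneg (bump_nonneg (h.lt i) t) (hu0 i)
      linarith
    · rw [hf2 i t ht]
      have := mul_nonneg (bump_nonneg (h.lt_next i) t) (hw0 i)
      linarith
  · have h1 := shift_sub_eq hφ hfper (a 0) t
    have h2 := hA (0 + n)
    rw [h.shift_a, H.shift_a] at h2
    rw [h2, hφ0] at h1
    linarith

/-! ### The conormal lift of a plane curve with given angle function -/

lemma hasDerivAt_nrm {Θ : ℝ → ℝ} {q : ℝ → ℝ × ℝ} {Θ' t : ℝ} {q' : ℝ × ℝ}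
    (hΘ : HasDerivAt Θ Θ' t) (hq : HasDerivAt q q' t) :
    HasDerivAt (fun t => nrm (Θ t) (q t)) (nrm (Θ t) q' - tng (Θ t) (q t) * Θ') t := by
  have h1 : HasDerivAt (fun t => (q t).1) q'.1 t := hq.fst
  have h2 : HasDerivAt (fun t => (q t).2) q'.2 t := hq.snd
  have := (h1.fun_mul hΘ.cos).fun_add (h2.fun_mul hΘ.sin)
  refine this.congr_deriv ?_
  simp only [nrm, tng]
  ring

lemma hasDerivAt_tng {Θ : ℝ → ℝ} {q : ℝ → ℝ × ℝ} {Θ' t : ℝ} {q' : ℝ × ℝ}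
    (hΘ : HasDerivAt Θ Θ' t) (hq : HasDerivAt q q' t) :
    HasDerivAt (fun t => tng (Θ t) (q t)) (tng (Θ t) q' + nrm (Θ t) (q t) * Θ') t := by
  have h1 : HasDerivAt (fun t => (q t).1) q'.1 t := hq.fst
  have h2 : HasDerivAt (fun t => (q t).2) q'.2 t := hq.snd
  have := (h1.fun_mul hΘ.sin).fun_sub (h2.fun_mul hΘ.cos)
  refine this.congr_deriv ?_
  simp only [nrm, tng]
  ring

lemma contDiff_nrm {X : Type*} [NormedAddCommGroup X] [NormedSpace ℝ X] {Θ : X → ℝ}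
    {q : X → ℝ × ℝ} (hΘ : ContDiff ℝ ∞ Θ) (hq : ContDiff ℝ ∞ q) :
    ContDiff ℝ ∞ (fun t => nrm (Θ t) (q t)) := by
  unfold nrm; fun_prop

lemma contDiff_tng {X : Type*} [NormedAddCommGroup X] [NormedSpace ℝ X] {Θ : X → ℝ}
    {q : X → ℝ × ℝ} (hΘ : ContDiff ℝ ∞ Θ) (hq : ContDiff ℝ ∞ q) :
    ContDiff ℝ ∞ (fun t => tng (Θ t) (q t)) := by
  unfold tng; fun_prop

/-- The unit covector is `(cos Θ, sin Θ)`, whose argument is `Θ` modulo `2π`. This replaces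
`Complex.arg`, which is discontinuous, by any real angle function of the curve. -/
lemma conormal_eq {q : ℝ → ℝ × ℝ} {t Θ ρ : ℝ} (hρ : 0 < ρ) (hq : deriv q t = ρ • tvec Θ) :
    conormal q t = ((Θ : Real.Angle), -tng Θ (q t), nrm Θ (q t)) := by
  have hs : Real.sqrt ((ρ * Real.sin Θ) ^ 2 + (ρ * -Real.cos Θ) ^ 2) = ρ := by
    rw [show (ρ * Real.sin Θ) ^ 2 + (ρ * -Real.cos Θ) ^ 2
      = ρ ^ 2 * (Real.sin Θ ^ 2 + Real.cos Θ ^ 2) by ring, Real.sin_sq_add_cos_sq, mul_one,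
      Real.sqrt_sq hρ.le]
  have hcov : conormalCovector (deriv q t) = (Real.cos Θ, Real.sin Θ) := by
    rw [hq]
    simp only [conormalCovector, tvec, Prod.smul_mk, smul_eq_mul]
    rw [hs]
    ext <;> simp <;> field_simp
  have harg : ((Complex.arg ⟨Real.cos Θ, Real.sin Θ⟩ : ℝ) : Real.Angle) = Θ := by
    have := Complex.arg_cos_add_sin_mul_I_coe_angle (Θ : Real.Angle)
    simp only [Real.Angle.cos_coe, Real.Angle.sin_coe] at this
    rw [← this]
    congr 2
    apply Complex.ext <;> simp [-Complex.ofReal_cos, -Complex.ofReal_sin]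
  simp only [conormal, hcov, cotangentToJet]
  rw [harg, sin_eq_of_coe_eq harg, cos_eq_of_coe_eq harg]
  ext
  · rfl
  · simp only [tng]; ring
  · simp only [nrm]

/-! ### Plane curves near a rectilinear polygon -/

/-- The open cones of half-angle 45° about the four directions are disjoint. -/
lemma Heading.eq_of_cone {h k : Heading} {u : ℝ × ℝ}
    (h1 : |nrm h.dotAngle u| < tng h.dotAngle u) (h2 : |nrm k.dotAngle u| < tng k.dotAngle u) :
    h = k := by
  rw [abs_lt] at h1 h2
  simp only [nrm, tng, cos_dotAngle, sin_dotAngle] at h1 h2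
  cases h <;> cases k <;> first | rfl | (exfalso; simp only [vec] at h1 h2; linarith)

/-- The open half-plane is centred at the bisector of the perpendicular directions `k` and `l`; the
45° cones about the two opposite directions lie outside it. -/
lemma Heading.eq_or_eq_of_cone {h k l : Heading} {u : ℝ × ℝ}
    (hkl : l.IsHorizontal ↔ ¬ k.IsHorizontal)
    (h1 : |nrm h.dotAngle u| < tng h.dotAngle u)
    (h2 : 0 < tng k.dotAngle u + tng l.dotAngle u) : h = k ∨ h = l := by
  rw [abs_lt] at h1
  simp only [nrm, tng, cos_dotAngle, sin_dotAngle] at h1 h2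
  cases h <;> cases k <;> cases l <;> simp [IsHorizontal] at hkl ⊢ <;>
    simp only [vec] at h1 h2 <;> linarith

namespace RectilinearPolygon

variable (P : RectilinearPolygon)

/-- The closed curve `q` stays within `δ` of the edges of `P` during the times `[a i, b i]` and of
the vertices during the times `[b i, a (i + 1)]`, and its direction is approximately that of the
polygon. -/
structure IsNearPolygon (α : ℤ → ℝ) (δ : ℝ) (a b : ℤ → ℝ) (q : ℝ → ℝ × ℝ) : Prop where
  smooth : ContDiff ℝ ∞ q
  periodic : Function.Periodic q 1
  edge : ∀ i, ∀ t ∈ Set.Icc (a i) (b i), |nrm (α i) (q t) - (P.dot i).2| < δ ∧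
    |nrm (α i) (deriv q t)| < tng (α i) (deriv q t)
  vertex : ∀ i, ∀ t ∈ Set.Icc (b i) (a (i + 1)), |nrm (α i) (q t) - (P.dot i).2| < δ ∧
    |nrm (α (i + 1)) (q t) - (P.dot (i + 1)).2| < δ ∧
    0 < tng (α i) (deriv q t) + tng (α (i + 1)) (deriv q t)

variable {P} {α : ℤ → ℝ} {δ : ℝ} {a b : ℤ → ℝ} {q q₀ q₁ : ℝ → ℝ × ℝ}

lemma abs_convex_sub_lt {x y c δ r : ℝ} (hx : |x - c| < δ) (hy : |y - c| < δ)
    (hr : r ∈ Set.Icc (0 : ℝ) 1) : |((1 - r) * x + r * y) - c| < δ := by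
  obtain ⟨h0, h1⟩ := hr
  rw [abs_lt] at *
  rcases h0.eq_or_lt with rfl | h0
  · constructor <;> linarith
  · constructor <;> nlinarith

lemma convex_pos {x y r : ℝ} (hx : 0 < x) (hy : 0 < y) (hr : r ∈ Set.Icc (0 : ℝ) 1) :
    0 < (1 - r) * x + r * y := by
  obtain ⟨h0, h1⟩ := hr
  rcases h0.eq_or_lt with rfl | h0
  · linarith
  · nlinarith

lemma deriv_convex (h₀ : ContDiff ℝ ∞ q₀) (h₁ : ContDiff ℝ ∞ q₁) (r t : ℝ) :
    deriv (fun t => (1 - r) • q₀ t + r • q₁ t) t = (1 - r) • deriv q₀ t + r • deriv q₁ t := by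
  have d₀ := (h₀.differentiable (by simp) t).hasDerivAt
  have d₁ := (h₁.differentiable (by simp) t).hasDerivAt
  exact ((d₀.fun_const_smul (1 - r)).fun_add (d₁.fun_const_smul r)).deriv

namespace IsNearPolygon

/-- Once the edge and corner times are fixed, strips, cones and half-planes are convex conditions on
position and velocity. This is why the second stage of the isotopy can be a straight line. -/
lemma convex (h₀ : P.IsNearPolygon α δ a b q₀) (h₁ : P.IsNearPolygon α δ a b q₁) {r : ℝ}
    (hr : r ∈ Set.Icc (0 : ℝ) 1) :
    P.IsNearPolygon α δ a b (fun t => (1 - r) • q₀ t + r • q₁ t) where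
  smooth := (h₀.smooth.const_smul (1 - r)).add (h₁.smooth.const_smul r)
  periodic t := by simp only [h₀.periodic t, h₁.periodic t]
  edge i t ht := by
    rw [deriv_convex h₀.smooth h₁.smooth]
    simp only [nrm_add, tng_add, nrm_smul, tng_smul]
    obtain ⟨h1, h2⟩ := h₀.edge i t ht
    obtain ⟨h3, h4⟩ := h₁.edge i t ht
    refine ⟨abs_convex_sub_lt h1 h3 hr, ?_⟩
    rw [abs_lt] at h2 h4 ⊢
    have e1 := convex_pos (sub_pos.2 h2.1) (sub_pos.2 h4.1) hr
    have e2 := convex_pos (sub_pos.2 h2.2) (sub_pos.2 h4.2) hr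
    constructor <;> linarith
  vertex i t ht := by
    rw [deriv_convex h₀.smooth h₁.smooth]
    simp only [nrm_add, tng_add, nrm_smul, tng_smul]
    obtain ⟨h1, h2, h3⟩ := h₀.vertex i t ht
    obtain ⟨h4, h5, h6⟩ := h₁.vertex i t ht
    refine ⟨abs_convex_sub_lt h1 h4 hr, abs_convex_sub_lt h2 h5 hr, ?_⟩
    have := convex_pos h3 h6 hr
    linarith

lemma mono {δ' : ℝ} (h : P.IsNearPolygon α δ a b q) (hδ : δ ≤ δ') :
    P.IsNearPolygon α δ' a b q where
  smooth := h.smooth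
  periodic := h.periodic
  edge i t ht := ⟨(h.edge i t ht).1.trans_le hδ, (h.edge i t ht).2⟩
  vertex i t ht := ⟨(h.vertex i t ht).1.trans_le hδ, (h.vertex i t ht).2.1.trans_le hδ,
    (h.vertex i t ht).2.2⟩

lemma comp (h : P.IsNearPolygon α δ a b q) {a' b' : ℤ → ℝ} {φ : ℝ → ℝ}
    (hφ : IsReparametrization φ) (ha : ∀ i, φ (a' i) = a i ∧ φ (b' i) = b i) :
    P.IsNearPolygon α δ a' b' (q ∘ φ) := by
  have hd : ∀ t, deriv (q ∘ φ) t = deriv φ t • deriv q (φ t) := fun t =>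
    ((h.smooth.differentiable (by simp) (φ t)).hasDerivAt.scomp t
      (hφ.smooth.differentiable (by simp) t).hasDerivAt).deriv
  have hm : Monotone φ := monotone_of_deriv_nonneg (hφ.smooth.differentiable (by simp))
    fun t => (hφ.deriv_pos t).le
  refine ⟨h.smooth.comp hφ.smooth, fun t => ?_, fun i t ht => ?_, fun i t ht => ?_⟩
  · simp only [Function.comp, hφ.shift]
    exact h.periodic _
  · have ht' : φ t ∈ Set.Icc (a i) (b i) := by
      rw [← (ha i).1, ← (ha i).2]
      exact ⟨hm ht.1, hm ht.2⟩
    obtain ⟨h1, h2⟩ := h.edge i _ ht'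
    refine ⟨h1, ?_⟩
    rw [hd, nrm_smul, tng_smul, abs_mul, abs_of_pos (hφ.deriv_pos t)]
    exact mul_lt_mul_of_pos_left h2 (hφ.deriv_pos t)
  · have ht' : φ t ∈ Set.Icc (b i) (a (i + 1)) := by
      rw [← (ha i).2, ← (ha (i + 1)).1]
      exact ⟨hm ht.1, hm ht.2⟩
    obtain ⟨h1, h2, h3⟩ := h.vertex i _ ht'
    refine ⟨h1, h2, ?_⟩
    rw [hd, tng_smul, tng_smul, ← mul_add]
    exact mul_pos (hφ.deriv_pos t) h3

/-- The cone about an edge direction lies in the half-plane allowed at the corner that follows it;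
`edge_succ_add_pos` is the same for the corner that precedes it. -/
lemma edge_add_pos (hα : P.IsAngleLift α) {i : ℤ} {u : ℝ × ℝ} (h : |nrm (α i) u| < tng (α i) u) :
    0 < tng (α i) u + tng (α (i + 1)) u := by
  rw [hα.tng_succ]
  rw [abs_lt] at h
  rcases P.turn_eq_or i with e | e <;> rw [e] <;> linarith

lemma edge_succ_add_pos (hα : P.IsAngleLift α) {i : ℤ} {u : ℝ × ℝ}
    (h : |nrm (α (i + 1)) u| < tng (α (i + 1)) u) : 0 < tng (α i) u + tng (α (i + 1)) u := by
  have e := hα.nrm_succ i u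
  rw [abs_lt] at h
  rcases P.turn_eq_or i with e' | e' <;> rw [e'] at e <;> linarith

/-- Two curves near the same polygon never move in opposite directions. -/
lemma exists_halfplane (h₀ : P.IsNearPolygon α δ a b q₀) (h₁ : P.IsNearPolygon α δ a b q₁)
    (hab : IsSubdivision P.n a b) (t : ℝ) :
    ∃ p : ℝ × ℝ, 0 < p.1 * (deriv q₀ t).1 + p.2 * (deriv q₀ t).2 ∧
      0 < p.1 * (deriv q₁ t).1 + p.2 * (deriv q₁ t).2 := by
  obtain ⟨i, ht | ht⟩ := hab.exists_mem_Icc t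
  · refine ⟨tvec (α i), ?_, ?_⟩
    · have h := (abs_nonneg _).trans_lt (h₀.edge i t ht).2
      simp only [tng, tvec] at h ⊢
      linarith
    · have h := (abs_nonneg _).trans_lt (h₁.edge i t ht).2
      simp only [tng, tvec] at h ⊢
      linarith
  · refine ⟨tvec (α i) + tvec (α (i + 1)), ?_, ?_⟩
    · have h := (h₀.vertex i t ht).2.2
      simp only [tng, tvec, Prod.fst_add, Prod.snd_add] at h ⊢
      linarith
    · have h := (h₁.vertex i t ht).2.2
      simp only [tng, tvec, Prod.fst_add, Prod.snd_add] at h ⊢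
      linarith

lemma deriv_ne_zero (h : P.IsNearPolygon α δ a b q) (hab : IsSubdivision P.n a b) (t : ℝ) :
    deriv q t ≠ 0 := by
  intro h0
  obtain ⟨p, hp, -⟩ := h.exists_halfplane h hab t
  rw [h0] at hp
  simp at hp

/-- The coordinate along the sum of the two edge directions increases strictly throughout edge `i`,
the corner and edge `i + 1`. -/
lemma injOn (h : P.IsNearPolygon α δ a b q) (hα : P.IsAngleLift α) (i : ℤ) :
    Set.InjOn q (Set.Icc (a i) (b (i + 1))) := by
  have hd : ∀ t, HasDerivAt (fun t => tng (α i) (q t) + tng (α (i + 1)) (q t))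
      (tng (α i) (deriv q t) + tng (α (i + 1)) (deriv q t)) t := fun t => by
    have hq := (h.smooth.differentiable (by simp) t).hasDerivAt
    simpa using (hasDerivAt_tng (hasDerivAt_const t (α i)) hq).fun_add
      (hasDerivAt_tng (hasDerivAt_const t (α (i + 1))) hq)
  have hmono : StrictMonoOn (fun t => tng (α i) (q t) + tng (α (i + 1)) (q t))
      (Set.Icc (a i) (b (i + 1))) := by
    refine strictMonoOn_of_deriv_pos (convex_Icc _ _)
      (fun t _ => (hd t).continuousAt.continuousWithinAt) fun t ht => ?_
    rw [(hd t).deriv]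
    rw [interior_Icc] at ht
    rcases le_total t (b i) with h1 | h1
    · exact edge_add_pos hα (h.edge i t ⟨ht.1.le, h1⟩).2
    · rcases le_total t (a (i + 1)) with h2 | h2
      · exact (h.vertex i t ⟨h1, h2⟩).2.2
      · exact edge_succ_add_pos hα (h.edge (i + 1) t ⟨h2, ht.2.le⟩).2
  intro s hs t ht e
  exact hmono.injOn hs ht (by simp only [e])

/-- The point and the direction of a curve near a polygon determine the time. -/
lemma embedded (h : P.IsNearPolygon α δ a b q) (hα : P.IsAngleLift α)
    (hab : IsSubdivision P.n a b)
    (hδ : ∀ i j : ℤ, ((P.dir i).IsHorizontal ↔ (P.dir j).IsHorizontal) → ∀ q : ℝ × ℝ,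
      |(P.dir i).dotHeight q - (P.dot i).2| < δ → |(P.dir j).dotHeight q - (P.dot j).2| < δ →
      (P.n : ℤ) ∣ i - j) {s t κ : ℝ} (hκ : 0 < κ) (hst : q s = q t)
    (hd : deriv q s = κ • deriv q t) : ∃ k : ℤ, t = s + k := by
  have sep : ∀ i j : ℤ, ((P.dir i).IsHorizontal ↔ (P.dir j).IsHorizontal) →
      |nrm (α i) (q s) - (P.dot i).2| < δ → |nrm (α j) (q t) - (P.dot j).2| < δ →
      ∃ k : ℤ, i = j + k * P.n := by
    intro i j hij h1 h2
    rw [← hα.dotHeight] at h1 h2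
    obtain ⟨k, hk⟩ := hδ i j hij (q s) h1 (by rw [hst]; exact h2)
    exact ⟨k, by linarith⟩
  have hper : ∀ (x : ℝ) (k : ℤ), q (x - k) = q x := fun x k => by
    simpa using h.periodic.sub_zsmul_eq k (x := x)
  -- It suffices to move both times, up to an integer, onto one stretch edge, corner, edge. The
  -- cases below find it: the direction shows which edges are parallel, the position shows which of
  -- these coincide.
  have finish : ∀ (j k : ℤ), s - k ∈ Set.Icc (a j) (b (j + 1)) →
      t ∈ Set.Icc (a j) (b (j + 1)) → ∃ k : ℤ, t = s + k := by
    intro j k h1 h2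
    have := h.injOn hα j h1 h2 (by rw [hper, hst])
    exact ⟨-k, by push_cast; linarith⟩
  have cone : ∀ j, |nrm (α j) (deriv q s)| < tng (α j) (deriv q s) →
      |nrm (α j) (deriv q t)| < tng (α j) (deriv q t) := by
    intro j hj
    rw [hd, nrm_smul, tng_smul, abs_mul, abs_of_pos hκ] at hj
    exact lt_of_mul_lt_mul_left hj hκ.le
  obtain ⟨i, hs⟩ := hab.exists_mem_Icc s
  obtain ⟨j, ht⟩ := hab.exists_mem_Icc t
  have l1 := hab.lt j
  have l2 := hab.lt_next j
  have l3 := hab.lt (j + 1)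
  rcases hs with hs | hs
  · obtain ⟨hs1, hs2⟩ := h.edge i s hs
    have hs3 := cone i hs2
    rw [nrm_congr (hα.coe i), tng_congr (hα.coe i)] at hs3
    rcases ht with ht | ht
    · obtain ⟨ht1, ht2⟩ := h.edge j t ht
      rw [nrm_congr (hα.coe j), tng_congr (hα.coe j)] at ht2
      obtain ⟨k, rfl⟩ := sep i j (by rw [Heading.eq_of_cone hs3 ht2]) hs1 ht1
      rw [hab.shift_a_mul, hab.shift_b_mul] at hs
      exact finish j k ⟨by linarith [hs.1], by linarith [hs.2]⟩ ⟨ht.1, by linarith [ht.2]⟩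
    · obtain ⟨ht1, ht2, ht3⟩ := h.vertex j t ht
      rw [tng_congr (hα.coe j), tng_congr (hα.coe (j + 1))] at ht3
      rcases Heading.eq_or_eq_of_cone (P.right_angle j) hs3 ht3 with e | e
      · obtain ⟨k, rfl⟩ := sep i j (by rw [e]) hs1 ht1
        rw [hab.shift_a_mul, hab.shift_b_mul] at hs
        exact finish j k ⟨by linarith [hs.1], by linarith [hs.2]⟩
          ⟨by linarith [ht.1], by linarith [ht.2]⟩
      · obtain ⟨k, rfl⟩ := sep i (j + 1) (by rw [e]) hs1 ht2
        rw [hab.shift_a_mul, hab.shift_b_mul] at hs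
        exact finish j k ⟨by linarith [hs.1], by linarith [hs.2]⟩
          ⟨by linarith [ht.1], by linarith [ht.2]⟩
  · obtain ⟨hs1, hs2, hs3⟩ := h.vertex i s hs
    rcases ht with ht | ht
    · obtain ⟨ht1, ht2⟩ := h.edge j t ht
      rw [nrm_congr (hα.coe j), tng_congr (hα.coe j)] at ht2
      rw [hd, tng_smul, tng_smul, ← mul_add] at hs3
      have hs3 := pos_of_mul_pos_right hs3 hκ.le
      rw [tng_congr (hα.coe i), tng_congr (hα.coe (i + 1))] at hs3
      rcases Heading.eq_or_eq_of_cone (P.right_angle i) ht2 hs3 with e | e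
      · obtain ⟨k, rfl⟩ := sep i j (by rw [e]) hs1 ht1
        rw [show j + k * (P.n : ℤ) + 1 = (j + 1) + k * P.n by ring, hab.shift_a_mul,
          hab.shift_b_mul] at hs
        exact finish j k ⟨by linarith [hs.1], by linarith [hs.2]⟩
          ⟨by linarith [ht.1], by linarith [ht.2]⟩
      · obtain ⟨k, hk⟩ := sep (i + 1) j (by rw [e]) hs2 ht1
        obtain rfl : i = (j - 1) + k * P.n := by linarith
        rw [show j - 1 + k * (P.n : ℤ) + 1 = j + k * P.n by ring, hab.shift_a_mul,
          hab.shift_b_mul] at hs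
        have l4 := hab.lt (j - 1)
        have l5 := hab.lt_next (j - 1)
        refine finish (j - 1) k ⟨by linarith [hs.1], ?_⟩ ⟨?_, ?_⟩ <;>
          rw [sub_add_cancel] at * <;> linarith [hs.2, ht.1, ht.2]
    · obtain ⟨ht1, ht2, ht3⟩ := h.vertex j t ht
      have hi := P.right_angle i
      have hj := P.right_angle j
      by_cases hij : (P.dir i).IsHorizontal ↔ (P.dir j).IsHorizontal
      · obtain ⟨k, rfl⟩ := sep i j hij hs1 ht1
        rw [show j + k * (P.n : ℤ) + 1 = (j + 1) + k * P.n by ring, hab.shift_a_mul,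
          hab.shift_b_mul] at hs
        exact finish j k ⟨by linarith [hs.1], by linarith [hs.2]⟩
          ⟨by linarith [ht.1], by linarith [ht.2]⟩
      -- If edges `i` and `j` are perpendicular, the corners could only match crosswise, which would
      -- make `n` divide 2.
      · obtain ⟨k, hk⟩ := sep i (j + 1) (by tauto) hs1 ht2
        obtain ⟨l, hl⟩ := sep (i + 1) j (by tauto) hs2 ht1
        exact absurd ⟨l - k, by linarith⟩ P.not_n_dvd_two

/-- The conormal of a curve near a polygon is a Legendrian knot. -/
lemma isLegendrianKnot_conormal (h : P.IsNearPolygon α δ a b q) (hα : P.IsAngleLift α)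
    (hab : IsSubdivision P.n a b)
    (hδ : ∀ i j : ℤ, ((P.dir i).IsHorizontal ↔ (P.dir j).IsHorizontal) → ∀ q : ℝ × ℝ,
      |(P.dir i).dotHeight q - (P.dot i).2| < δ → |(P.dir j).dotHeight q - (P.dot j).2| < δ →
      (P.n : ℤ) ∣ i - j) {Θ ρ : ℝ → ℝ} (hΘ : ContDiff ℝ ∞ Θ) (hρ : ∀ t, 0 < ρ t)
    (hq : ∀ t, deriv q t = ρ t • tvec (Θ t)) : IsLegendrianKnot (conormal q) := by
  have hc : ∀ t, conormal q t = ((Θ t : Real.Angle), -tng (Θ t) (q t), nrm (Θ t) (q t)) :=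
    fun t => conormal_eq (hρ t) (hq t)
  have dΘ : ∀ t, HasDerivAt Θ (deriv Θ t) t := fun t =>
    (hΘ.differentiable (by simp) t).hasDerivAt
  have dq : ∀ t, HasDerivAt q (ρ t • tvec (Θ t)) t := fun t => by
    rw [← hq]; exact (h.smooth.differentiable (by simp) t).hasDerivAt
  have hper : Function.Periodic (conormal q) 1 := fun t => by
    have hdp : deriv q (t + 1) = deriv q t := by
      rw [← deriv_comp_add_const]
      congr 1
      exact funext h.periodic
    simp only [conormal, hdp, h.periodic t]
  refine ⟨⟨Θ, fun t => -tng (Θ t) (q t), fun t => nrm (Θ t) (q t), hc, hper, hΘ,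
    (contDiff_tng hΘ h.smooth).neg, contDiff_nrm hΘ h.smooth, fun t => ?_, fun t h0 => ?_⟩,
    fun s t e => ?_⟩
  · rw [(hasDerivAt_nrm (dΘ t) (dq t)).deriv, nrm_smul, nrm_tvec]
    simp
  -- Where the angle is stationary the slope coordinate moves with velocity `-ρ`, which is nonzero.
  · have h1 : deriv Θ t = 0 := congrArg Prod.fst h0
    have h2 := congrArg (fun x => x.2.1) h0
    simp only [(hasDerivAt_tng (dΘ t) (dq t)).fun_neg.deriv, tng_smul, tng_tvec, h1] at h2
    have := hρ t
    simp at h2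
    linarith
  · rw [hc, hc] at e
    simp only [Prod.mk.injEq, neg_inj] at e
    obtain ⟨e1, e2, e3⟩ := e
    rw [nrm_congr e1] at e3
    rw [tng_congr e1] at e2
    refine h.embedded hα hab hδ (div_pos (hρ s) (hρ t)) (eq_of_nrm_tng e3 e2) ?_
    rw [hq, hq, tvec_congr e1, smul_smul, div_mul_cancel₀ _ (hρ t).ne']

end IsNearPolygon

/-- A rectilinear curve rounds vertex `i` before running along edge `i`, so the edge times become
`[B i, A (i + 1)]`. At a corner the velocity is a nonnegative combination of two perpendicular
directions, and immersedness excludes that both coefficients vanish. -/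
lemma IsRectilinearCurve.isNearPolygon {ε : ℝ} (hε : 0 < ε) (hα : P.IsAngleLift α)
    (hq : IsPlaneCurve q) {A B : ℤ → ℝ}
    (hedge : ∀ i, ∀ t ∈ Set.Icc (B i) (A (i + 1)),
      q t ∈ segment ℝ (P.vertex i) (P.vertex (i + 1)) ∧
      ∃ r : ℝ, 0 < r ∧ deriv q t = r • (P.dir i).vec)
    (hvertex : ∀ i, ∀ t ∈ Set.Icc (A i) (B i),
      dist (q t) (P.vertex i) < ε ∧
      ∃ r s : ℝ, 0 ≤ r ∧ 0 ≤ s ∧ deriv q t = r • (P.dir (i - 1)).vec + s • (P.dir i).vec) :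
    P.IsNearPolygon α ε B (fun i => A (i + 1)) q where
  smooth := hq.smooth
  periodic := hq.periodic
  edge i t ht := by
    obtain ⟨⟨u, v, -, -, huv, e⟩, r, hr, hd⟩ := hedge i t ht
    rw [hd, hα.vec, nrm_smul, tng_smul, nrm_tvec, tng_tvec, ← e, nrm_add, nrm_smul, nrm_smul,
      hα.nrm_vertex, hα.nrm_vertex_succ, ← add_mul, huv]
    simpa using ⟨hε, hr⟩
  vertex i t ht := by
    obtain ⟨hdist, r, s, hr, hs, hd⟩ := hvertex (i + 1) t ht
    have key : ∀ h : Heading,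
        |nrm h.dotAngle (q t) - nrm h.dotAngle (P.vertex (i + 1))| < ε := by
      intro h
      rw [Prod.dist_eq, max_lt_iff, Real.dist_eq, Real.dist_eq] at hdist
      rw [← nrm_sub, Heading.nrm_dotAngle]
      cases h <;> simp only [Heading.dotHeight, Prod.fst_sub, Prod.snd_sub, abs_neg]
      exacts [hdist.2, hdist.1, hdist.2, hdist.1]
    refine ⟨?_, ?_, ?_⟩
    · rw [← hα.nrm_vertex_succ, nrm_congr (hα.coe i), nrm_congr (hα.coe i)]
      exact key _
    · rw [← hα.nrm_vertex, nrm_congr (hα.coe (i + 1)), nrm_congr (hα.coe (i + 1))]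
      exact key _
    · have h0 := hq.immersed t
      rw [add_sub_cancel_right] at hd
      rw [hd, hα.vec, hα.vec] at h0 ⊢
      have h1 : r ≠ 0 ∨ s ≠ 0 := by
        by_contra! hc
        rw [hc.1, hc.2] at h0
        simp at h0
      have e1 : Real.cos (α (i + 1) - α i) = 0 := by
        rw [hα.step]
        rcases P.turn_eq_or i with e | e <;> rw [e] <;> simp
      have e2 : Real.cos (α i - α (i + 1)) = 0 := by
        rw [← Real.cos_neg, neg_sub, e1]
      simp only [tng_add, tng_smul, tng_tvec, sub_self, Real.cos_zero, e1, e2]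
      rcases h1 with h1 | h1
      · have := lt_of_le_of_ne hr (Ne.symm h1)
        linarith
      · have := lt_of_le_of_ne hs (Ne.symm h1)
        linarith

end RectilinearPolygon

/-! ### Lifting the front of a smoothing -/

lemma exists_int_abs_lt_of_dist_lt {x y ε : ℝ}
    (h : dist (x : Real.Angle) (y : Real.Angle) < ε) :
    ∃ k : ℤ, |x - y - k * (2 * Real.pi)| < ε := by
  rw [dist_eq_norm, ← Real.Angle.coe_sub] at h
  have e := AddCircle.norm_eq (p := 2 * Real.pi) (x := x - y)
  exact ⟨round ((2 * Real.pi)⁻¹ * (x - y)), by rw [← e]; exact h⟩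

lemma exists_int_of_coe_eq {x y : ℝ} (h : (x : Real.Angle) = y) :
    ∃ k : ℤ, x = y + k * (2 * Real.pi) := by
  obtain ⟨k, hk⟩ := Real.Angle.angle_eq_iff_two_pi_dvd_sub.1 h
  exact ⟨k, by linarith⟩

lemma eq_of_coe_eq_of_abs_lt {x y : ℝ} (h : (x : Real.Angle) = y)
    (h' : |x - y| < 2 * Real.pi) : x = y := by
  obtain ⟨k, hk⟩ := exists_int_of_coe_eq h
  have hpi := Real.pi_pos
  have hk0 : k = 0 := by
    rw [hk, add_sub_cancel_left, abs_lt] at h'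
    have h1 : (-1 : ℝ) < k := by nlinarith
    have h2 : (k : ℝ) < 1 := by nlinarith
    have h1' : -1 < k := by exact_mod_cast h1
    have h2' : k < 1 := by exact_mod_cast h2
    omega
  rw [hk, hk0]
  simp

lemma lt_of_forall_ne {f : ℝ → ℝ} {a b m : ℝ} (hf : Continuous f)
    (ha : f a < m) (hne : ∀ t ∈ Set.Icc a b, f t ≠ m) : ∀ t ∈ Set.Icc a b, f t < m := by
  intro t ht
  by_contra! hle
  obtain ⟨s, hs, e⟩ := intermediate_value_Icc ht.1 hf.continuousOn ⟨ha.le, hle⟩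
  exact hne s ⟨hs.1, hs.2.trans ht.2⟩ e

/-- By the intermediate value theorem, a continuous angle difference that avoids `±π` cannot leave
its branch around zero. -/
lemma abs_lt_pi_of_forall_ne {f : ℝ → ℝ} {a b : ℝ} (hf : Continuous f)
    (ha : |f a| < Real.pi) (hne : ∀ t ∈ Set.Icc a b, ∀ σ : ℝ, σ = 1 ∨ σ = -1 → f t ≠ σ * Real.pi) :
    ∀ t ∈ Set.Icc a b, |f t| < Real.pi := by
  intro t ht
  rw [abs_lt] at ha ⊢
  constructor
  · have := lt_of_forall_ne (f := fun t => -f t) (m := Real.pi) hf.neg (by linarith)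
      (fun t ht e => hne t ht (-1) (Or.inr rfl) (by linarith)) t ht
    linarith
  · exact lt_of_forall_ne hf ha.2 (fun t ht e => hne t ht 1 (Or.inl rfl) (by linarith)) t ht

namespace RectilinearPolygon

/-- The slope of the straight segment that joins dot `i` to dot `i + 1`. -/
def slope (P : RectilinearPolygon) (i : ℤ) : ℝ :=
  P.turn i * (2 / Real.pi) * ((P.dot (i + 1)).2 - (P.dot i).2)

/-- The coordinate functions of a smoothing of the polygonal path, with the angle lifted along
the lift `α` of the angles of the dots. -/
structure IsFrontLift (P : RectilinearPolygon) (ε : ℝ) (α a b : ℤ → ℝ) (θ y z : ℝ → ℝ) :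
    Prop where
  angleLift : P.IsAngleLift α
  subdivision : IsSubdivision P.n a b
  smooth_θ : ContDiff ℝ ∞ θ
  smooth_y : ContDiff ℝ ∞ y
  smooth_z : ContDiff ℝ ∞ z
  periodic_θ : ∀ t, ((θ (t + 1) : ℝ) : Real.Angle) = θ t
  periodic_y : Function.Periodic y 1
  periodic_z : Function.Periodic z 1
  legendrian : ∀ t, deriv z t = y t * deriv θ t
  immersed : ∀ t, deriv θ t = 0 → deriv y t ≠ 0
  near : ∀ i, ∀ t ∈ Set.Icc (a i) (b i), |θ t - α i| < ε ∧ |z t - (P.dot i).2| < ε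
  chord : ∀ i, ∀ t ∈ Set.Icc (b i) (a (i + 1)), ∃ u ∈ Set.Icc (0 : ℝ) 1,
    θ t = α i + P.turn i * (u * (Real.pi / 2)) ∧
    z t = (1 - u) * (P.dot i).2 + u * (P.dot (i + 1)).2
  chord_deriv : ∀ i, ∀ t ∈ Set.Icc (b i) (a (i + 1)), 0 < P.turn i * deriv θ t
  rounded : ∀ i, P.turn (i - 1) = P.turn i →
    ∀ t ∈ Set.Icc (a i) (b i), 0 < P.turn i * deriv θ t
  cusp : ∀ i, P.turn (i - 1) ≠ P.turn i →
    (∃ c ∈ Set.Ioo (a i) (b i),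
      (∀ t ∈ Set.Ico (a i) c, 0 < P.turn (i - 1) * deriv θ t) ∧
      (∀ t ∈ Set.Ioc c (b i), 0 < P.turn i * deriv θ t)) ∧
    (MonotoneOn y (Set.Icc (a i) (b i)) ∨ AntitoneOn y (Set.Icc (a i) (b i)))

variable {P : RectilinearPolygon}

/-- The conditions on the front hold only modulo `2π`, with an integer that could depend on time.
Continuity of `θ` keeps this integer constant on each dot interval and each chord interval, and
adjacent intervals share an endpoint. -/
lemma IsSmoothedFront.exists_lift {ε : ℝ} (hε1 : ε ≤ 1) {γ : ℝ → JetSpace}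
    (h : P.IsSmoothedFront ε γ) : ∃ (α a b : ℤ → ℝ) (θ y z : ℝ → ℝ),
      P.IsFrontLift ε α a b θ y z ∧ ∀ t, γ t = ((θ t : Real.Angle), y t, z t) := by
  obtain ⟨θ, y, z, hL, a, b, hab, hchord, hdot, hround, hcusp⟩ := h
  have hpi := Real.pi_gt_three
  have hθc := hL.smooth_θ.continuous
  have hdist : ∀ i, ∀ t ∈ Set.Icc (a i) (b i),
      (∃ k : ℤ, |θ t - (P.dir i).dotAngle - k * (2 * Real.pi)| < ε) ∧
      |z t - (P.dot i).2| < ε := by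
    intro i t ht
    have := hdot i t ht
    rw [hL.coords, Prod.dist_eq, max_lt_iff] at this
    refine ⟨exists_int_abs_lt_of_dist_lt this.1, ?_⟩
    have h2 := this.2
    rwa [Real.dist_eq] at h2
  -- The lift `α i` is the representative of the dot's angle nearest to `θ` at the moment of
  -- entering its neighbourhood.
  choose k hk using fun i => (hdist i (a i) ⟨le_rfl, (hab.lt i).le⟩).1
  set α : ℤ → ℝ := fun i => (P.dir i).dotAngle + k i * (2 * Real.pi) with hαdef
  have hcoe : ∀ i, (α i : Real.Angle) = (P.dir i).dotAngle := fun i => by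
    rw [Real.Angle.angle_eq_iff_two_pi_dvd_sub]
    exact ⟨k i, by simp only [hαdef]; ring⟩
  have hnear : ∀ i, ∀ t ∈ Set.Icc (a i) (b i), |θ t - α i| < ε := by
    intro i
    have hdot' : ∀ t ∈ Set.Icc (a i) (b i), ∃ m : ℤ, |θ t - α i - m * (2 * Real.pi)| < ε := by
      intro t ht
      obtain ⟨m, hm⟩ := (hdist i t ht).1
      refine ⟨m - k i, ?_⟩
      rw [show θ t - α i - ((m - k i : ℤ) : ℝ) * (2 * Real.pi)
        = θ t - (P.dir i).dotAngle - m * (2 * Real.pi) by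
          simp only [hαdef]; push_cast; ring]
      exact hm
    have hpiab := abs_lt_pi_of_forall_ne (f := fun t => θ t - α i) (a := a i) (b := b i)
      (hθc.sub continuous_const) (by
        have := hk i
        rw [show θ (a i) - (P.dir i).dotAngle - k i * (2 * Real.pi) = θ (a i) - α i by
          simp only [hαdef]; ring] at this
        linarith)
      (fun t ht σ hσ e => by
        obtain ⟨m, hm⟩ := hdot' t ht
        have e' : θ t - α i = σ * Real.pi := e
        rw [e', abs_lt] at hm
        rcases hσ with rfl | rfl
        · rcases le_or_gt m 0 with hm0 | hm0
          · have : (m : ℝ) ≤ 0 := by exact_mod_cast hm0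
            nlinarith
          · have : (1 : ℝ) ≤ m := by exact_mod_cast hm0
            nlinarith
        · rcases lt_or_ge m 0 with hm0 | hm0
          · have : (m : ℝ) ≤ -1 := by exact_mod_cast Int.le_sub_one_of_lt hm0
            nlinarith
          · have : (0 : ℝ) ≤ m := by exact_mod_cast hm0
            nlinarith)
    intro t ht
    obtain ⟨m, hm⟩ := hdot' t ht
    have h1 : |θ t - α i| < Real.pi := hpiab t ht
    have hm0 : m = 0 := by
      rw [abs_lt] at h1
      have hm' := abs_lt.1 hm
      have h2 : (-1 : ℝ) < m := by nlinarith
      have h3 : (m : ℝ) < 1 := by nlinarith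
      have h2' : -1 < m := by exact_mod_cast h2
      have h3' : m < 1 := by exact_mod_cast h3
      omega
    rw [hm0] at hm
    simpa using hm
  have hchord' : ∀ i, ∀ t ∈ Set.Icc (b i) (a (i + 1)), ∃ u ∈ Set.Icc (0 : ℝ) 1,
      θ t = α i + P.turn i * (u * (Real.pi / 2)) ∧
      z t = (1 - u) * (P.dot i).2 + u * (P.dot (i + 1)).2 := by
    intro i
    have hτ := P.turn_mul_self i
    have hc : ∀ t ∈ Set.Icc (b i) (a (i + 1)), ∃ u ∈ Set.Icc (0 : ℝ) 1, ∃ m : ℤ,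
        θ t - α i = P.turn i * (u * (Real.pi / 2)) + m * (2 * Real.pi) ∧
        z t = (1 - u) * (P.dot i).2 + u * (P.dot (i + 1)).2 := by
      intro t ht
      obtain ⟨⟨u, hu, e⟩, -⟩ := hchord i t ht
      rw [hL.coords] at e
      have e1 := congrArg Prod.fst e
      have e2 := congrArg Prod.snd e
      simp only [front, chord] at e1 e2
      obtain ⟨m, hm⟩ := exists_int_of_coe_eq e1
      refine ⟨u, hu, m - k i, ?_, e2⟩
      rw [hm]
      simp only [hαdef]
      push_cast
      ring
    have hpiab := abs_lt_pi_of_forall_ne (f := fun t => θ t - α i) (a := b i) (b := a (i + 1))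
      (hθc.sub continuous_const) (by
        have := hnear i (b i) ⟨(hab.lt i).le, le_rfl⟩
        linarith)
      (fun t ht σ hσ e => by
        obtain ⟨u, hu, m, hm, -⟩ := hc t ht
        have e' : θ t - α i = σ * Real.pi := e
        rw [e'] at hm
        have hne : σ = P.turn i * u / 2 + 2 * m := by
          have : Real.pi * (σ - (P.turn i * u / 2 + 2 * m)) = 0 := by linear_combination hm
          rcases mul_eq_zero.1 this with h0 | h0
          · exact absurd h0 Real.pi_ne_zero
          · linarith
        have h1 : (-1 : ℝ) < m := by
          rcases P.turn_eq_or i with ht | ht <;> rw [ht] at hne <;>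
            rcases hσ with rfl | rfl <;> linarith [hu.1, hu.2]
        have h2 : (m : ℝ) < 1 := by
          rcases P.turn_eq_or i with ht | ht <;> rw [ht] at hne <;>
            rcases hσ with rfl | rfl <;> linarith [hu.1, hu.2]
        have h1' : -1 < m := by exact_mod_cast h1
        have h2' : m < 1 := by exact_mod_cast h2
        obtain rfl : m = 0 := by omega
        rcases P.turn_eq_or i with ht | ht <;> rw [ht] at hne <;>
          rcases hσ with rfl | rfl <;> norm_num at hne <;> linarith [hu.1, hu.2])
    intro t ht
    obtain ⟨u, hu, m, hm, hz⟩ := hc t ht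
    have h1 : |θ t - α i| < Real.pi := hpiab t ht
    rw [hm, abs_lt] at h1
    have hm0 : m = 0 := by
      have h2 : (-1 : ℝ) < m := by
        rcases P.turn_eq_or i with ht | ht <;> rw [ht] at h1 <;> nlinarith [hu.1, hu.2]
      have h3 : (m : ℝ) < 1 := by
        rcases P.turn_eq_or i with ht | ht <;> rw [ht] at h1 <;> nlinarith [hu.1, hu.2]
      have h2' : -1 < m := by exact_mod_cast h2
      have h3' : m < 1 := by exact_mod_cast h3
      omega
    refine ⟨u, hu, ?_, hz⟩
    rw [hm0] at hm
    simp only [Int.cast_zero, zero_mul, add_zero] at hm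
    linarith
  have hstep : ∀ i, α (i + 1) = α i + P.turn i * (Real.pi / 2) := by
    intro i
    -- Both sides represent the angle of dot `i + 1`. The end of chord `i` lies within `ε` of `α (i
    -- + 1)` and within a quarter turn of `α i`, so they differ by less than `2π`.
    refine eq_of_coe_eq_of_abs_lt ?_ ?_
    · rw [hcoe, Real.Angle.coe_add, hcoe, ← Real.Angle.coe_add, P.coe_dotAngle_step]
    · obtain ⟨u, hu, e, -⟩ := hchord' i (a (i + 1)) ⟨(hab.lt_next i).le, le_rfl⟩
      have h1 := hnear (i + 1) (a (i + 1)) ⟨le_rfl, (hab.lt _).le⟩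
      rw [abs_lt] at h1 ⊢
      rcases P.turn_eq_or i with ht | ht <;> rw [ht] at e ⊢ <;>
        constructor <;> nlinarith [hu.1, hu.2]
  refine ⟨α, a, b, θ, y, z, ⟨⟨hcoe, hstep⟩, hab, hL.smooth_θ, hL.smooth_y, hL.smooth_z, ?_, ?_, ?_,
    fun t => by linarith [hL.legendrian t], fun t h0 h1 => ?_,
    fun i t ht => ⟨hnear i t ht, (hdist i t ht).2⟩, hchord', fun i t ht => (hchord i t ht).2,
    hround, hcusp⟩, hL.coords⟩
  · intro t
    have := hL.periodic t
    rw [hL.coords, hL.coords] at this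
    exact congrArg Prod.fst this
  · intro t
    have := hL.periodic t
    rw [hL.coords, hL.coords] at this
    exact congrArg (fun x => x.2.1) this
  · intro t
    have := hL.periodic t
    rw [hL.coords, hL.coords] at this
    exact congrArg (fun x => x.2.2) this
  · refine hL.immersed t ?_
    have := hL.legendrian t
    rw [h0] at this ⊢
    rw [h1, show deriv z t = 0 by linarith]
    rfl

namespace IsFrontLift

variable {ε : ℝ} {α a b : ℤ → ℝ} {θ y z : ℝ → ℝ}

lemma hasDerivAt_θ (h : P.IsFrontLift ε α a b θ y z) (t : ℝ) : HasDerivAt θ (deriv θ t) t :=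
  (h.smooth_θ.differentiable (by simp) t).hasDerivAt

lemma hasDerivAt_y (h : P.IsFrontLift ε α a b θ y z) (t : ℝ) : HasDerivAt y (deriv y t) t :=
  (h.smooth_y.differentiable (by simp) t).hasDerivAt

lemma hasDerivAt_z (h : P.IsFrontLift ε α a b θ y z) (t : ℝ) : HasDerivAt z (deriv z t) t :=
  (h.smooth_z.differentiable (by simp) t).hasDerivAt

lemma z_chord (h : P.IsFrontLift ε α a b θ y z) {i : ℤ} {t : ℝ}
    (ht : t ∈ Set.Icc (b i) (a (i + 1))) : z t = (P.dot i).2 + P.slope i * (θ t - α i) := by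
  obtain ⟨u, -, e1, e2⟩ := h.chord i t ht
  rw [e1, e2, slope]
  have := P.turn_mul_self i
  have hpi := Real.pi_ne_zero
  field_simp
  linear_combination (-Real.pi * u * ((P.dot (i + 1)).2 - (P.dot i).2)) * this

/-- On a chord `z` is an affine function of `θ`; comparing its derivative with `y θ'` and cancelling
`θ' ≠ 0` gives the slope. -/
lemma y_chord (h : P.IsFrontLift ε α a b θ y z) {i : ℤ} {t : ℝ}
    (ht : t ∈ Set.Icc (b i) (a (i + 1))) : y t = P.slope i := by
  have h1 : HasDerivWithinAt z (P.slope i * deriv θ t) (Set.Icc (b i) (a (i + 1))) t := by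
    have := (((h.hasDerivAt_θ t).sub_const (α i)).const_mul (P.slope i)).const_add (P.dot i).2
    exact this.hasDerivWithinAt.congr (fun s hs => h.z_chord hs) (h.z_chord ht)
  have h2 := (h.hasDerivAt_z t).hasDerivWithinAt (s := Set.Icc (b i) (a (i + 1)))
  have h3 := (uniqueDiffOn_Icc (h.subdivision.lt_next i) t ht).eq_deriv _ h1 h2
  rw [h.legendrian] at h3
  have h4 := h.chord_deriv i t ht
  have h5 : deriv θ t ≠ 0 := fun h0 => by rw [h0] at h4; simp at h4
  exact (mul_right_cancel₀ h5 h3).symm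

/-- If the two turns are opposite, edges `i - 1` and `i + 1` have the same heading and their lines
are offset by the length `l` of edge `i`, to the side that makes the slope drop by `2 l / π`. So at
every reversal the slope must decrease, just as it does for a conormal. -/
lemma slope_lt_of_turn_ne (P : RectilinearPolygon) {i : ℤ} (hi : P.turn (i - 1) ≠ P.turn i) :
    P.slope i < P.slope (i - 1) := by
  have h1 := P.turn_eq_neg_of_ne hi
  obtain ⟨l, hl, hv⟩ := P.edge i
  have key : P.turn i * ((P.dot (i + 1)).2 - (P.dot (i - 1)).2) < 0 := by
    have hd1 := P.right_angle i
    have hd0 := P.right_angle (i - 1)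
    rw [sub_add_cancel] at hd0
    rw [← P.dotHeight_succ (i - 1), sub_add_cancel]
    simp only [dot, hv]
    unfold turn at h1 ⊢
    rw [sub_add_cancel] at h1
    generalize P.dir i = x at *
    generalize P.dir (i + 1) = y at *
    generalize P.dir (i - 1) = w at *
    cases x <;> cases y <;> cases w <;>
      simp [Heading.IsHorizontal, Heading.vec, Heading.dotHeight] at hd1 hd0 h1 ⊢ <;>
      linarith
  unfold slope
  rw [h1, sub_add_cancel]
  have hpi : 0 < 2 / Real.pi := div_pos two_pos Real.pi_pos
  nlinarith

/-- At a cusp the slope of the front is decreasing, strictly so at the cusp point. -/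
lemma exists_cusp (h : P.IsFrontLift ε α a b θ y z) {i : ℤ} (hi : P.turn (i - 1) ≠ P.turn i) :
    ∃ c ∈ Set.Ioo (a i) (b i),
      (∀ t ∈ Set.Ico (b (i - 1)) c, 0 < P.turn (i - 1) * deriv θ t) ∧
      (∀ t ∈ Set.Ioc c (a (i + 1)), 0 < P.turn i * deriv θ t) ∧
      deriv θ c = 0 ∧ deriv y c < 0 ∧ AntitoneOn y (Set.Icc (b (i - 1)) (a (i + 1))) := by
  obtain ⟨⟨c, hc, hl, hr⟩, hy⟩ := h.cusp i hi
  have hab := h.subdivision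
  have hl0 := hab.lt_next (i - 1)
  rw [sub_add_cancel] at hl0
  have hcont : Continuous (deriv θ) := h.smooth_θ.continuous_deriv (by simp)
  have hyL : ∀ t ∈ Set.Icc (b (i - 1)) (a i), y t = P.slope (i - 1) := fun t ht =>
    h.y_chord (by rw [sub_add_cancel]; exact ht)
  have hyR : ∀ t ∈ Set.Icc (b i) (a (i + 1)), y t = P.slope i := fun t ht => h.y_chord ht
  -- The slope equals that of the adjacent chords at the two ends, and these slopes drop, so the
  -- increasing alternative is impossible.
  have hanti : AntitoneOn y (Set.Icc (a i) (b i)) := by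
    rcases hy with hy | hy
    · have h1 := hy ⟨le_rfl, (hab.lt i).le⟩ ⟨(hab.lt i).le, le_rfl⟩ (hab.lt i).le
      rw [hyL _ ⟨hl0.le, le_rfl⟩, hyR _ ⟨le_rfl, (hab.lt_next i).le⟩] at h1
      exact absurd (slope_lt_of_turn_ne P hi) (not_lt.2 h1)
    · exact hy
  have hanti1 : AntitoneOn y (Set.Icc (b (i - 1)) (b i)) := by
    intro s hs t ht hst
    rcases le_total t (a i) with h1 | h1
    · rw [hyL t ⟨ht.1, h1⟩, hyL s ⟨hs.1, hst.trans h1⟩]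
    · rcases le_total s (a i) with h2 | h2
      · rw [hyL s ⟨hs.1, h2⟩, ← hyL (a i) ⟨hl0.le, le_rfl⟩]
        exact hanti ⟨le_rfl, (hab.lt i).le⟩ ⟨h1, ht.2⟩ h1
      · exact hanti ⟨h2, hs.2⟩ ⟨h1, ht.2⟩ hst
  have hanti2 : AntitoneOn y (Set.Icc (b (i - 1)) (a (i + 1))) := by
    intro s hs t ht hst
    rcases le_total (b i) s with h1 | h1
    · rw [hyR t ⟨h1.trans hst, ht.2⟩, hyR s ⟨h1, hs.2⟩]
    · rcases le_total (b i) t with h2 | h2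
      · rw [hyR t ⟨h2, ht.2⟩, ← hyR (b i) ⟨le_rfl, (hab.lt_next i).le⟩]
        exact hanti1 ⟨hs.1, h1⟩ ⟨hl0.le.trans (hab.lt i).le, le_rfl⟩ h1
      · exact hanti1 ⟨hs.1, h1⟩ ⟨ht.1, h2⟩ hst
  -- Limits from the left and from the right give `θ'` at `c` both signs, hence it vanishes there;
  -- immersedness then makes `y'` nonzero at `c`.
  have h0l : 0 ≤ P.turn (i - 1) * deriv θ c := by
    have hcl : c ∈ closure (Set.Ico (a i) c) := by
      rw [closure_Ico hc.1.ne]; exact ⟨hc.1.le, le_rfl⟩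
    have hclosed : IsClosed {t | 0 ≤ P.turn (i - 1) * deriv θ t} :=
      isClosed_le continuous_const (continuous_const.mul hcont)
    exact hclosed.closure_subset_iff.2 (fun t ht => (hl t ht).le) hcl
  have h0r : 0 ≤ P.turn i * deriv θ c := by
    have hcl : c ∈ closure (Set.Ioc c (b i)) := by
      rw [closure_Ioc hc.2.ne]; exact ⟨le_rfl, hc.2.le⟩
    have hclosed : IsClosed {t | 0 ≤ P.turn i * deriv θ t} :=
      isClosed_le continuous_const (continuous_const.mul hcont)
    exact hclosed.closure_subset_iff.2 (fun t ht => (hr t ht).le) hcl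
  have hθc : deriv θ c = 0 := by
    rw [P.turn_eq_neg_of_ne hi] at h0l
    rcases P.turn_eq_or i with e | e <;> rw [e] at h0l h0r <;> linarith
  refine ⟨c, hc, fun t ht => ?_, fun t ht => ?_, hθc, ?_, hanti2⟩
  · rcases le_total (a i) t with h1 | h1
    · exact hl t ⟨h1, ht.2⟩
    · exact h.chord_deriv (i - 1) t ⟨ht.1, by rw [sub_add_cancel]; exact h1⟩
  · rcases le_total t (b i) with h1 | h1
    · exact hr t ⟨ht.1, h1⟩
    · exact h.chord_deriv i t ⟨h1, ht.2⟩
  · refine lt_of_le_of_ne ?_ (h.immersed c hθc)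
    have h1 := hanti.derivWithin_nonpos (x := c)
    rwa [derivWithin_of_mem_nhds (Icc_mem_nhds hc.1 hc.2)] at h1

end IsFrontLift

end RectilinearPolygon

/-! ### Plane curves with a prescribed angle function -/

lemma norm_tvec_le (θ : ℝ) : ‖tvec θ‖ ≤ 1 := by
  rw [Prod.norm_def, max_le_iff]
  simp only [tvec, Real.norm_eq_abs, abs_neg]
  exact ⟨Real.abs_sin_le_one θ, Real.abs_cos_le_one θ⟩

lemma norm_tvec_sub_le (θ φ : ℝ) : ‖tvec θ - tvec φ‖ ≤ |θ - φ| := by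
  have h1 : |Real.cos θ - Real.cos φ| ≤ |θ - φ| := by
    simpa [Real.dist_eq] using Real.lipschitzWith_cos.dist_le_mul θ φ
  have h2 : |Real.sin θ - Real.sin φ| ≤ |θ - φ| := by
    simpa [Real.dist_eq] using Real.lipschitzWith_sin.dist_le_mul θ φ
  rw [Prod.norm_def, max_le_iff]
  simp only [tvec, Prod.fst_sub, Prod.snd_sub, Real.norm_eq_abs]
  refine ⟨h2, ?_⟩
  rw [show -Real.cos θ - -Real.cos φ = -(Real.cos θ - Real.cos φ) by ring, abs_neg]
  exact h1

lemma abs_fst_le_norm (q : ℝ × ℝ) : |q.1| ≤ ‖q‖ := norm_fst_le q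

lemma abs_snd_le_norm (q : ℝ × ℝ) : |q.2| ≤ ‖q‖ := norm_snd_le q

lemma abs_nrm_le_norm (θ : ℝ) (q : ℝ × ℝ) : |nrm θ q| ≤ 2 * ‖q‖ := by
  linarith [abs_nrm_le θ q, abs_fst_le_norm q, abs_snd_le_norm q]

lemma abs_tng_le_norm (θ : ℝ) (q : ℝ × ℝ) : |tng θ q| ≤ 2 * ‖q‖ := by
  linarith [abs_tng_le θ q, abs_fst_le_norm q, abs_snd_le_norm q]

lemma l1_le_add (x y : ℝ × ℝ) :
    |x.1| + |x.2| ≤ (|(x - y).1| + |(x - y).2|) + (|y.1| + |y.2|) := by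
  have h1 := abs_add_le (x - y).1 y.1
  have h2 := abs_add_le (x - y).2 y.2
  rw [← Prod.fst_add, sub_add_cancel] at h1
  rw [← Prod.snd_add, sub_add_cancel] at h2
  linarith

lemma l1_segment_le {v w : ℝ × ℝ} {u M : ℝ} (hv : |v.1| + |v.2| ≤ M) (hw : |w.1| + |w.2| ≤ M)
    (h0 : 0 ≤ u) (h1 : u ≤ 1) : |(v + u • (w - v)).1| + |(v + u • (w - v)).2| ≤ M := by
  have key : ∀ x y : ℝ, |x + u * (y - x)| ≤ (1 - u) * |x| + u * |y| := fun x y => by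
    rw [show x + u * (y - x) = (1 - u) * x + u * y by ring]
    refine (abs_add_le _ _).trans ?_
    rw [abs_mul, abs_mul, abs_of_nonneg h0, abs_of_nonneg (by linarith : (0 : ℝ) ≤ 1 - u)]
  have h2 := key v.1 w.1
  have h3 := key v.2 w.2
  simp only [Prod.fst_add, Prod.snd_add, Prod.smul_fst, Prod.smul_snd, Prod.fst_sub,
    Prod.snd_sub, smul_eq_mul]
  nlinarith

lemma contDiff_tvec {θ : ℝ → ℝ} (h : ContDiff ℝ ∞ θ) : ContDiff ℝ ∞ fun t => tvec (θ t) := by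
  unfold tvec; fun_prop

lemma norm_sub_le_of_norm_deriv_le {E : Type*} [NormedAddCommGroup E] [NormedSpace ℝ E]
    {F F' : ℝ → E} {B B' : ℝ → ℝ} {x y : ℝ} (hxy : x ≤ y) (hF : ∀ t, HasDerivAt F (F' t) t)
    (hB : ∀ t, HasDerivAt B (B' t) t) (h : ∀ t ∈ Set.Icc x y, ‖F' t‖ ≤ B' t) :
    ‖F y - F x‖ ≤ B y - B x :=
  image_norm_le_of_norm_deriv_right_le_deriv_boundary (f := fun t => F t - F x)
    (B := fun t => B t - B x) (a := x) (b := y)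
    (fun t _ => ((hF t).sub_const (F x)).continuousAt.continuousWithinAt)
    (fun t _ => ((hF t).sub_const (F x)).hasDerivWithinAt) (by simp)
    (fun t => (hB t).sub_const (B x)) (fun t ht => h t ⟨ht.1, ht.2.le⟩) ⟨hxy, le_rfl⟩

lemma step_shift {x y : ℝ} (hxy : x < y) (hy : y < x + 1) (t : ℝ) :
    step x y (t + 1) - step x y t = 1 := by
  rw [shift_sub_eq (step_hasDerivAt x y) (bump_periodic x y) x t, step_left,
    step_eq_one hxy hy ⟨hy.le, le_rfl⟩, sub_zero]

lemma IsSubdivision.bump_eq_zero_or {n : ℕ} {a b : ℤ → ℝ} (h : IsSubdivision n a b) {i : ℕ}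
    (hi : i ∈ Finset.range n) {t : ℝ} (ht : t ∈ Set.Icc (a 0) (a 0 + 1)) :
    bump (a i) (b i) t = 0 ∨ t ∈ Set.Icc (a i) (b i) := by
  have hi' := Finset.mem_range.1 hi
  have h0 : a 0 ≤ a i := h.strictMono_a.monotone (by positivity)
  have h1 : b i ≤ a 0 + 1 := by
    rw [← h.shift_a]
    exact (h.lt_of_lt (by omega)).le
  by_cases hm : t ∈ Set.Icc (a i) (b i)
  · exact Or.inr hm
  · rw [Set.mem_Icc, not_and_or, not_le, not_le] at hm
    refine Or.inl ?_
    rcases hm with hm | hm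
    · exact bump_eq_zero_left (h.lt i) ⟨by linarith [ht.1], hm.le⟩
    · exact bump_eq_zero (h.lt i) ⟨hm.le, by linarith [ht.2]⟩

/-- Solving a linear system close to a diagonal one. -/
lemma exists_solution_of_near_diagonal {A B C D r s ρ σ : ℝ} (hσ : σ = 1 ∨ σ = -1)
    (hA : |A - 1| ≤ 1 / 5) (hB : |B| ≤ 1 / 5) (hC : |C| ≤ 1 / 5) (hD : |D - σ| ≤ 1 / 5)
    (hr : |r| ≤ ρ) (hs : |s| ≤ ρ) :
    ∃ x y, A * x + B * y = r ∧ C * x + D * y = s ∧ |x| ≤ 4 * ρ ∧ |y| ≤ 4 * ρ := by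
  have hρ : 0 ≤ ρ := (abs_nonneg r).trans hr
  rw [abs_le] at hA hB hC
  have hAD : 16 / 25 ≤ σ * (A * D) := by
    rw [abs_le] at hD
    rcases hσ with rfl | rfl <;> nlinarith
  have hBC : |B * C| ≤ 1 / 25 := by
    rw [abs_mul]
    have := abs_le.2 hB
    have := abs_le.2 hC
    nlinarith [abs_nonneg B, abs_nonneg C]
  -- The diagonal product has absolute value at least `(4/5)²` and the other at most `(1/5)²`.
  -- Cramer's numerators are at most `7ρ/5`, which leaves room in the bound `4ρ`.
  have hdet : 1 / 2 ≤ |A * D - B * C| := by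
    rw [abs_le] at hBC
    rcases hσ with rfl | rfl
    · rw [le_abs]; left; linarith
    · rw [le_abs]; right; linarith
  have hne : A * D - B * C ≠ 0 := fun h0 => by rw [h0] at hdet; norm_num at hdet
  have bound : ∀ p q u v : ℝ, |p| ≤ 6 / 5 → |q| ≤ 1 / 5 → |u| ≤ ρ → |v| ≤ ρ →
      |(p * u - q * v) / (A * D - B * C)| ≤ 4 * ρ := by
    intro p q u v hp hq hu hv
    rw [abs_div, div_le_iff₀ (by linarith)]
    have h1 : |p * u - q * v| ≤ |p| * |u| + |q| * |v| := by
      rw [← abs_mul, ← abs_mul]; exact abs_sub _ _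
    have h2 : |p| * |u| ≤ 6 / 5 * ρ := by
      nlinarith [abs_nonneg p, abs_nonneg u]
    have h3 : |q| * |v| ≤ 1 / 5 * ρ := by
      nlinarith [abs_nonneg q, abs_nonneg v]
    nlinarith
  refine ⟨(D * r - B * s) / (A * D - B * C), (A * s - C * r) / (A * D - B * C), ?_, ?_,
    bound _ _ _ _ ?_ (abs_le.2 hB) hr hs, bound _ _ _ _ ?_ (abs_le.2 hC) hs hr⟩
  · rw [mul_div_assoc', mul_div_assoc', ← add_div, div_eq_iff hne]; ring
  · rw [mul_div_assoc', mul_div_assoc', ← add_div, div_eq_iff hne]; ring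
  · rw [abs_le] at hD ⊢
    rcases hσ with rfl | rfl <;> constructor <;> linarith
  · rw [abs_le]; constructor <;> linarith

namespace RectilinearPolygon

variable (P : RectilinearPolygon)

/-- The length of edge `i`. -/
def len (i : ℤ) : ℝ :=
  (P.dir i).vec.1 * (P.vertex (i + 1) - P.vertex i).1
    + (P.dir i).vec.2 * (P.vertex (i + 1) - P.vertex i).2

lemma len_spec (i : ℤ) : 0 < P.len i ∧ P.vertex (i + 1) = P.vertex i + P.len i • (P.dir i).vec := by
  obtain ⟨l, hl, e⟩ := P.edge i
  have : P.len i = l := by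
    unfold len
    rw [e]
    cases P.dir i <;> simp [Heading.vec]
  rw [this]
  exact ⟨hl, e⟩

lemma len_periodic (i : ℤ) : P.len (i + P.n) = P.len i := by
  unfold len
  rw [P.dir_periodic, show i + (P.n : ℤ) + 1 = i + 1 + P.n by ring, P.vertex_periodic,
    P.vertex_periodic]

lemma sum_len : ∑ i ∈ Finset.range P.n, P.len i • (P.dir i).vec = 0 := by
  have h : ∀ i ∈ Finset.range P.n, P.len (i : ℤ) • (P.dir (i : ℤ)).vec
      = P.vertex ((i + 1 : ℕ) : ℤ) - P.vertex (i : ℕ) := fun i _ => by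
    push_cast
    rw [(P.len_spec i).2, add_sub_cancel_left]
  rw [Finset.sum_congr rfl h, Finset.sum_range_sub (fun i : ℕ => P.vertex i)]
  have := P.vertex_periodic 0
  rw [zero_add] at this
  simp [this]

/-- A closed curve that runs along the edges of the polygon and stops at the vertices. -/
lemma exists_stopping_curve {a b : ℤ → ℝ} (hab : IsSubdivision P.n a b) :
    ∃ f : ℝ → ℝ × ℝ, Function.Periodic f 1 ∧
      (∀ t, HasDerivAt f (∑ i ∈ Finset.range P.n,
        bump (a i) (b i) t • (P.len i • (P.dir i).vec)) t) ∧
      (∀ i, ∀ t ∈ Set.Icc (a i) (a (i + 1)),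
        f t = P.vertex i + step (a i) (b i) t • (P.len i • (P.dir i).vec)) := by
  set c : ℤ → ℝ → ℝ × ℝ := fun i _ => P.len i • (P.dir i).vec with hc
  have hcper : ∀ i, c (i + P.n) = c i := fun i => by
    simp only [hc, P.len_periodic, P.dir_periodic]
  have hsm : ContDiff ℝ ∞ (bumpSum P.n a b c) := bumpSum_contDiff _ _ _ fun i => contDiff_const
  obtain ⟨f, -, hf, hf0⟩ := exists_primitive hsm (a 0) (P.vertex 0)
  have hwin : ∀ i, ∀ t ∈ Set.Icc (a i) (a (i + 1)),
      f t = f (a i) + step (a i) (b i) t • (P.len i • (P.dir i).vec) := by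
    intro i t ht
    have := sub_eq_sub_of_hasDerivAt (F := f)
      (G := fun t => step (a i) (b i) t • (P.len i • (P.dir i).vec)) ht.1
      (fun s _ => hf s) (fun s hs => by
        rw [bumpSum_apply hab hcper ⟨hs.1, hs.2.trans ht.2⟩]
        exact (step_hasDerivAt _ _ s).smul_const _)
    rw [step_left, zero_smul, sub_zero] at this
    rw [← this]
    abel
  have hv : ∀ i, f (a i) = P.vertex i := by
    intro i
    have := int_seq_const (f := fun i => f (a i) - P.vertex i) (fun i => by
      rw [hwin i (a (i + 1)) ⟨hab.strictMono_a.monotone (by omega), le_rfl⟩,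
        step_eq_one (hab.lt i) (hab.lt_add_one i) ⟨(hab.lt_next i).le, hab.next_le i⟩,
        (P.len_spec i).2, one_smul]
      abel) i
    simp only [hf0, sub_self] at this
    exact sub_eq_zero.1 this
  refine ⟨f, fun t => ?_, hf, fun i t ht => by rw [hwin i t ht, hv]⟩
  have h1 := shift_sub_eq hf (bumpSum_periodic _ _ _ fun i _ => rfl) (a 0) t
  have h2 := hv (0 + P.n)
  rw [hab.shift_a, P.vertex_periodic] at h2
  rw [h2, hf0, sub_self] at h1
  exact sub_eq_zero.1 h1

set_option maxHeartbeats 800000 in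
/-- A closed plane curve with a prescribed angle function that follows the polygon. -/
lemma exists_curve_of_angle {δ M : ℝ} (hδ : 0 < δ)
    (hM : ∀ i, |(P.vertex i).1| + |(P.vertex i).2| ≤ M) :
    ∃ ε₁, 0 < ε₁ ∧ ∀ {ε : ℝ} {α a b : ℤ → ℝ} {θ : ℝ → ℝ}, 0 < ε → ε ≤ ε₁ → P.IsAngleLift α →
      IsSubdivision P.n a b → ContDiff ℝ ∞ θ → (∀ t, ((θ (t + 1) : ℝ) : Real.Angle) = θ t) →
      (∀ i, ∀ t ∈ Set.Icc (a i) (b i), |θ t - α i| < ε) →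
      ∃ (q : ℝ → ℝ × ℝ) (ρ : ℝ → ℝ), ContDiff ℝ ∞ q ∧ Function.Periodic q 1 ∧ (∀ t, 0 < ρ t) ∧
        (∀ t, HasDerivAt q (ρ t • tvec (θ t)) t) ∧
        (∀ i, ∀ t ∈ Set.Icc (a i) (b i), |nrm (α i) (q t) - (P.dot i).2| < δ) ∧
        (∀ i, ∀ t ∈ Set.Icc (b i) (a (i + 1)), |(q t - P.vertex (i + 1)).1|
          + |(q t - P.vertex (i + 1)).2| < δ) ∧
        (∀ t, |(q t).1| + |(q t).2| ≤ M + δ) := by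
  obtain ⟨m, hm, hmlen⟩ := exists_common_pos P.n_pos (fun i D => D ≤ P.len i)
    (fun i => by simp only [P.len_periodic]) (fun i D D' h1 h2 => h1.trans h2)
    (fun i => ⟨P.len i, (P.len_spec i).1, le_rfl⟩)
  set L := ∑ i ∈ Finset.range P.n, P.len (i : ℤ) with hL
  have hL0 : 0 ≤ L := Finset.sum_nonneg fun i _ => (P.len_spec i).1.le
  -- The three bounds serve, in order, the near-diagonality of the closing equations, the positivity
  -- of the corrected lengths (`m` is a lower bound for the edge lengths), and closeness to the
  -- polygon.
  set ε₁ := min (1 / 10) (min (m / (9 * (1 + L))) (δ / (40 * (1 + L)))) with hε₁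
  refine ⟨ε₁, by positivity, ?_⟩
  intro ε α a b θ hε hεle hα hab hθ hθper hnear
  have hε1 : ε ≤ 1 / 10 := hεle.trans (min_le_left _ _)
  have hε2 : 8 * (ε * (1 + L)) < m := by
    have : ε ≤ m / (9 * (1 + L)) := hεle.trans ((min_le_right _ _).trans (min_le_left _ _))
    rw [le_div_iff₀ (by positivity)] at this
    nlinarith
  have hε3 : 34 * (ε * (1 + L)) < δ := by
    have : ε ≤ δ / (40 * (1 + L)) := hεle.trans ((min_le_right _ _).trans (min_le_right _ _))
    rw [le_div_iff₀ (by positivity)] at this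
    nlinarith
  have hvper : Function.Periodic (fun t => tvec (θ t)) 1 := fun t => tvec_congr (hθper t)
  have hvs := contDiff_tvec hθ
  -- The curve will have velocity `(ε + ∑ (len i + κ i) bump i) • tvec θ`. Its direction is
  -- prescribed, the constant `ε` keeps the speed positive, and the corrections `κ` make it close
  -- up. `V` and `G i` are primitives of the separate terms; `U` and `W i` are their increments over
  -- a period.
  obtain ⟨V, hVs, hV, -⟩ := exists_primitive hvs 0 0
  have hGex : ∀ i : ℤ, ∃ G : ℝ → ℝ × ℝ, ContDiff ℝ ∞ G ∧
      ∀ t, HasDerivAt G (bump (a i) (b i) t • tvec (θ t)) t := fun i => by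
    obtain ⟨G, h1, h2, -⟩ := exists_primitive ((bump_contDiff (a i) (b i)).smul hvs) 0 0
    exact ⟨G, h1, h2⟩
  choose G hGs hG using hGex
  have hGper : ∀ i, Function.Periodic (fun t => bump (a i) (b i) t • tvec (θ t)) 1 := fun i t => by
    simp only [bump_periodic _ _ t, hvper t]
  set W : ℤ → ℝ × ℝ := fun i => G i (a 0 + 1) - G i (a 0) with hW
  set U := V (a 0 + 1) - V (a 0) with hU
  have hUle : ‖U‖ ≤ 1 := by
    have := norm_sub_le_of_norm_deriv_le (F := V) (B := fun t => t) (B' := fun _ => 1)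
      (x := a 0) (y := a 0 + 1) (by linarith) hV (fun t => hasDerivAt_id t)
      (fun t _ => norm_tvec_le _)
    simpa using this
  have hWd : ∀ i, ‖W i - tvec (α i)‖ ≤ ε := by
    intro i
    have h1 : W i = G i (a i + 1) - G i (a i) := shift_sub_eq (hG i) (hGper i) (a i) (a 0)
    have := norm_sub_le_of_norm_deriv_le (F := fun t => G i t - step (a i) (b i) t • tvec (α i))
      (B := fun t => step (a i) (b i) t * ε) (x := a i) (y := a i + 1) (by linarith)
      (fun t => (hG i t).fun_sub ((step_hasDerivAt _ _ t).smul_const _))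
      (fun t => (step_hasDerivAt _ _ t).mul_const _) (fun t ht => by
        rw [← smul_sub, norm_smul, Real.norm_eq_abs, abs_of_nonneg (bump_nonneg (hab.lt i) t)]
        rcases le_total t (b i) with h2 | h2
        · exact mul_le_mul_of_nonneg_left
            ((norm_tvec_sub_le _ _).trans (hnear i t ⟨ht.1, h2⟩).le) (bump_nonneg (hab.lt i) t)
        · rw [bump_eq_zero (hab.lt i) ⟨h2, ht.2⟩]; simp)
    rw [step_left, step_eq_one (hab.lt i) (hab.lt_add_one i) ⟨(hab.lt_add_one i).le, le_rfl⟩] at this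
    rw [h1]
    rw [one_smul, zero_smul, sub_zero, one_mul, zero_mul, sub_zero] at this
    rwa [sub_right_comm]
  -- This is the closing defect without corrections. It is small because each `W i` is within `ε` of
  -- the direction of edge `i`, and the polygon itself closes.
  set R := ε • U + ∑ i ∈ Finset.range P.n, P.len (i : ℤ) • W i with hR
  have hRle : ‖R‖ ≤ ε * (1 + L) := by
    have e : R = ε • U + ∑ i ∈ Finset.range P.n, P.len (i : ℤ) • (W i - tvec (α i)) := by
      have h0 := P.sum_len
      simp only [hα.vec] at h0
      simp only [smul_sub, Finset.sum_sub_distrib, h0, sub_zero, hR]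
    rw [e, mul_add, mul_one]
    refine (norm_add_le _ _).trans (add_le_add ?_ ((norm_sum_le _ _).trans ?_))
    · rw [norm_smul, Real.norm_eq_abs, abs_of_pos hε]
      nlinarith [norm_nonneg U]
    · rw [hL, Finset.mul_sum]
      refine Finset.sum_le_sum fun i _ => ?_
      rw [norm_smul, Real.norm_eq_abs, abs_of_pos (P.len_spec i).1, mul_comm]
      exact mul_le_mul_of_nonneg_right (hWd i) (P.len_spec i).1.le
  have hcoord : ∀ (p q : ℝ × ℝ), ‖p - q‖ ≤ ε →
      |tng (α 0) p - tng (α 0) q| ≤ 1 / 5 ∧ |nrm (α 0) p - nrm (α 0) q| ≤ 1 / 5 := by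
    intro p q h
    rw [← tng_sub, ← nrm_sub]
    exact ⟨(abs_tng_le_norm _ _).trans (by linarith), (abs_nrm_le_norm _ _).trans (by linarith)⟩
  have hα1 : α 1 - α 0 = P.turn 0 * (Real.pi / 2) := by
    have := hα.step 0
    rw [zero_add] at this
    linarith
  have hcos1 : Real.cos (α 1 - α 0) = 0 := by
    rw [hα1]
    rcases P.turn_eq_or 0 with e | e <;> rw [e] <;> simp
  have hsin1 : Real.sin (α 1 - α 0) = P.turn 0 := by
    rw [hα1]
    rcases P.turn_eq_or 0 with e | e <;> rw [e] <;> simp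
  obtain ⟨hA, hC⟩ := hcoord _ _ (hWd 0)
  obtain ⟨hB, hD⟩ := hcoord _ _ (hWd 1)
  rw [tng_tvec] at hA hB
  rw [nrm_tvec] at hC hD
  rw [sub_self, Real.cos_zero] at hA
  rw [sub_self, Real.sin_zero, sub_zero] at hC
  rw [hcos1, sub_zero] at hB
  rw [hsin1] at hD
  -- Edges 0 and 1 are perpendicular, so `W 0` and `W 1` nearly form an orthonormal frame. Changing
  -- only these two lengths cancels the defect.
  obtain ⟨x, y, e1, e2, hx, hy⟩ := exists_solution_of_near_diagonal (P.turn_eq_or 0) hA hB hC hD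
    (r := -tng (α 0) R) (s := -nrm (α 0) R) (ρ := 2 * (ε * (1 + L)))
    (by rw [abs_neg]; exact (abs_tng_le_norm _ _).trans (by linarith))
    (by rw [abs_neg]; exact (abs_nrm_le_norm _ _).trans (by linarith))
  have hclose : x • W 0 + y • W 1 + R = 0 := by
    refine eq_of_nrm_tng (θ := α 0) ?_ ?_
    · simp only [nrm_add, nrm_smul]
      rw [show nrm (α 0) 0 = 0 by simp [nrm]]
      linarith
    · simp only [tng_add, tng_smul]
      rw [show tng (α 0) 0 = 0 by simp [tng]]
      linarith
  set κ : ℕ → ℝ := fun i => if i = 0 then x else if i = 1 then y else 0 with hκ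
  have hn3 := P.three_le_n
  have hκsum : ∀ {E : Type} [AddCommGroup E] [Module ℝ E] (w : ℕ → E),
      ∑ i ∈ Finset.range P.n, κ i • w i = x • w 0 + y • w 1 := by
    intro E _ _ w
    rw [← Finset.sum_subset (s₁ := {0, 1})]
    · rw [Finset.sum_pair (by norm_num)]
      simp [hκ]
    · intro i hi
      simp only [Finset.mem_insert, Finset.mem_singleton] at hi
      rw [Finset.mem_range]
      omega
    · intro i _ hi
      simp only [Finset.mem_insert, Finset.mem_singleton, not_or] at hi
      simp [hκ, hi.1, hi.2]
  have hκabs : ∑ i ∈ Finset.range P.n, |κ i| = |x| + |y| := by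
    rw [← Finset.sum_subset (s₁ := {0, 1})]
    · rw [Finset.sum_pair (by norm_num)]
      simp [hκ]
    · intro i hi
      simp only [Finset.mem_insert, Finset.mem_singleton] at hi
      rw [Finset.mem_range]
      omega
    · intro i _ hi
      simp only [Finset.mem_insert, Finset.mem_singleton, not_or] at hi
      simp [hκ, hi.1, hi.2]
  have hκle : ∀ i, |κ i| ≤ 8 * (ε * (1 + L)) := by
    intro i
    simp only [hκ]
    split_ifs
    · linarith
    · linarith
    · rw [abs_zero]; positivity
  have hc : ∀ i : ℕ, 0 < P.len i + κ i := by
    intro i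
    have h1 := hmlen i
    have h2 := (abs_le.1 (hκle i)).1
    linarith
  obtain ⟨f, hfper, hf, hfval⟩ := P.exists_stopping_curve hab
  set Q : ℝ → ℝ × ℝ := fun t => ε • V t + ∑ i ∈ Finset.range P.n, (P.len i + κ i) • G i t with hQ
  set ρ : ℝ → ℝ := fun t => ε + ∑ i ∈ Finset.range P.n, (P.len i + κ i) * bump (a i) (b i) t
    with hρ
  have hρpos : ∀ t, 0 < ρ t := fun t => add_pos_of_pos_of_nonneg hε
    (Finset.sum_nonneg fun i _ => mul_nonneg (hc i).le (bump_nonneg (hab.lt i) t))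
  have hQd : ∀ t, HasDerivAt Q (ρ t • tvec (θ t)) t := by
    intro t
    have h1 := ((hV t).fun_const_smul ε).fun_add (HasDerivAt.fun_sum (u := Finset.range P.n)
      fun i _ => (hG i t).fun_const_smul (P.len i + κ i))
    refine h1.congr_deriv ?_
    simp only [hρ, add_smul, Finset.sum_smul, smul_smul]
  have hQs : ContDiff ℝ ∞ Q := (hVs.const_smul ε).add
    (ContDiff.sum fun i _ => (hGs i).const_smul _)
  have hρper : Function.Periodic (fun t => ρ t • tvec (θ t)) 1 := fun t => by
    simp only [hρ, hvper t, bump_periodic _ _ t]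
  have hQclose : Q (a 0 + 1) - Q (a 0) = 0 := by
    have h0 := hκsum (fun i : ℕ => W i)
    rw [Nat.cast_zero, Nat.cast_one] at h0
    rw [← hclose, hR, ← h0]
    simp only [hQ, hU, hW, smul_sub, add_smul, Finset.sum_add_distrib, Finset.sum_sub_distrib]
    abel
  have hQper : Function.Periodic Q 1 := fun t => by
    have := shift_sub_eq hQd hρper (a 0) t
    rw [hQclose] at this
    exact sub_eq_zero.1 this
  -- The deviation from the stopping curve accumulates at most `ε` from the constant speed, `|x| +
  -- |y| ≤ 16 ε (1 + L)` from the corrections, and `L ε` from the directions. Periodicity extends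
  -- the bound from one period to all times.
  have hmain : ∀ t, ‖(Q t - Q (a 0)) - (f t - f (a 0))‖ ≤ 17 * (ε * (1 + L)) := by
    have hwin : ∀ t ∈ Set.Icc (a 0) (a 0 + 1),
        ‖(Q t - Q (a 0)) - (f t - f (a 0))‖ ≤ 17 * (ε * (1 + L)) := by
      intro t ht
      have hB : ∀ t, HasDerivAt (fun t => ε * t + ∑ i ∈ Finset.range P.n,
          step (a i) (b i) t * (|κ i| + P.len i * ε))
          (ε + ∑ i ∈ Finset.range P.n, bump (a i) (b i) t * (|κ i| + P.len i * ε)) t := by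
        intro t
        have := ((hasDerivAt_id t).const_mul ε).fun_add (HasDerivAt.fun_sum
          (u := Finset.range P.n) fun i _ =>
            (step_hasDerivAt (a i) (b i) t).mul_const (|κ i| + P.len i * ε))
        simpa using this
      have h1 := norm_sub_le_of_norm_deriv_le (F := fun t => Q t - f t) ht.1
        (fun t => (hQd t).fun_sub (hf t)) hB (fun s hs => by
          have hs' : s ∈ Set.Icc (a 0) (a 0 + 1) := ⟨hs.1, hs.2.trans ht.2⟩
          have e : ρ s • tvec (θ s) - ∑ i ∈ Finset.range P.n,
              bump (a i) (b i) s • (P.len i • (P.dir i).vec)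
              = ε • tvec (θ s) + ∑ i ∈ Finset.range P.n, bump (a i) (b i) s •
                (κ i • tvec (θ s) + P.len i • (tvec (θ s) - tvec (α i))) := by
            simp only [hρ, add_smul, Finset.sum_smul]
            rw [add_sub_assoc, ← Finset.sum_sub_distrib]
            congr 1
            refine Finset.sum_congr rfl fun i _ => ?_
            rw [hα.vec]
            module
          rw [e]
          refine (norm_add_le _ _).trans (add_le_add ?_ ((norm_sum_le _ _).trans
            (Finset.sum_le_sum fun i hi => ?_)))
          · rw [norm_smul, Real.norm_eq_abs, abs_of_pos hε]
            nlinarith [norm_tvec_le (θ s)]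
          · rw [norm_smul, Real.norm_eq_abs, abs_of_nonneg (bump_nonneg (hab.lt i) s)]
            rcases hab.bump_eq_zero_or hi hs' with h0 | h0
            · rw [h0]; simp
            · refine mul_le_mul_of_nonneg_left ((norm_add_le _ _).trans (add_le_add ?_ ?_))
                (bump_nonneg (hab.lt i) s)
              · rw [norm_smul, Real.norm_eq_abs]
                nlinarith [norm_tvec_le (θ s), abs_nonneg (κ i)]
              · rw [norm_smul, Real.norm_eq_abs, abs_of_pos (P.len_spec i).1]
                exact mul_le_mul_of_nonneg_left
                  ((norm_tvec_sub_le _ _).trans (hnear i s h0).le) (P.len_spec i).1.le)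
      have h2 : ∀ i : ℕ, (step (a i) (b i) t - step (a i) (b i) (a 0)) * (|κ i| + P.len i * ε)
          ≤ |κ i| + P.len i * ε := by
        intro i
        have h3 := step_shift (hab.lt i) (hab.lt_add_one i) (a 0)
        have h4 := step_mono (hab.lt i) ht.2
        have h5 : 0 ≤ |κ i| + P.len i * ε :=
          add_nonneg (abs_nonneg _) (mul_nonneg (P.len_spec i).1.le hε.le)
        nlinarith
      have h3 : ∑ i ∈ Finset.range P.n,
          (step (a i) (b i) t - step (a i) (b i) (a 0)) * (|κ i| + P.len i * ε)
          ≤ (|x| + |y|) + L * ε := by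
        refine (Finset.sum_le_sum fun i _ => h2 i).trans ?_
        rw [Finset.sum_add_distrib, hκabs, ← Finset.sum_mul]
      simp only [sub_mul, Finset.sum_sub_distrib] at h3
      rw [show Q t - Q (a 0) - (f t - f (a 0)) = Q t - f t - (Q (a 0) - f (a 0)) by abel]
      refine h1.trans ?_
      nlinarith [ht.2]
    intro t
    have e1 := hwin (t - ⌊t - a 0⌋) ⟨by linarith [Int.floor_le (t - a 0)],
      by linarith [Int.lt_floor_add_one (t - a 0)]⟩
    have e2 : Q (t - ⌊t - a 0⌋) = Q t := by simpa using hQper.sub_zsmul_eq ⌊t - a 0⌋ (x := t)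
    have e3 : f (t - ⌊t - a 0⌋) = f t := by simpa using hfper.sub_zsmul_eq ⌊t - a 0⌋ (x := t)
    rwa [e2, e3] at e1
  have hdist : ∀ t, ‖(Q t - Q (a 0) + f (a 0)) - f t‖ ≤ 17 * (ε * (1 + L)) := fun t => by
    convert hmain t using 2
    abel
  have hl1 : ∀ t, |(Q t - Q (a 0) + f (a 0) - f t).1| + |(Q t - Q (a 0) + f (a 0) - f t).2| < δ :=
    fun t => by
      have := hdist t
      linarith [abs_fst_le_norm (Q t - Q (a 0) + f (a 0) - f t),
        abs_snd_le_norm (Q t - Q (a 0) + f (a 0) - f t)]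
  refine ⟨fun t => Q t - Q (a 0) + f (a 0), ρ, (hQs.sub contDiff_const).add contDiff_const,
    fun t => by simp only [hQper t], hρpos, fun t => ((hQd t).sub_const _).add_const _,
    fun i t ht => ?_, fun i t ht => ?_, fun t => ?_⟩
  · have e : nrm (α i) (f t) = (P.dot i).2 := by
      rw [hfval i t ⟨ht.1, ht.2.trans (hab.lt_next i).le⟩, nrm_add, nrm_smul, nrm_smul, hα.vec,
        nrm_tvec, hα.nrm_vertex]
      simp
    rw [← e, ← nrm_sub]
    exact (abs_nrm_le _ _).trans_lt (hl1 t)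
  · have e : f t = P.vertex (i + 1) := by
      rw [hfval i t ⟨(hab.lt i).le.trans ht.1, ht.2⟩,
        step_eq_one (hab.lt i) (hab.lt_add_one i) ⟨ht.1, ht.2.trans (hab.next_le i)⟩, one_smul,
        (P.len_spec i).2]
    rw [← e]
    exact hl1 t
  · obtain ⟨i, hi⟩ := hab.exists_mem t
    have e := hfval i t ⟨hi.1, hi.2.le⟩
    have h0 := step_nonneg (hab.lt i) hi.1
    have h1 := step_le_one (hab.lt i) (hab.lt_add_one i) (hi.2.le.trans (hab.next_le i))
    have hv : P.len i • (P.dir i).vec = P.vertex (i + 1) - P.vertex i := by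
      rw [(P.len_spec i).2, add_sub_cancel_left]
    rw [hv] at e
    have hfM := l1_segment_le (hM i) (hM (i + 1)) h0 h1
    rw [← e] at hfM
    linarith [hl1 t, l1_le_add (Q t - Q (a 0) + f (a 0)) (f t)]

end RectilinearPolygon

/-! ### Recovering the heights of dots from value and slope -/

lemma abs_comb_le {v w x y η : ℝ} (hv : |v| ≤ 1) (hw : |w| ≤ 1) (hx : |x| ≤ η) (hy : |y| ≤ η) :
    |v * x - w * y| ≤ 2 * η := by
  refine (abs_sub _ _).trans ?_
  rw [abs_mul, abs_mul]
  nlinarith [abs_nonneg v, abs_nonneg w, abs_nonneg x, abs_nonneg y]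

lemma abs_le_of_mul_eq {C E W η : ℝ} (hW : 1 / 4 ≤ W) (hE : C * W = E) (hle : |E| ≤ 2 * η) :
    |C| ≤ 8 * η := by
  rw [← hE, abs_mul, abs_of_nonneg (by linarith : 0 ≤ W)] at hle
  have := mul_le_mul_of_nonneg_left hW (abs_nonneg C)
  linarith

/-- Two functions in the span of the interpolated pair `f, g` that nearly agree to first order
have nearly equal coefficients. -/
lemma coeff_le_of_jet_le {A B x p η : ℝ} (hx : x ∈ Set.Icc 0 (Real.pi / 2))
    (hp : p ∈ Set.Icc (0 : ℝ) 1)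
    (h0 : |A * ((1 - p) * (1 - x * (2 / Real.pi)) + p * Real.cos x)
      + B * ((1 - p) * (x * (2 / Real.pi)) + p * Real.sin x)| ≤ η)
    (h1 : |B * ((1 - p) * (2 / Real.pi) + p * Real.cos x)
      - A * ((1 - p) * (2 / Real.pi) + p * Real.sin x)| ≤ η) :
    |A| ≤ 8 * η ∧ |B| ≤ 8 * η := by
  obtain ⟨hx0, hx1⟩ := hx
  obtain ⟨hp0, hp1⟩ := hp
  have hpi := Real.pi_pos
  have hpi3 := Real.pi_gt_three
  have hpi4 := Real.pi_lt_four
  have hc0 : 0 ≤ Real.cos x := Real.cos_nonneg_of_mem_Icc ⟨by linarith, hx1⟩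
  have hs0 : 0 ≤ Real.sin x := Real.sin_nonneg_of_nonneg_of_le_pi hx0 (by linarith)
  have hc1 := Real.cos_le_one x
  have hs1 := Real.sin_le_one x
  have hcs := Real.sin_sq_add_cos_sq x
  have hk0 : 1 / 2 ≤ 2 / Real.pi := by
    rw [div_le_div_iff₀ two_pos hpi]; linarith
  have hk1 : 2 / Real.pi ≤ 1 := by
    rw [div_le_one hpi]; linarith
  have hu0 : 0 ≤ x * (2 / Real.pi) := by positivity
  have hu1 : x * (2 / Real.pi) ≤ 1 := by
    calc x * (2 / Real.pi) ≤ Real.pi / 2 * (2 / Real.pi) :=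
          mul_le_mul_of_nonneg_right hx1 (by positivity)
      _ = 1 := by field_simp
  generalize 2 / Real.pi = k at *
  generalize x * k = u at *
  generalize Real.cos x = c at *
  generalize Real.sin x = s at *
  set r := 1 - p with hr
  have hr0 : 0 ≤ r := by linarith
  have hη : 0 ≤ η := (abs_nonneg _).trans h0
  -- `f` and `g` interpolate between the linear pair `1 - u, u` and the pair `cos, sin`. Their
  -- derivatives in `x` are `-f'` and `g'`, so `f * g' + f' * g` is the Wronskian and Cramer's rule
  -- yields the coefficients.
  set f := r * (1 - u) + p * c with hf
  set g := r * u + p * s with hg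
  set g' := r * k + p * c with hg'
  set f' := r * k + p * s with hf'
  have b1 : 0 ≤ r * (1 - u) := mul_nonneg hr0 (by linarith)
  have b2 : 0 ≤ p * c := mul_nonneg hp0 hc0
  have b3 : 0 ≤ r * u := mul_nonneg hr0 hu0
  have b4 : 0 ≤ p * s := mul_nonneg hp0 hs0
  have b5 : 0 ≤ r * k := mul_nonneg hr0 (by linarith)
  have b6 : p * c ≤ p := by nlinarith
  have b7 : p * s ≤ p := by nlinarith
  have b8 : r * k ≤ r := by nlinarith
  have b9 : r * u ≤ r := by nlinarith
  -- All mixed terms are nonnegative, and `r² k + p² ≥ r² / 2 + p² ≥ 1 / 4` because `r + p = 1` and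
  -- `k ≥ 1 / 2`.
  have hW : 1 / 4 ≤ f * g' + f' * g := by
    have e : f * g' + f' * g = r ^ 2 * k + p ^ 2 * (s ^ 2 + c ^ 2)
        + (r * (1 - u) * (p * c) + p * c * (r * k) + r * k * (p * s) + p * s * (r * u)) := by
      simp only [hf, hg, hf', hg']; ring
    have n1 := mul_nonneg b1 b2
    have n2 := mul_nonneg b2 b5
    have n3 := mul_nonneg b5 b4
    have n4 := mul_nonneg b4 b3
    rw [e, hcs]
    nlinarith [sq_nonneg r, sq_nonneg p, sq_nonneg (r - p)]
  have hfb : |f| ≤ 1 ∧ |g| ≤ 1 ∧ |f'| ≤ 1 ∧ |g'| ≤ 1 := by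
    refine ⟨?_, ?_, ?_, ?_⟩ <;> rw [abs_le] <;> constructor <;> linarith
  constructor
  · exact abs_le_of_mul_eq hW (by ring) (abs_comb_le hfb.2.2.2 hfb.2.1 h0 h1)
  · exact abs_le_of_mul_eq hW
      (show B * (f * g' + f' * g) = f * (B * g' - A * f') - (-f') * (A * f + B * g) by ring)
      (abs_comb_le hfb.1 (by rw [abs_neg]; exact hfb.2.2.1) h1 h0)

lemma Heading.eq_of_cos_pos {h k : Heading} (hc : 0 < Real.cos (h.dotAngle - k.dotAngle)) :
    h = k := by
  rw [Real.cos_sub, cos_dotAngle, cos_dotAngle, sin_dotAngle, sin_dotAngle] at hc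
  cases h <;> cases k <;> first | rfl | (exfalso; simp only [vec] at hc; linarith)

/-! ### Interpolation over a fixed angle function -/

namespace RectilinearPolygon

/-- A smoothing of the polygonal path together with a plane curve near the polygon that has the
same angle function. -/
structure IsFrontWithCurve (P : RectilinearPolygon) (ε δ D M : ℝ) (α a b : ℤ → ℝ)
    (θ y z : ℝ → ℝ) (q : ℝ → ℝ × ℝ) (ρ : ℝ → ℝ) : Prop where
  front : P.IsFrontLift ε α a b θ y z
  smooth : ContDiff ℝ ∞ q
  periodic : Function.Periodic q 1
  speed_pos : ∀ t, 0 < ρ t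
  hasDerivAt : ∀ t, HasDerivAt q (ρ t • tvec (θ t)) t
  edge : ∀ i, ∀ t ∈ Set.Icc (a i) (b i), |nrm (α i) (q t) - (P.dot i).2| < δ
  vertex : ∀ i, ∀ t ∈ Set.Icc (b i) (a (i + 1)), |(q t - P.vertex (i + 1)).1|
    + |(q t - P.vertex (i + 1)).2| < δ
  bound : ∀ t, |(q t).1| + |(q t).2| ≤ M + δ
  vertex_bound : ∀ i, |(P.vertex i).1| + |(P.vertex i).2| ≤ M
  separation : ∀ i j : ℤ, ((P.dir i).IsHorizontal ↔ (P.dir j).IsHorizontal) → ∀ q : ℝ × ℝ,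
    |(P.dir i).dotHeight q - (P.dot i).2| < D → |(P.dir j).dotHeight q - (P.dot j).2| < D →
    (P.n : ℤ) ∣ i - j
  ε_le : ε ≤ 1 / 10
  D_pos : 0 < D
  δ_lt : 32 * δ < D
  ε_lt : (1 + 2 * M) * ε < D
  εδ_lt : ε * (M + δ) + δ < D

variable {P : RectilinearPolygon}

lemma IsAngleLift.exists_int {α : ℤ → ℝ} (hα : P.IsAngleLift α) (i : ℤ) :
    ∃ m : ℤ, α i = m * (Real.pi / 2) := by
  obtain ⟨k, hk⟩ := exists_int_of_coe_eq (hα.coe i)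
  rw [hk]
  cases P.dir i
  · exact ⟨1 + 4 * k, by simp only [Heading.dotAngle]; push_cast; ring⟩
  · exact ⟨2 + 4 * k, by simp only [Heading.dotAngle]; push_cast; ring⟩
  · exact ⟨3 + 4 * k, by simp only [Heading.dotAngle]; push_cast; ring⟩
  · exact ⟨4 * k, by simp only [Heading.dotAngle]; push_cast; ring⟩

namespace IsFrontWithCurve

variable {ε δ D M : ℝ} {α a b : ℤ → ℝ} {θ y z : ℝ → ℝ} {q : ℝ → ℝ × ℝ} {ρ : ℝ → ℝ}

lemma index_of_height (h : P.IsFrontWithCurve ε δ D M α a b θ y z q ρ) {i j : ℤ} {x : ℝ}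
    (hij : P.dir i = P.dir j) (hi : |x - (P.dot i).2| < D) (hj : |x - (P.dot j).2| < D) :
    ∃ k : ℤ, i = j + k * P.n := by
  obtain ⟨q₀, hq⟩ := exists_point_dotHeight (P.dir i) x
  obtain ⟨k, hk⟩ := h.separation i j (by rw [hij]) q₀ (by rw [hq]; exact hi)
    (by rw [← hij, hq]; exact hj)
  exact ⟨k, by linarith⟩

lemma nrm_vertex_lt (h : P.IsFrontWithCurve ε δ D M α a b θ y z q ρ) {i : ℤ} {t : ℝ}
    (ht : t ∈ Set.Icc (b i) (a (i + 1))) :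
    |nrm (α i) (q t) - (P.dot i).2| < δ ∧ |nrm (α (i + 1)) (q t) - (P.dot (i + 1)).2| < δ := by
  have hv := h.vertex i t ht
  rw [← h.front.angleLift.nrm_vertex_succ i, ← h.front.angleLift.nrm_vertex (i + 1),
    ← nrm_sub, ← nrm_sub]
  exact ⟨(abs_nrm_le _ _).trans_lt hv, (abs_nrm_le _ _).trans_lt hv⟩

/-- The window consists of the times of dot `k` and of its two adjacent chords, that is, of edge `k`
and its two vertices, and all of these lie on the line of edge `k`. -/
lemma nrm_window_lt (h : P.IsFrontWithCurve ε δ D M α a b θ y z q ρ) {k : ℤ} {t : ℝ}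
    (ht : t ∈ Set.Icc (b (k - 1)) (a (k + 1))) : |nrm (α k) (q t) - (P.dot k).2| < δ := by
  rcases le_total t (a k) with h1 | h1
  · have := (h.nrm_vertex_lt (i := k - 1) ⟨ht.1, by rw [sub_add_cancel]; exact h1⟩).2
    rwa [sub_add_cancel] at this
  · rcases le_total t (b k) with h2 | h2
    · exact h.edge k t ⟨h1, h2⟩
    · exact (h.nrm_vertex_lt ⟨h2, ht.2⟩).1

lemma abs_height_le (h : P.IsFrontWithCurve ε δ D M α a b θ y z q ρ) (i : ℤ) :
    |(P.dot i).2| ≤ M := by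
  rw [← h.front.angleLift.nrm_vertex]
  exact (abs_nrm_le _ _).trans (h.vertex_bound i)

lemma abs_slope_le (h : P.IsFrontWithCurve ε δ D M α a b θ y z q ρ) (i : ℤ) :
    |P.slope i| ≤ 2 * M := by
  have h1 := h.abs_height_le i
  have h2 := h.abs_height_le (i + 1)
  have hpi := Real.pi_pos
  have hk : 2 / Real.pi ≤ 1 := by rw [div_le_one hpi]; linarith [Real.pi_gt_three]
  unfold slope
  rw [abs_mul, abs_mul, P.abs_turn, one_mul, abs_of_pos (by positivity)]
  have h3 := abs_sub (P.dot (i + 1)).2 (P.dot i).2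
  nlinarith [abs_nonneg ((P.dot (i + 1)).2 - (P.dot i).2)]

/-- On a segment, the angle is `α i + turn i * x` with `0 ≤ x ≤ π / 2`. -/
lemma chord_angle (h : P.IsFrontWithCurve ε δ D M α a b θ y z q ρ) {i : ℤ} {t : ℝ}
    (ht : t ∈ Set.Icc (b i) (a (i + 1))) :
    ∃ x ∈ Set.Icc 0 (Real.pi / 2), θ t = α i + P.turn i * x := by
  obtain ⟨u, hu, e, -⟩ := h.front.chord i t ht
  have := Real.pi_pos
  exact ⟨u * (Real.pi / 2), ⟨by nlinarith [hu.1], by nlinarith [hu.2]⟩, e⟩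

lemma abs_window_le (h : P.IsFrontWithCurve ε δ D M α a b θ y z q ρ) {k : ℤ} {t : ℝ}
    (ht : t ∈ Set.Icc (b (k - 1)) (a (k + 1))) : |θ t - α k| ≤ Real.pi / 2 := by
  have hpi := Real.pi_gt_three
  rcases le_total t (a k) with h1 | h1
  · obtain ⟨x, hx, e⟩ := h.chord_angle (i := k - 1) ⟨ht.1, by rw [sub_add_cancel]; exact h1⟩
    have h2 := h.front.angleLift.step (k - 1)
    rw [sub_add_cancel] at h2
    rw [e, h2, show α (k - 1) + P.turn (k - 1) * x - (α (k - 1) + P.turn (k - 1) * (Real.pi / 2))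
      = P.turn (k - 1) * (x - Real.pi / 2) by ring, abs_mul, P.abs_turn, one_mul, abs_le]
    constructor <;> linarith [hx.1, hx.2]
  · rcases le_total t (b k) with h2 | h2
    · have := (h.front.near k t ⟨h1, h2⟩).1
      linarith [h.ε_le]
    · obtain ⟨x, hx, e⟩ := h.chord_angle ⟨h2, ht.2⟩
      rw [e, add_sub_cancel_left, abs_mul, P.abs_turn, one_mul, abs_le]
      constructor <;> linarith [hx.1, hx.2]

/-- Slopes are bounded by `2 M`, so along a chord the height changes by at most `2 M ε` while the
angle stays within `ε` of the dot; `ε_lt` is tailored to this. -/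
lemma z_near (h : P.IsFrontWithCurve ε δ D M α a b θ y z q ρ) {k : ℤ} {t : ℝ}
    (ht : t ∈ Set.Icc (b (k - 1)) (a (k + 1))) (hθ : |θ t - α k| ≤ ε) :
    |z t - (P.dot k).2| < D := by
  have hε : 0 ≤ ε := (abs_nonneg _).trans hθ
  have hM : 0 ≤ M := (abs_nonneg _).trans (h.abs_height_le 0)
  have key : ∀ i, |P.slope i * (θ t - α k)| < D := fun i => by
    rw [abs_mul]
    have h1 := h.abs_slope_le i
    have h2 := h.ε_lt
    have h3 : |P.slope i| * |θ t - α k| ≤ 2 * M * ε :=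
      mul_le_mul h1 hθ (abs_nonneg _) (by linarith)
    linarith
  rcases le_total t (a k) with h1 | h1
  · have e := h.front.z_chord (i := k - 1) ⟨ht.1, by rw [sub_add_cancel]; exact h1⟩
    have h2 := h.front.angleLift.step (k - 1)
    rw [sub_add_cancel] at h2
    have e2 : P.slope (k - 1) * (α k - α (k - 1)) = (P.dot k).2 - (P.dot (k - 1)).2 := by
      rw [h2, slope, sub_add_cancel]
      have := P.turn_mul_self (k - 1)
      have := Real.pi_ne_zero
      field_simp
      linear_combination (Real.pi * ((P.dot k).2 - (P.dot (k - 1)).2)) * P.turn_mul_self (k - 1)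
    rw [e, show (P.dot (k - 1)).2 + P.slope (k - 1) * (θ t - α (k - 1)) - (P.dot k).2
      = P.slope (k - 1) * (θ t - α k) by linear_combination e2]
    exact key _
  · rcases le_total t (b k) with h2 | h2
    · have := (h.front.near k t ⟨h1, h2⟩).2
      nlinarith [h.ε_lt]
    · rw [h.front.z_chord ⟨h2, ht.2⟩, add_sub_cancel_left]
      exact key _

lemma nrm_near (h : P.IsFrontWithCurve ε δ D M α a b θ y z q ρ) {k : ℤ} {t : ℝ}
    (ht : t ∈ Set.Icc (b (k - 1)) (a (k + 1))) (hθ : |θ t - α k| ≤ ε) :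
    |nrm (θ t) (q t) - (P.dot k).2| < D := by
  have h1 := h.nrm_window_lt ht
  have h2 := abs_nrm_sub_nrm_le (θ t) (α k) (q t)
  have h3 : |θ t - α k| * (|(q t).1| + |(q t).2|) ≤ ε * (M + δ) :=
    mul_le_mul hθ (h.bound t) (by positivity) ((abs_nonneg _).trans hθ)
  have h4 := abs_add_le (nrm (θ t) (q t) - nrm (α k) (q t)) (nrm (α k) (q t) - (P.dot k).2)
  rw [sub_add_sub_cancel] at h4
  linarith [h.εδ_lt]

lemma strictMonoOn_of_turn (h : P.IsFrontWithCurve ε δ D M α a b θ y z q ρ) {τ s t : ℝ}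
    (hd : ∀ u ∈ Set.Ioo s t, 0 < τ * deriv θ u) : StrictMonoOn (fun u => τ * θ u) (Set.Icc s t) := by
  refine strictMonoOn_of_deriv_pos (convex_Icc _ _)
    ((h.front.smooth_θ.continuous.const_smul τ).continuousOn) fun u hu => ?_
  rw [interior_Icc] at hu
  rw [((h.front.hasDerivAt_θ u).const_mul τ).deriv]
  exact hd u hu

lemma chord_injOn (h : P.IsFrontWithCurve ε δ D M α a b θ y z q ρ) (i : ℤ) :
    Set.InjOn θ (Set.Icc (b i) (a (i + 1))) := fun s hs t ht e =>
  (h.strictMonoOn_of_turn fun u hu => h.front.chord_deriv i u ⟨hu.1.le, hu.2.le⟩).injOn hs ht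
    (by simp only [e])

/-- The angle approaches that of the dot monotonically along the incoming chord and leaves it
monotonically along the outgoing one. Hence no time between two near times is far. -/
lemma abs_le_of_mem (h : P.IsFrontWithCurve ε δ D M α a b θ y z q ρ) {k : ℤ} {s t u : ℝ}
    (hs : s ∈ Set.Icc (b (k - 1)) (a (k + 1))) (ht : t ∈ Set.Icc (b (k - 1)) (a (k + 1)))
    (hsθ : |θ s - α k| ≤ ε) (htθ : |θ t - α k| ≤ ε) (hu : u ∈ Set.Icc s t) :
    |θ u - α k| ≤ ε := by
  have hpi := Real.pi_pos
  rcases le_total u (a k) with h1 | h1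
  · have hw : ∀ v ∈ Set.Icc (b (k - 1)) (a k), ∃ x ∈ Set.Icc 0 (Real.pi / 2),
        P.turn (k - 1) * θ v = P.turn (k - 1) * α k - x := by
      intro v hv
      obtain ⟨x, hx, e⟩ := h.chord_angle (i := k - 1) (by rw [sub_add_cancel]; exact hv)
      have h2 := h.front.angleLift.step (k - 1)
      rw [sub_add_cancel] at h2
      refine ⟨Real.pi / 2 - x, ⟨by linarith [hx.2], by linarith [hx.1]⟩, ?_⟩
      rw [e, h2]
      linear_combination (x - Real.pi / 2) * P.turn_mul_self (k - 1)
    obtain ⟨x, hx, ex⟩ := hw u ⟨hs.1.trans hu.1, h1⟩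
    obtain ⟨x', hx', ex'⟩ := hw s ⟨hs.1, hu.1.trans h1⟩
    have hm := (h.strictMonoOn_of_turn (τ := P.turn (k - 1)) (s := b (k - 1)) (t := a k)
      fun v hv => h.front.chord_deriv (k - 1) v ⟨hv.1.le, by
        rw [sub_add_cancel]; exact hv.2.le⟩).monotoneOn
      ⟨hs.1, hu.1.trans h1⟩ ⟨hs.1.trans hu.1, h1⟩ hu.1
    simp only [ex, ex'] at hm
    rcases P.turn_eq_or (k - 1) with e | e <;> rw [e] at ex ex' <;> rw [abs_le] at hsθ ⊢ <;>
      constructor <;> linarith [hx.1, hx'.1]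
  · rcases le_total u (b k) with h2 | h2
    · exact (h.front.near k u ⟨h1, h2⟩).1.le
    · obtain ⟨x, hx, ex⟩ := h.chord_angle ⟨h2, hu.2.trans ht.2⟩
      obtain ⟨x', hx', ex'⟩ := h.chord_angle ⟨h2.trans hu.2, ht.2⟩
      have hm := (h.strictMonoOn_of_turn (τ := P.turn k) (s := b k) (t := a (k + 1))
        fun v hv => h.front.chord_deriv k v ⟨hv.1.le, hv.2.le⟩).monotoneOn
        ⟨h2, hu.2.trans ht.2⟩ ⟨h2.trans hu.2, ht.2⟩ hu.2
      simp only [ex, ex'] at hm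
      rcases P.turn_eq_or k with e | e <;> rw [e] at ex ex' hm <;> rw [abs_le] at htθ ⊢ <;>
        constructor <;> linarith [hx.1, hx'.1]

/-- Between the two times the direction of the curve stays within `2 ε` of its direction at `s`, so
the coordinate along the latter increases. -/
lemma tng_lt (h : P.IsFrontWithCurve ε δ D M α a b θ y z q ρ) {k : ℤ} {s t : ℝ}
    (hs : s ∈ Set.Icc (b (k - 1)) (a (k + 1))) (ht : t ∈ Set.Icc (b (k - 1)) (a (k + 1)))
    (hsθ : |θ s - α k| ≤ ε) (htθ : |θ t - α k| ≤ ε) (hst : s < t) :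
    tng (θ s) (q s) < tng (θ s) (q t) := by
  have hd : ∀ u, HasDerivAt (fun u => tng (θ s) (q u)) (ρ u * Real.cos (θ u - θ s)) u := by
    intro u
    have := hasDerivAt_tng (hasDerivAt_const u (θ s)) (h.hasDerivAt u)
    simpa [tng_smul, tng_tvec] using this
  refine strictMonoOn_of_deriv_pos (convex_Icc s t)
    (fun u _ => (hd u).continuousAt.continuousWithinAt) (fun u hu => ?_)
    ⟨le_rfl, hst.le⟩ ⟨hst.le, le_rfl⟩ hst
  rw [interior_Icc] at hu
  rw [(hd u).deriv]
  have h1 := h.abs_le_of_mem hs ht hsθ htθ ⟨hu.1.le, hu.2.le⟩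
  have hpi := Real.pi_gt_three
  have hε := h.ε_le
  rw [abs_le] at h1 hsθ
  exact mul_pos (h.speed_pos u) (Real.cos_pos_of_mem_Ioo ⟨by linarith, by linarith⟩)

/-- Near a dot, the angle and the slope determine the time. -/
lemma eq_of_near (h : P.IsFrontWithCurve ε δ D M α a b θ y z q ρ) {p : ℝ}
    (hp : p ∈ Set.Icc (0 : ℝ) 1) {k : ℤ} {s t : ℝ}
    (hs : s ∈ Set.Icc (b (k - 1)) (a (k + 1))) (ht : t ∈ Set.Icc (b (k - 1)) (a (k + 1)))
    (hsθ : |θ s - α k| ≤ ε) (htθ : |θ t - α k| ≤ ε) (hθ : θ s = θ t)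
    (hy : (1 - p) * y s + p * -tng (θ s) (q s) = (1 - p) * y t + p * -tng (θ t) (q t)) :
    s = t := by
  wlog hst : s < t generalizing s t with H
  · rcases (not_lt.1 hst).eq_or_lt with e | e
    · exact e.symm
    · exact (H ht hs htθ hsθ hθ.symm hy.symm e).symm
  -- Without reversal `θ` is strictly monotone on the whole window. With a reversal it is so on each
  -- side of `c`, and only times on opposite sides of the cusp remain; there both slopes strictly
  -- decrease, hence so does their convex combination.
  by_cases hk : P.turn (k - 1) = P.turn k
  · have hm := h.strictMonoOn_of_turn (τ := P.turn k) (s := b (k - 1)) (t := a (k + 1))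
      fun u hu => by
        rcases le_total u (a k) with h1 | h1
        · rw [← hk]
          exact h.front.chord_deriv (k - 1) u ⟨hu.1.le, by rw [sub_add_cancel]; exact h1⟩
        · rcases le_total u (b k) with h2 | h2
          · exact h.front.rounded k hk u ⟨h1, h2⟩
          · exact h.front.chord_deriv k u ⟨h2, hu.2.le⟩
    exact hm.injOn hs ht (by simp only [hθ])
  · obtain ⟨c, hc, hl, hr, -, hyc, hanti⟩ := h.front.exists_cusp hk
    rcases le_total t c with h1 | h1
    · exact (h.strictMonoOn_of_turn (τ := P.turn (k - 1)) (s := s) (t := t) fun u hu =>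
        hl u ⟨hs.1.trans hu.1.le, hu.2.trans_le h1⟩).injOn ⟨le_rfl, hst.le⟩ ⟨hst.le, le_rfl⟩
        (by simp only [hθ])
    rcases le_total c s with h2 | h2
    · exact (h.strictMonoOn_of_turn (τ := P.turn k) (s := s) (t := t) fun u hu =>
        hr u ⟨h2.trans_lt hu.1, hu.2.le.trans ht.2⟩).injOn ⟨le_rfl, hst.le⟩ ⟨hst.le, le_rfl⟩
        (by simp only [hθ])
    rcases h2.eq_or_lt with rfl | h2
    · exact (h.strictMonoOn_of_turn (τ := P.turn k) (s := s) (t := t) fun u hu =>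
        hr u ⟨hu.1, hu.2.le.trans ht.2⟩).injOn ⟨le_rfl, hst.le⟩ ⟨hst.le, le_rfl⟩
        (by simp only [hθ])
    rcases h1.eq_or_lt with rfl | h1
    · exact (h.strictMonoOn_of_turn (τ := P.turn (k - 1)) (s := s) (t := c) fun u hu =>
        hl u ⟨hs.1.trans hu.1.le, hu.2⟩).injOn ⟨le_rfl, hst.le⟩ ⟨hst.le, le_rfl⟩
        (by simp only [hθ])
    exfalso
    -- Equality would make the antitone function `y` constant around the cusp, contradicting `hyc`.
    have hyle : y t < y s := by
      refine lt_of_le_of_ne (hanti hs ht hst.le) fun e => hyc.ne ?_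
      have hconst : ∀ u ∈ Set.Ioo s t, y u = y s := fun u hu =>
        le_antisymm (hanti hs ⟨hs.1.trans hu.1.le, hu.2.le.trans ht.2⟩ hu.1.le)
          (e ▸ hanti ⟨hs.1.trans hu.1.le, hu.2.le.trans ht.2⟩ ht hu.2.le)
      have heq : y =ᶠ[nhds c] fun _ => y s :=
        Filter.eventually_of_mem (Ioo_mem_nhds h2 h1) hconst
      rw [heq.deriv_eq, deriv_const]
    have htng := h.tng_lt hs ht hsθ htθ hst
    rw [← hθ] at hy
    have := convex_pos (sub_pos.2 hyle) (sub_pos.2 htng) hp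
    linarith

/-- The interpolated coordinates along a segment. -/
lemma chord_form (h : P.IsFrontWithCurve ε δ D M α a b θ y z q ρ) {p : ℝ}
    (hp : p ∈ Set.Icc (0 : ℝ) 1) {i : ℤ} {t x : ℝ} (ht : t ∈ Set.Icc (b i) (a (i + 1)))
    (hx : θ t = α i + P.turn i * x) :
    |(1 - p) * z t + p * nrm (θ t) (q t)
      - ((P.dot i).2 * ((1 - p) * (1 - x * (2 / Real.pi)) + p * Real.cos x)
      + (P.dot (i + 1)).2 * ((1 - p) * (x * (2 / Real.pi)) + p * Real.sin x))| ≤ 2 * δ ∧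
    |P.turn i * ((1 - p) * y t + p * -tng (θ t) (q t))
      - ((P.dot (i + 1)).2 * ((1 - p) * (2 / Real.pi) + p * Real.cos x)
      - (P.dot i).2 * ((1 - p) * (2 / Real.pi) + p * Real.sin x))| ≤ 2 * δ := by
  obtain ⟨h1, h2⟩ := h.nrm_vertex_lt ht
  have hτ := P.turn_mul_self i
  have hcos : Real.cos (P.turn i * x) = Real.cos x := by
    rcases P.turn_eq_or i with e | e <;> rw [e] <;> simp
  have hsin : Real.sin (P.turn i * x) = P.turn i * Real.sin x := by
    rcases P.turn_eq_or i with e | e <;> rw [e] <;> simp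
  have hn := h.front.angleLift.nrm_succ i (q t)
  have htn : tng (α i) (q t) = -P.turn i * nrm (α (i + 1)) (q t) := by
    rw [hn]; linear_combination (-tng (α i) (q t)) * hτ
  -- Near the vertex the coordinates of `q` at the two dots are within `δ` of their heights. So the
  -- conormal follows the sinusoid through both dots, in the same form as the chord with `cos x, sin
  -- x` in place of `1 - u, u`.
  have e1 : nrm (θ t) (q t) = Real.cos x * nrm (α i) (q t) + Real.sin x * nrm (α (i + 1)) (q t) := by
    rw [hx, nrm_angle_add, hcos, hsin, hn]; ring
  have e2 : -tng (θ t) (q t) = P.turn i * (Real.cos x * nrm (α (i + 1)) (q t)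
      - Real.sin x * nrm (α i) (q t)) := by
    rw [hx, tng_angle_add, hcos, hsin, htn]; ring
  have e3 : z t = (P.dot i).2 + (x * (2 / Real.pi)) * ((P.dot (i + 1)).2 - (P.dot i).2) := by
    rw [h.front.z_chord ht, hx, slope]
    linear_combination (x * (2 / Real.pi) * ((P.dot (i + 1)).2 - (P.dot i).2)) * hτ
  have e4 : y t = P.turn i * ((2 / Real.pi) * ((P.dot (i + 1)).2 - (P.dot i).2)) := by
    rw [h.front.y_chord ht, slope]; ring
  have hc := Real.abs_cos_le_one x
  have hs := Real.abs_sin_le_one x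
  have two : ∀ v w c d : ℝ, |v| ≤ 1 → |w| ≤ 1 → |c| < δ → |d| < δ →
      |p * (v * c + w * d)| ≤ 2 * δ := by
    intro v w c d hv hw hc hd
    have h3 : |v * c + w * d| ≤ 2 * δ := by
      refine (abs_add_le _ _).trans ?_
      rw [abs_mul, abs_mul]
      nlinarith [abs_nonneg v, abs_nonneg w, abs_nonneg c, abs_nonneg d]
    rw [abs_mul, abs_of_nonneg hp.1]
    nlinarith [abs_nonneg (v * c + w * d), hp.2]
  constructor
  · convert two (Real.cos x) (Real.sin x) _ _ hc hs h1 h2 using 2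
    rw [e1, e3]; ring
  · convert two (-Real.sin x) (Real.cos x) _ _ (by rwa [abs_neg]) hc h1 h2 using 2
    rw [e2, e4]
    linear_combination ((1 - p) * (2 / Real.pi) * ((P.dot (i + 1)).2 - (P.dot i).2)
      + p * (Real.cos x * nrm (α (i + 1)) (q t) - Real.sin x * nrm (α i) (q t))) * hτ

lemma ε_pos (h : P.IsFrontWithCurve ε δ D M α a b θ y z q ρ) : 0 < ε :=
  (abs_nonneg _).trans_lt (h.front.near 0 (a 0) ⟨le_rfl, (h.front.subdivision.lt 0).le⟩).1

lemma coe_θ_sub_int (h : P.IsFrontWithCurve ε δ D M α a b θ y z q ρ) (t : ℝ) (m : ℤ) :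
    ((θ (t - m) : ℝ) : Real.Angle) = θ t := by
  have hp : Function.Periodic (fun t => ((θ t : ℝ) : Real.Angle)) 1 := h.front.periodic_θ
  simpa using hp.sub_zsmul_eq m (x := t)

lemma dir_eq_of_coe (h : P.IsFrontWithCurve ε δ D M α a b θ y z q ρ) {i j : ℤ} {s t u v : ℝ}
    (hst : (θ s : Real.Angle) = θ t) (hi : α i = θ s + u) (hj : α j = θ t + v) (huv : u = v) :
    P.dir i = P.dir j :=
  h.front.angleLift.dir_eq (by rw [hi, hj, huv, Real.Angle.coe_add, Real.Angle.coe_add, hst])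

/-- Equal angles near two dots force equal headings, and equal heights then force the same edge
modulo `n`. After a shift by whole periods both times lie in one window, where `eq_of_near` applies.
-/
lemma exists_shift_of_near (h : P.IsFrontWithCurve ε δ D M α a b θ y z q ρ) {p : ℝ}
    (hp : p ∈ Set.Icc (0 : ℝ) 1) {k l : ℤ} {s t : ℝ}
    (hs : s ∈ Set.Icc (b (k - 1)) (a (k + 1))) (ht : t ∈ Set.Icc (b (l - 1)) (a (l + 1)))
    (hsθ : |θ s - α k| ≤ ε) (htθ : |θ t - α l| ≤ ε) (hθ : (θ s : Real.Angle) = θ t)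
    (hy : (1 - p) * y s + p * -tng (θ s) (q s) = (1 - p) * y t + p * -tng (θ t) (q t))
    (hz : (1 - p) * z s + p * nrm (θ s) (q s) = (1 - p) * z t + p * nrm (θ t) (q t)) :
    ∃ m : ℤ, t = s + m := by
  have hpi := Real.pi_gt_three
  have hε := h.ε_le
  have hα := h.front.angleLift
  have hab := h.front.subdivision
  have hsθ' := abs_le.1 hsθ
  have htθ' := abs_le.1 htθ
  have hdir : P.dir k = P.dir l := by
    obtain ⟨K, hK⟩ := exists_int_of_coe_eq hθ
    refine Heading.eq_of_cos_pos ?_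
    have e : Real.cos ((P.dir k).dotAngle - (P.dir l).dotAngle) = Real.cos (α k - α l) := by
      refine cos_eq_of_coe_eq ?_
      rw [Real.Angle.coe_sub, Real.Angle.coe_sub, hα.coe, hα.coe]
    rw [e, show α k - α l = (θ t - α l) - (θ s - α k) + K * (2 * Real.pi) by linarith,
      Real.cos_add_int_mul_two_pi]
    exact Real.cos_pos_of_mem_Ioo ⟨by linarith, by linarith⟩
  have hzs := abs_convex_sub_lt (h.z_near hs hsθ) (h.nrm_near hs hsθ) hp
  have hzt := abs_convex_sub_lt (h.z_near ht htθ) (h.nrm_near ht htθ) hp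
  rw [← hz] at hzt
  obtain ⟨m, rfl⟩ := h.index_of_height hdir hzs hzt
  have hsm : s - m ∈ Set.Icc (b (l - 1)) (a (l + 1)) := by
    rw [show l + m * (P.n : ℤ) - 1 = l - 1 + m * P.n by ring,
      show l + m * (P.n : ℤ) + 1 = l + 1 + m * P.n by ring, hab.shift_a_mul,
      hab.shift_b_mul] at hs
    exact ⟨by linarith [hs.1], by linarith [hs.2]⟩
  have hcoe := h.coe_θ_sub_int s m
  have hw := abs_le.1 (h.abs_window_le hsm)
  have e1 : θ (s - m) - α l = θ s - α (l + m * P.n) := by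
    refine eq_of_coe_eq_of_abs_lt ?_ ?_
    · rw [Real.Angle.coe_sub, Real.Angle.coe_sub, hcoe, hα.coe, hα.coe, hdir]
    · rw [abs_lt]; constructor <;> linarith
  have hsmθ : |θ (s - m) - α l| ≤ ε := by rw [e1]; exact hsθ
  have hsmθ' := abs_le.1 hsmθ
  have e2 : θ (s - m) = θ t := by
    refine eq_of_coe_eq_of_abs_lt (hcoe.trans hθ) ?_
    rw [abs_lt]; constructor <;> linarith
  have e3 : y (s - m) = y s := by simpa using h.front.periodic_y.sub_zsmul_eq m (x := s)
  have e4 : q (s - m) = q s := by simpa using h.periodic.sub_zsmul_eq m (x := s)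
  have := h.eq_of_near hp hsm ht hsmθ htθ e2 (by rw [e3, e4, tng_congr hcoe, hy])
  exact ⟨-m, by push_cast; linarith⟩

lemma mem_window_of_dot (h : P.IsFrontWithCurve ε δ D M α a b θ y z q ρ) {i : ℤ} {t : ℝ}
    (ht : t ∈ Set.Icc (a i) (b i)) : t ∈ Set.Icc (b (i - 1)) (a (i + 1)) :=
  ⟨(h.front.subdivision.lt_of_lt (by omega)).le.trans ht.1,
    ht.2.trans (h.front.subdivision.lt_next i).le⟩

lemma mem_window_of_chord (h : P.IsFrontWithCurve ε δ D M α a b θ y z q ρ) {i : ℤ} {t : ℝ}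
    (ht : t ∈ Set.Icc (b i) (a (i + 1))) : t ∈ Set.Icc (b (i - 1)) (a (i + 1)) :=
  ⟨(h.front.subdivision.strictMono_b.monotone (by omega)).trans ht.1, ht.2⟩

lemma mem_window_succ_of_chord (h : P.IsFrontWithCurve ε δ D M α a b θ y z q ρ) {i : ℤ} {t : ℝ}
    (ht : t ∈ Set.Icc (b i) (a (i + 1))) : t ∈ Set.Icc (b (i + 1 - 1)) (a (i + 1 + 1)) :=
  ⟨by rw [add_sub_cancel_right]; exact ht.1,
    ht.2.trans (h.front.subdivision.strictMono_a.monotone (by omega))⟩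

/-- Dots sit at multiples of `π / 2`, so a chord sweeps exactly the range between two neighbouring
multiples. An angle within `ε` of some multiple is therefore within `ε` of an end of that range. -/
lemma near_of_chord (h : P.IsFrontWithCurve ε δ D M α a b θ y z q ρ) {i j : ℤ} {s t : ℝ}
    (ht : t ∈ Set.Icc (b j) (a (j + 1))) (hs : |θ s - α i| ≤ ε)
    (hθ : (θ s : Real.Angle) = θ t) : |θ t - α j| ≤ ε ∨ |θ t - α (j + 1)| ≤ ε := by
  have hpi := Real.pi_gt_three
  have hε := h.ε_le
  have hα := h.front.angleLift
  obtain ⟨x, hx, e⟩ := h.chord_angle ht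
  obtain ⟨K, hK⟩ := exists_int_of_coe_eq hθ
  obtain ⟨mi, hmi⟩ := hα.exists_int i
  obtain ⟨mj, hmj⟩ := hα.exists_int j
  rw [hα.step, e]
  have hs' := abs_le.1 hs
  have key : P.turn j * x = (θ s - α i) + ((mi - mj - 4 * K : ℤ) : ℝ) * (Real.pi / 2) := by
    push_cast; linarith
  generalize mi - mj - 4 * K = N at key
  have hx0 := hx.1
  have hx1 := hx.2
  rcases P.turn_eq_or j with eτ | eτ <;> rw [eτ] at key ⊢
  · have h1 : (-1 : ℝ) < N := by nlinarith
    have h2 : (N : ℝ) < 2 := by nlinarith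
    have h1' : -1 < N := by exact_mod_cast h1
    have h2' : N < 2 := by exact_mod_cast h2
    have hN : N = 0 ∨ N = 1 := by omega
    rcases hN with rfl | rfl
    · left
      push_cast at key
      rw [abs_le]; constructor <;> linarith
    · right
      push_cast at key
      rw [abs_le]; constructor <;> linarith
  · have h1 : (-2 : ℝ) < N := by nlinarith
    have h2 : (N : ℝ) < 1 := by nlinarith
    have h1' : -2 < N := by exact_mod_cast h1
    have h2' : N < 1 := by exact_mod_cast h2
    have hN : N = 0 ∨ N = -1 := by omega
    rcases hN with rfl | rfl
    · left
      push_cast at key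
      rw [abs_le]; constructor <;> linarith
    · right
      push_cast at key
      rw [abs_le]; constructor <;> linarith

/-- Two segments over the same range of angles, run in the same direction. -/
lemma exists_shift_of_chord_same (h : P.IsFrontWithCurve ε δ D M α a b θ y z q ρ) {p : ℝ}
    (hp : p ∈ Set.Icc (0 : ℝ) 1) {i j : ℤ} {s t x : ℝ} (hx : x ∈ Set.Icc 0 (Real.pi / 2))
    (hs : s ∈ Set.Icc (b i) (a (i + 1))) (ht : t ∈ Set.Icc (b j) (a (j + 1)))
    (hτ : P.turn i = P.turn j) (es : θ s = α i + P.turn i * x) (et : θ t = α j + P.turn j * x)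
    (hθ : (θ s : Real.Angle) = θ t)
    (hy : (1 - p) * y s + p * -tng (θ s) (q s) = (1 - p) * y t + p * -tng (θ t) (q t))
    (hz : (1 - p) * z s + p * nrm (θ s) (q s) = (1 - p) * z t + p * nrm (θ t) (q t)) :
    ∃ m : ℤ, t = s + m := by
  have hpi := Real.pi_gt_three
  have hab := h.front.subdivision
  have hdir : P.dir i = P.dir j :=
    h.dir_eq_of_coe hθ (u := -(P.turn i * x)) (v := -(P.turn j * x)) (by linarith) (by linarith)
      (by rw [hτ])
  obtain ⟨c1, c2⟩ := h.chord_form hp hs es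
  obtain ⟨c3, c4⟩ := h.chord_form hp ht et
  rw [← hy, ← hτ] at c4
  rw [← hz] at c3
  -- Each chord form is accurate to `2 δ`, so the difference of the two is at most `4 δ` and the
  -- heights differ by at most `32 δ < D`. This is where `δ_lt` comes from.
  have hcoef := (coeff_le_of_jet_le (A := (P.dot i).2 - (P.dot j).2)
    (B := (P.dot (i + 1)).2 - (P.dot (j + 1)).2) (η := 4 * δ) hx hp
    (by rw [abs_le] at c1 c3 ⊢; constructor <;> linarith)
    (by rw [abs_le] at c2 c4 ⊢; constructor <;> linarith)).1
  have hδ := h.δ_lt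
  obtain ⟨m, rfl⟩ := h.index_of_height hdir (x := (P.dot i).2) (by simpa using h.D_pos)
    (by linarith)
  have hsm : s - m ∈ Set.Icc (b j) (a (j + 1)) := by
    rw [show j + m * (P.n : ℤ) + 1 = j + 1 + m * P.n by ring, hab.shift_a_mul,
      hab.shift_b_mul] at hs
    exact ⟨by linarith [hs.1], by linarith [hs.2]⟩
  have hcoe := h.coe_θ_sub_int s m
  have w1 := abs_le.1 (h.abs_window_le (h.mem_window_of_chord hsm))
  have w2 := abs_le.1 (h.abs_window_le (h.mem_window_of_chord ht))
  have e2 : θ (s - m) = θ t := by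
    refine eq_of_coe_eq_of_abs_lt (hcoe.trans hθ) ?_
    rw [abs_lt]; constructor <;> linarith
  have := h.chord_injOn j hsm ht e2
  exact ⟨-m, by push_cast; linarith⟩

/-- Two segments over the same range of angles, run in opposite directions. -/
lemma false_of_chord_opposite (h : P.IsFrontWithCurve ε δ D M α a b θ y z q ρ) {p : ℝ}
    (hp : p ∈ Set.Icc (0 : ℝ) 1) {i j : ℤ} {s t x : ℝ} (hx : x ∈ Set.Icc 0 (Real.pi / 2))
    (hs : s ∈ Set.Icc (b i) (a (i + 1))) (ht : t ∈ Set.Icc (b j) (a (j + 1)))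
    (hτ : P.turn j = -P.turn i) (es : θ s = α i + P.turn i * x)
    (et : θ t = α j + P.turn j * (Real.pi / 2 - x)) (hθ : (θ s : Real.Angle) = θ t)
    (hy : (1 - p) * y s + p * -tng (θ s) (q s) = (1 - p) * y t + p * -tng (θ t) (q t))
    (hz : (1 - p) * z s + p * nrm (θ s) (q s) = (1 - p) * z t + p * nrm (θ t) (q t)) :
    False := by
  have hα := h.front.angleLift
  have hd1 : P.dir i = P.dir (j + 1) :=
    h.dir_eq_of_coe hθ (u := -(P.turn i * x)) (v := -(P.turn i * x)) (by linarith)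
      (by rw [hα.step, et, hτ]; ring) rfl
  have hd2 : P.dir (i + 1) = P.dir j :=
    h.dir_eq_of_coe hθ (u := P.turn i * (Real.pi / 2 - x)) (v := P.turn i * (Real.pi / 2 - x))
      (by rw [hα.step, es]; ring) (by rw [et, hτ]; ring) rfl
  obtain ⟨c1, c2⟩ := h.chord_form hp hs es
  obtain ⟨c3, c4⟩ := h.chord_form hp ht et
  rw [← hy, hτ] at c4
  rw [← hz] at c3
  -- Running the chord backwards exchanges the two interpolating functions, so dot `i` is matched
  -- with dot `j + 1` and dot `i + 1` with dot `j`.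
  rw [Real.cos_pi_div_two_sub, Real.sin_pi_div_two_sub] at c3 c4
  have hu : (Real.pi / 2 - x) * (2 / Real.pi) = 1 - x * (2 / Real.pi) := by
    have := Real.pi_ne_zero
    field_simp
  rw [hu] at c3
  obtain ⟨hA, hB⟩ := coeff_le_of_jet_le (A := (P.dot i).2 - (P.dot (j + 1)).2)
    (B := (P.dot (i + 1)).2 - (P.dot j).2) (η := 4 * δ) hx hp
    (by rw [abs_le] at c1 c3 ⊢; constructor <;> linarith)
    (by rw [abs_le] at c2 c4 ⊢; constructor <;> linarith)
  have hδ := h.δ_lt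
  obtain ⟨m, hm⟩ := h.index_of_height hd1 (x := (P.dot i).2) (by simpa using h.D_pos) (by linarith)
  obtain ⟨l, hl⟩ := h.index_of_height hd2 (x := (P.dot (i + 1)).2) (by simpa using h.D_pos)
    (by linarith)
  exact P.not_n_dvd_two ⟨l - m, by linarith⟩

/-- Two chords with a common angle either sweep the same quarter turn, in the same or in opposite
directions, or meet only at end angles. In the latter case both points are near dots. -/
lemma exists_shift_of_chords (h : P.IsFrontWithCurve ε δ D M α a b θ y z q ρ) {p : ℝ}
    (hp : p ∈ Set.Icc (0 : ℝ) 1) {i j : ℤ} {s t : ℝ}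
    (hs : s ∈ Set.Icc (b i) (a (i + 1))) (ht : t ∈ Set.Icc (b j) (a (j + 1)))
    (hθ : (θ s : Real.Angle) = θ t)
    (hy : (1 - p) * y s + p * -tng (θ s) (q s) = (1 - p) * y t + p * -tng (θ t) (q t))
    (hz : (1 - p) * z s + p * nrm (θ s) (q s) = (1 - p) * z t + p * nrm (θ t) (q t)) :
    ∃ m : ℤ, t = s + m := by
  have hpi := Real.pi_gt_three
  have hα := h.front.angleLift
  have hε := h.ε_pos
  obtain ⟨x, hx, es⟩ := h.chord_angle hs
  obtain ⟨x', hx', et⟩ := h.chord_angle ht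
  obtain ⟨K, hK⟩ := exists_int_of_coe_eq hθ
  obtain ⟨mi, hmi⟩ := hα.exists_int i
  obtain ⟨mj, hmj⟩ := hα.exists_int j
  have hx0 := hx.1
  have hx1 := hx.2
  have hx0' := hx'.1
  have hx1' := hx'.2
  have key : P.turn i * x - P.turn j * x' = ((mj - mi + 4 * K : ℤ) : ℝ) * (Real.pi / 2) := by
    push_cast; linarith
  generalize mj - mi + 4 * K = N at key
  have near0 : ∀ {i : ℤ} {s x : ℝ}, θ s = α i + P.turn i * x → x = 0 → |θ s - α i| ≤ ε := by
    intro i s x e hx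
    rw [e, hx]; simpa using hε.le
  have near1 : ∀ {i : ℤ} {s x : ℝ}, θ s = α i + P.turn i * x → x = Real.pi / 2 →
      |θ s - α (i + 1)| ≤ ε := by
    intro i s x e hx
    rw [hα.step, e, hx]; simpa using hε.le
  by_cases hτ : P.turn i = P.turn j
  · obtain ⟨N', hN'⟩ : ∃ N' : ℤ, x - x' = N' * (Real.pi / 2) := by
      rw [← hτ] at key
      rcases P.turn_eq_or i with e | e <;> rw [e] at key
      · exact ⟨N, by linarith⟩
      · exact ⟨-N, by push_cast; linarith⟩
    have h1 : (-2 : ℝ) < N' := by nlinarith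
    have h2 : (N' : ℝ) < 2 := by nlinarith
    have h1' : -2 < N' := by exact_mod_cast h1
    have h2' : N' < 2 := by exact_mod_cast h2
    have hcases : N' = -1 ∨ N' = 0 ∨ N' = 1 := by omega
    rcases hcases with rfl | rfl | rfl <;> push_cast at hN'
    · exact h.exists_shift_of_near hp (h.mem_window_of_chord hs) (h.mem_window_succ_of_chord ht)
        (near0 es (by linarith)) (near1 et (by linarith)) hθ hy hz
    · obtain rfl : x = x' := by linarith
      exact h.exists_shift_of_chord_same hp hx hs ht hτ es et hθ hy hz
    · exact h.exists_shift_of_near hp (h.mem_window_succ_of_chord hs) (h.mem_window_of_chord ht)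
        (near1 es (by linarith)) (near0 et (by linarith)) hθ hy hz
  · have hτ' : P.turn j = -P.turn i := P.turn_eq_neg_of_ne (Ne.symm hτ)
    obtain ⟨N', hN'⟩ : ∃ N' : ℤ, x + x' = N' * (Real.pi / 2) := by
      rw [hτ'] at key
      rcases P.turn_eq_or i with e | e <;> rw [e] at key
      · exact ⟨N, by linarith⟩
      · exact ⟨-N, by push_cast; linarith⟩
    have h1 : (-1 : ℝ) < N' := by nlinarith
    have h2 : (N' : ℝ) < 3 := by nlinarith
    have h1' : -1 < N' := by exact_mod_cast h1
    have h2' : N' < 3 := by exact_mod_cast h2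
    have hcases : N' = 0 ∨ N' = 1 ∨ N' = 2 := by omega
    rcases hcases with rfl | rfl | rfl <;> push_cast at hN'
    · exact h.exists_shift_of_near hp (h.mem_window_of_chord hs) (h.mem_window_of_chord ht)
        (near0 es (by linarith)) (near0 et (by linarith)) hθ hy hz
    · obtain rfl : x' = Real.pi / 2 - x := by linarith
      exact (h.false_of_chord_opposite hp hx hs ht hτ' es et hθ hy hz).elim
    · exact h.exists_shift_of_near hp (h.mem_window_succ_of_chord hs)
        (h.mem_window_succ_of_chord ht) (near1 es (by linarith)) (near1 et (by linarith)) hθ hy hz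

lemma embedded (h : P.IsFrontWithCurve ε δ D M α a b θ y z q ρ) {p : ℝ}
    (hp : p ∈ Set.Icc (0 : ℝ) 1) {s t : ℝ} (hθ : (θ s : Real.Angle) = θ t)
    (hy : (1 - p) * y s + p * -tng (θ s) (q s) = (1 - p) * y t + p * -tng (θ t) (q t))
    (hz : (1 - p) * z s + p * nrm (θ s) (q s) = (1 - p) * z t + p * nrm (θ t) (q t)) :
    ∃ m : ℤ, t = s + m := by
  obtain ⟨i, hs | hs⟩ := h.front.subdivision.exists_mem_Icc s <;>
    obtain ⟨j, ht | ht⟩ := h.front.subdivision.exists_mem_Icc t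
  · exact h.exists_shift_of_near hp (h.mem_window_of_dot hs) (h.mem_window_of_dot ht)
      (h.front.near i s hs).1.le (h.front.near j t ht).1.le hθ hy hz
  · have hn := (h.front.near i s hs).1.le
    rcases h.near_of_chord ht hn hθ with h1 | h1
    · exact h.exists_shift_of_near hp (h.mem_window_of_dot hs) (h.mem_window_of_chord ht) hn h1
        hθ hy hz
    · exact h.exists_shift_of_near hp (h.mem_window_of_dot hs) (h.mem_window_succ_of_chord ht)
        hn h1 hθ hy hz
  · have hn := (h.front.near j t ht).1.le
    rcases h.near_of_chord hs hn hθ.symm with h1 | h1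
    · exact h.exists_shift_of_near hp (h.mem_window_of_chord hs) (h.mem_window_of_dot ht) h1 hn
        hθ hy hz
    · exact h.exists_shift_of_near hp (h.mem_window_succ_of_chord hs) (h.mem_window_of_dot ht)
        h1 hn hθ hy hz
  · exact h.exists_shift_of_chords hp hs ht hθ hy hz

/-- The angle can only be stationary at a cusp point, and there the slope decreases strictly. -/
lemma deriv_y_neg (h : P.IsFrontWithCurve ε δ D M α a b θ y z q ρ) {t : ℝ} (ht : deriv θ t = 0) :
    deriv y t < 0 := by
  have contra : ∀ i, ¬ 0 < P.turn i * deriv θ t := fun i hi => by rw [ht] at hi; simp at hi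
  obtain ⟨i, hi | hi⟩ := h.front.subdivision.exists_mem_Icc t
  · by_cases hk : P.turn (i - 1) = P.turn i
    · exact absurd (h.front.rounded i hk t hi) (contra i)
    · obtain ⟨c, hc, hl, hr, -, hyc, -⟩ := h.front.exists_cusp hk
      have hw := h.mem_window_of_dot hi
      rcases lt_trichotomy t c with h1 | rfl | h1
      · exact absurd (hl t ⟨hw.1, h1⟩) (contra _)
      · exact hyc
      · exact absurd (hr t ⟨h1, hw.2⟩) (contra _)
  · exact absurd (h.front.chord_deriv i t hi) (contra i)

/-- Interpolating linearly, over a fixed angle function, between a smoothing of the polygonal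
path and the conormal of a curve near the polygon gives Legendrian knots. -/
lemma isLegendrianKnot (h : P.IsFrontWithCurve ε δ D M α a b θ y z q ρ) {p : ℝ}
    (hp : p ∈ Set.Icc (0 : ℝ) 1) : IsLegendrianKnot (fun t => ((θ t : Real.Angle),
      (1 - p) * y t + p * -tng (θ t) (q t), (1 - p) * z t + p * nrm (θ t) (q t))) := by
  have dY : ∀ t, HasDerivAt (fun t => (1 - p) * y t + p * -tng (θ t) (q t))
      ((1 - p) * deriv y t + p * -(ρ t + nrm (θ t) (q t) * deriv θ t)) t := fun t => by
    have := hasDerivAt_tng (h.front.hasDerivAt_θ t) (h.hasDerivAt t)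
    rw [tng_smul, tng_tvec, sub_self, Real.cos_zero, mul_one] at this
    exact ((h.front.hasDerivAt_y t).const_mul (1 - p)).fun_add (this.fun_neg.const_mul p)
  have dZ : ∀ t, HasDerivAt (fun t => (1 - p) * z t + p * nrm (θ t) (q t))
      ((1 - p) * deriv z t + p * (-(tng (θ t) (q t) * deriv θ t))) t := fun t => by
    have := hasDerivAt_nrm (h.front.hasDerivAt_θ t) (h.hasDerivAt t)
    rw [nrm_smul, nrm_tvec, sub_self, Real.sin_zero, mul_zero, zero_sub] at this
    exact ((h.front.hasDerivAt_z t).const_mul (1 - p)).fun_add (this.const_mul p)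
  refine ⟨⟨θ, _, _, fun t => rfl, fun t => ?_, h.front.smooth_θ, ?_, ?_, fun t => ?_,
    fun t h0 => ?_⟩, fun s t e => ?_⟩
  · simp only [h.front.periodic_θ t, h.front.periodic_y t, h.front.periodic_z t, h.periodic t,
      tng_congr (h.front.periodic_θ t), nrm_congr (h.front.periodic_θ t)]
  · exact (contDiff_const.mul h.front.smooth_y).add
      (contDiff_const.mul (contDiff_tng h.front.smooth_θ h.smooth).neg)
  · exact (contDiff_const.mul h.front.smooth_z).add
      (contDiff_const.mul (contDiff_nrm h.front.smooth_θ h.smooth))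
  · rw [(dZ t).deriv, h.front.legendrian]; ring
  -- At a stationary angle the slope of the smoothing has negative derivative and that of the
  -- conormal has derivative `-ρ`, so the combination cannot vanish.
  · have h1 : deriv θ t = 0 := congrArg Prod.fst h0
    have h2 : deriv (fun t => (1 - p) * y t + p * -tng (θ t) (q t)) t = 0 :=
      congrArg (fun x => x.2.1) h0
    rw [(dY t).deriv, h1] at h2
    have := convex_pos (neg_pos.2 (h.deriv_y_neg h1)) (h.speed_pos t) hp
    linarith
  · simp only [Prod.mk.injEq] at e
    exact h.embedded hp e.1 e.2.1 e.2.2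

/-- The curve that comes with a smoothing is near the polygon. -/
lemma isNearPolygon (h : P.IsFrontWithCurve ε δ D M α a b θ y z q ρ) :
    P.IsNearPolygon α δ a b q where
  smooth := h.smooth
  periodic := h.periodic
  edge i t ht := by
    refine ⟨h.edge i t ht, ?_⟩
    rw [(h.hasDerivAt t).deriv, nrm_smul, tng_smul, nrm_tvec, tng_tvec, abs_mul,
      abs_of_pos (h.speed_pos t)]
    refine mul_lt_mul_of_pos_left ?_ (h.speed_pos t)
    have h1 := (h.front.near i t ht).1
    have h2 := Real.one_sub_sq_div_two_le_cos (x := θ t - α i)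
    have h3 := Real.abs_sin_le_abs (x := θ t - α i)
    have h4 := h.ε_le
    have h5 := sq_abs (θ t - α i)
    nlinarith [abs_nonneg (θ t - α i)]
  vertex i t ht := by
    obtain ⟨h1, h2⟩ := h.nrm_vertex_lt ht
    refine ⟨h1, h2, ?_⟩
    obtain ⟨x, hx, e⟩ := h.chord_angle ht
    have hpi := Real.pi_pos
    have e1 : Real.cos (θ t - α i) = Real.cos x := by
      rw [e, add_sub_cancel_left]
      rcases P.turn_eq_or i with e | e <;> rw [e] <;> simp
    have e2 : Real.cos (θ t - α (i + 1)) = Real.sin x := by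
      rw [e, h.front.angleLift.step, add_sub_add_left_eq_sub, ← mul_sub,
        ← Real.cos_pi_div_two_sub]
      rcases P.turn_eq_or i with e | e <;> rw [e]
      · rw [one_mul, ← Real.cos_neg, neg_sub]
      · rw [neg_one_mul, neg_sub]
    rw [(h.hasDerivAt t).deriv, tng_smul, tng_smul, tng_tvec, tng_tvec, e1, e2, ← mul_add]
    refine mul_pos (h.speed_pos t) ?_
    have hc0 : 0 ≤ Real.cos x := Real.cos_nonneg_of_mem_Icc ⟨by linarith [hx.1], hx.2⟩
    have hs0 : 0 ≤ Real.sin x := Real.sin_nonneg_of_nonneg_of_le_pi hx.1 (by linarith [hx.2])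
    have hcs := Real.sin_sq_add_cos_sq x
    by_contra! hle
    have hc : Real.cos x = 0 := by linarith
    have hs : Real.sin x = 0 := by linarith
    rw [hc, hs] at hcs
    norm_num at hcs

end IsFrontWithCurve

end RectilinearPolygon

/-! ### The isotopy -/

/-- The polar form of a vector, with the angle measured from the direction `tvec θ`. -/
lemma polar_form (θ : ℝ) (u : ℝ × ℝ) :
    u = ‖(⟨tng θ u, nrm θ u⟩ : ℂ)‖ • tvec (θ + Complex.arg ⟨tng θ u, nrm θ u⟩) := by
  refine eq_of_nrm_tng (θ := θ) ?_ ?_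
  · rw [nrm_smul, nrm_tvec, add_sub_cancel_left, Complex.norm_mul_sin_arg]
  · rw [tng_smul, tng_tvec, add_sub_cancel_left, Complex.norm_mul_cos_arg]

/-- The conormal sees only the point and the direction, and a positive factor in the velocity does
not change the direction. -/
lemma conormal_comp {q : ℝ → ℝ × ℝ} {φ : ℝ → ℝ} (hq : ContDiff ℝ ∞ q) (hne : ∀ t, deriv q t ≠ 0)
    (hφ : IsReparametrization φ) : conormal (q ∘ φ) = conormal q ∘ φ := by
  funext t
  have hd : deriv (q ∘ φ) t = deriv φ t • deriv q (φ t) :=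
    ((hq.differentiable (by simp) (φ t)).hasDerivAt.scomp t
      (hφ.smooth.differentiable (by simp) t).hasDerivAt).deriv
  have hp := polar_form 0 (deriv q (φ t))
  set r := ‖(⟨tng 0 (deriv q (φ t)), nrm 0 (deriv q (φ t))⟩ : ℂ)‖ with hr
  have hr0 : 0 < r := by
    refine lt_of_le_of_ne (norm_nonneg _) fun h0 => hne (φ t) ?_
    rw [hp, ← h0, zero_smul]
  rw [Function.comp_apply, conormal_eq hr0 hp,
    conormal_eq (mul_pos (hφ.deriv_pos t) hr0) (by rw [hd, mul_smul, ← hp])]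
  rfl

/-- Outside the slit plane the combination would be a nonpositive multiple of `tvec θ`. Its pairing
with `p` would then be nonpositive, although both velocities pair positively with `p`. -/
lemma mem_slitPlane_of_halfplane {θ ρ r : ℝ} {p w₀ w₁ : ℝ × ℝ} (hρ : 0 < ρ)
    (hr : r ∈ Set.Icc (0 : ℝ) 1) (hw₁ : w₁ = ρ • tvec θ) (h₀ : 0 < p.1 * w₀.1 + p.2 * w₀.2)
    (h₁ : 0 < p.1 * w₁.1 + p.2 * w₁.2) :
    (⟨tng θ ((1 - r) • w₁ + r • w₀), nrm θ ((1 - r) • w₁ + r • w₀)⟩ : ℂ) ∈ Complex.slitPlane := by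
  rw [Complex.mem_slitPlane_iff]
  by_contra! hcon
  obtain ⟨hx, hy⟩ := hcon
  simp only at hx hy
  set w := (1 - r) • w₁ + r • w₀ with hw
  have e : w = tng θ w • tvec θ := by
    refine eq_of_nrm_tng (θ := θ) ?_ ?_
    · rw [hy, nrm_smul, nrm_tvec]; simp
    · rw [tng_smul, tng_tvec]; simp
  have h2 := RectilinearPolygon.convex_pos h₁ h₀ hr
  have h3 : p.1 * w.1 + p.2 * w.2
      = (1 - r) * (p.1 * w₁.1 + p.2 * w₁.2) + r * (p.1 * w₀.1 + p.2 * w₀.2) := by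
    simp only [hw, Prod.fst_add, Prod.snd_add, Prod.smul_fst, Prod.smul_snd, smul_eq_mul]
    ring
  have h4 : p.1 * w.1 + p.2 * w.2 = tng θ w * (p.1 * (tvec θ).1 + p.2 * (tvec θ).2) := by
    have e1 := congrArg Prod.fst e
    have e2 := congrArg Prod.snd e
    simp only [Prod.smul_fst, Prod.smul_snd, smul_eq_mul] at e1 e2
    linear_combination p.1 * e1 + p.2 * e2
  have h5 : p.1 * w₁.1 + p.2 * w₁.2 = ρ * (p.1 * (tvec θ).1 + p.2 * (tvec θ).2) := by
    rw [hw₁]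
    simp only [Prod.smul_fst, Prod.smul_snd, smul_eq_mul]
    ring
  have h6 : 0 < p.1 * (tvec θ).1 + p.2 * (tvec θ).2 := by
    rw [h5] at h₁
    exact pos_of_mul_pos_right h₁ hρ.le
  nlinarith

lemma contDiff_arg {X : Type*} [NormedAddCommGroup X] [NormedSpace ℝ X] {f g : X → ℝ}
    (hf : ContDiff ℝ ∞ f) (hg : ContDiff ℝ ∞ g)
    (h : ∀ x, (⟨f x, g x⟩ : ℂ) ∈ Complex.slitPlane) :
    ContDiff ℝ ∞ fun x => Complex.arg ⟨f x, g x⟩ := by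
  have hfg : ContDiff ℝ ∞ fun x => (⟨f x, g x⟩ : ℂ) := by
    have e : (fun x => (⟨f x, g x⟩ : ℂ)) = fun x => (f x : ℂ) + (g x : ℂ) * Complex.I := by
      funext x
      apply Complex.ext <;> simp
    rw [e]
    exact (Complex.ofRealCLM.contDiff.comp hf).add
      ((Complex.ofRealCLM.contDiff.comp hg).mul contDiff_const)
  rw [contDiff_iff_contDiffAt]
  intro x
  have h1 : ContDiffAt ℝ ∞ Complex.log (⟨f x, g x⟩ : ℂ) :=
    (Complex.contDiffAt_log (h x)).restrict_scalars ℝ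
  have h2 := ContDiffAt.comp (g := Complex.log) x h1 hfg.contDiffAt
  have h3 := ContDiffAt.comp (g := Complex.imCLM) x Complex.imCLM.contDiff.contDiffAt h2
  refine h3.congr_of_eventuallyEq (Filter.Eventually.of_forall fun x => ?_)
  simp [Complex.log_im]

namespace RectilinearPolygon

variable {P : RectilinearPolygon}

/-- Both stages are written in one formula: `p` turns the smoothing into the conormal of `q₁`, and
`r` moves `q₁` to the reparametrized `q₀`. -/
lemma IsFrontWithCurve.legendrianIsotopic {ε δ D M : ℝ} {α a b : ℤ → ℝ} {θ y z : ℝ → ℝ}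
    {q₁ q₀ : ℝ → ℝ × ℝ} {ρ : ℝ → ℝ} (h : P.IsFrontWithCurve ε δ D M α a b θ y z q₁ ρ)
    {γ : ℝ → JetSpace} (hγ : ∀ t, γ t = ((θ t : Real.Angle), y t, z t)) {A B : ℤ → ℝ}
    (hAB : IsSubdivision P.n A B) (h₀ : P.IsNearPolygon α δ A B q₀) (hδ : 0 < δ) :
    LegendrianIsotopic γ (conormal q₀) := by
  have hab := h.front.subdivision
  have hα := h.front.angleLift
  have hsep : ∀ i j : ℤ, ((P.dir i).IsHorizontal ↔ (P.dir j).IsHorizontal) → ∀ q : ℝ × ℝ,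
      |(P.dir i).dotHeight q - (P.dot i).2| < δ → |(P.dir j).dotHeight q - (P.dot j).2| < δ →
      (P.n : ℤ) ∣ i - j := fun i j hij q h1 h2 =>
    h.separation i j hij q (by linarith [h.δ_lt]) (by linarith [h.δ_lt])
  obtain ⟨φ, hφ, hφab⟩ := exists_reparametrization hab hAB
  have h₂ := h₀.comp hφ hφab
  have h₁ := h.isNearPolygon
  set q₂ := q₀ ∘ φ with hq₂
  have hd₁ : ∀ t, deriv q₁ t = ρ t • tvec (θ t) := fun t => (h.hasDerivAt t).deriv
  -- `p` reaches 1 at `s = 1/3` and `r` leaves 0 at `s = 2/3`, so at each `s` at most one of them is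
  -- moving.
  set p : ℝ → ℝ := fun s => Real.smoothTransition (3 * s) with hp
  set r : ℝ → ℝ := fun s => Real.smoothTransition (3 * s - 2) with hr
  have hpm : ∀ s, p s ∈ Set.Icc (0 : ℝ) 1 := fun s =>
    ⟨Real.smoothTransition.nonneg _, Real.smoothTransition.le_one _⟩
  have hrm : ∀ s, r s ∈ Set.Icc (0 : ℝ) 1 := fun s =>
    ⟨Real.smoothTransition.nonneg _, Real.smoothTransition.le_one _⟩
  have hps : ContDiff ℝ ∞ p :=
    (Real.smoothTransition.contDiff (n := ⊤)).comp (contDiff_const.mul contDiff_id)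
  have hrs : ContDiff ℝ ∞ r :=
    (Real.smoothTransition.contDiff (n := ⊤)).comp
      ((contDiff_const.mul contDiff_id).sub contDiff_const)
  set w : ℝ × ℝ → ℝ × ℝ := fun x => (1 - r x.1) • deriv q₁ x.2 + r x.1 • deriv q₂ x.2 with hw
  set Q : ℝ × ℝ → ℝ × ℝ := fun x => (1 - r x.1) • q₁ x.2 + r x.1 • q₂ x.2 with hQ
  -- The angle of the interpolated curve is measured relative to `θ`. The relative velocity stays in
  -- the slit plane, so this is a smooth lift, and it equals `θ` as long as `r` vanishes.
  set Θ : ℝ × ℝ → ℝ := fun x =>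
    θ x.2 + Complex.arg ⟨tng (θ x.2) (w x), nrm (θ x.2) (w x)⟩ with hΘ
  set Y : ℝ × ℝ → ℝ := fun x => (1 - p x.1) * y x.2 + p x.1 * -tng (Θ x) (Q x) with hY
  set Z : ℝ × ℝ → ℝ := fun x => (1 - p x.1) * z x.2 + p x.1 * nrm (Θ x) (Q x) with hZ
  have hslit : ∀ x, (⟨tng (θ x.2) (w x), nrm (θ x.2) (w x)⟩ : ℂ) ∈ Complex.slitPlane := by
    intro x
    obtain ⟨v, hv₂, hv₁⟩ := h₂.exists_halfplane h₁ hab x.2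
    exact mem_slitPlane_of_halfplane (h.speed_pos x.2) (hrm x.1) (hd₁ x.2) hv₂ hv₁
  have hds : ∀ {q : ℝ → ℝ × ℝ}, ContDiff ℝ ∞ q → ContDiff ℝ ∞ (deriv q) := fun hq =>
    (contDiff_infty_iff_deriv.1 hq).2
  have hθs : ContDiff ℝ ∞ fun x : ℝ × ℝ => θ x.2 := h.front.smooth_θ.comp contDiff_snd
  have hrs' : ContDiff ℝ ∞ fun x : ℝ × ℝ => r x.1 := hrs.comp contDiff_fst
  have hps' : ContDiff ℝ ∞ fun x : ℝ × ℝ => p x.1 := hps.comp contDiff_fst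
  have hws : ContDiff ℝ ∞ w :=
    ((contDiff_const.sub hrs').smul ((hds h₁.smooth).comp contDiff_snd)).add
      (hrs'.smul ((hds h₂.smooth).comp contDiff_snd))
  have hQs : ContDiff ℝ ∞ Q :=
    ((contDiff_const.sub hrs').smul (h₁.smooth.comp contDiff_snd)).add
      (hrs'.smul (h₂.smooth.comp contDiff_snd))
  have hΘs : ContDiff ℝ ∞ Θ :=
    hθs.add (contDiff_arg (contDiff_tng hθs hws) (contDiff_nrm hθs hws) hslit)
  have hYs : ContDiff ℝ ∞ Y :=
    ((contDiff_const.sub hps').mul (h.front.smooth_y.comp contDiff_snd)).add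
      (hps'.mul (contDiff_tng hΘs hQs).neg)
  have hZs : ContDiff ℝ ∞ Z :=
    ((contDiff_const.sub hps').mul (h.front.smooth_z.comp contDiff_snd)).add
      (hps'.mul (contDiff_nrm hΘs hQs))
  have hΘ0 : ∀ s t, r s = 0 → Θ (s, t) = θ t ∧ Q (s, t) = q₁ t := by
    intro s t hs
    have hw0 : w (s, t) = ρ t • tvec (θ t) := by simp [hw, hs, hd₁]
    refine ⟨?_, by simp [hQ, hs]⟩
    simp only [hΘ]
    rw [hw0, tng_smul, nrm_smul, tng_tvec, nrm_tvec, sub_self, Real.cos_zero, Real.sin_zero,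
      mul_one, mul_zero]
    have : (⟨ρ t, 0⟩ : ℂ) = (ρ t : ℂ) := rfl
    rw [this, Complex.arg_ofReal_of_nonneg (h.speed_pos t).le, add_zero]
  have hderivQ : ∀ s t, deriv (fun t => Q (s, t)) t
      = ‖(⟨tng (θ t) (w (s, t)), nrm (θ t) (w (s, t))⟩ : ℂ)‖ • tvec (Θ (s, t)) := by
    intro s t
    rw [← polar_form, show (fun t => Q (s, t)) = fun t => (1 - r s) • q₁ t + r s • q₂ t from rfl,
      deriv_convex h₁.smooth h₂.smooth]
  have hnormpos : ∀ x, 0 < ‖(⟨tng (θ x.2) (w x), nrm (θ x.2) (w x)⟩ : ℂ)‖ := fun x =>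
    norm_pos_iff.2 (Complex.slitPlane_ne_zero (hslit x))
  have hcon : ∀ s, p s = 1 → (fun t => ((Θ (s, t) : Real.Angle), Y (s, t), Z (s, t)))
      = conormal fun t => Q (s, t) := by
    intro s hs
    funext t
    rw [conormal_eq (hnormpos (s, t)) (hderivQ s t)]
    simp [hY, hZ, hs]
  refine ⟨fun s t => ((Θ (s, t) : Real.Angle), Y (s, t), Z (s, t)),
    ⟨Θ, Y, Z, hΘs.contDiffOn, hYs.contDiffOn, hZs.contDiffOn, fun s _ t => rfl⟩, fun s _ => ?_,
    ⟨id, ⟨contDiff_id, fun t => by simp, fun t => rfl⟩, ?_⟩, ⟨φ, hφ, ?_⟩⟩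
  · rcases le_total s (2 / 3) with hs | hs
    · have hr0 : r s = 0 := Real.smoothTransition.zero_of_nonpos (by linarith)
      have e : (fun t => ((Θ (s, t) : Real.Angle), Y (s, t), Z (s, t)))
          = fun t => ((θ t : Real.Angle), (1 - p s) * y t + p s * -tng (θ t) (q₁ t),
            (1 - p s) * z t + p s * nrm (θ t) (q₁ t)) := by
        funext t
        obtain ⟨e1, e2⟩ := hΘ0 s t hr0
        simp only [hY, hZ, e1, e2]
      exact (congrArg IsLegendrianKnot e).mpr (h.isLegendrianKnot (hpm s))
    · have hp1 : p s = 1 := Real.smoothTransition.one_of_one_le (by linarith)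
      refine (congrArg IsLegendrianKnot (hcon s hp1)).mpr ?_
      exact (h₁.convex h₂ (hrm s)).isLegendrianKnot_conormal hα hab hsep
        (hΘs.comp (contDiff_const.prodMk contDiff_id)) (fun t => hnormpos (s, t)) (hderivQ s)
  · have hp0 : p 0 = 0 := Real.smoothTransition.zero_of_nonpos (by norm_num)
    have hr0 : r 0 = 0 := Real.smoothTransition.zero_of_nonpos (by norm_num)
    funext t
    obtain ⟨e1, e2⟩ := hΘ0 0 t hr0
    rw [Function.comp_apply, id, hγ]
    simp only [hY, hZ, e1, hp0]
    simp
  · have hp1 : p 1 = 1 := Real.smoothTransition.one_of_one_le (by norm_num)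
    have hr1 : r 1 = 1 := Real.smoothTransition.one_of_one_le (by norm_num)
    have e : (fun t => Q (1, t)) = q₀ ∘ φ := by
      funext t
      simp [hQ, hr1, hq₂]
    refine (hcon 1 hp1).trans ?_
    rw [e]
    exact conormal_comp h₀.smooth (h₀.deriv_ne_zero hAB) hφ

variable (P) in
/-- Sufficiently small smoothings of the polygonal path are Legendrian isotopic to the conormal
knots of sufficiently small rectilinear curves. -/
theorem exists_legendrianIsotopic : ∃ ε₀ : ℝ, 0 < ε₀ ∧ ∀ (q : ℝ → ℝ × ℝ) (γ : ℝ → JetSpace),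
    P.IsRectilinearCurve ε₀ q → P.IsSmoothedFront ε₀ γ → LegendrianIsotopic γ (conormal q) := by
  obtain ⟨D, hD, hsep⟩ := P.exists_separation
  obtain ⟨M, hM, hMv⟩ := P.exists_bound
  have hδ : 0 < D / 64 := by positivity
  obtain ⟨ε₁, hε₁, H⟩ := P.exists_curve_of_angle hδ hMv
  -- With `δ = D / 64` the entries supply `ε_le`, the hypothesis of `exists_curve_of_angle`, the
  -- inclusion of rectilinear curves in the `δ`-neighbourhood, `ε_lt` and `εδ_lt`.
  set ε₀ := min (min (1 / 10) ε₁) (min (D / 64) (min (D / (2 * (1 + 2 * M)))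
    (D / (2 * (M + D / 64))))) with hε₀
  have e1 : ε₀ ≤ 1 / 10 := (min_le_left _ _).trans (min_le_left _ _)
  have e2 : ε₀ ≤ ε₁ := (min_le_left _ _).trans (min_le_right _ _)
  have e3 : ε₀ ≤ D / 64 := (min_le_right _ _).trans (min_le_left _ _)
  have e4 : ε₀ ≤ D / (2 * (1 + 2 * M)) :=
    (min_le_right _ _).trans ((min_le_right _ _).trans (min_le_left _ _))
  have e5 : ε₀ ≤ D / (2 * (M + D / 64)) :=
    (min_le_right _ _).trans ((min_le_right _ _).trans (min_le_right _ _))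
  have hpos : 0 < ε₀ := by positivity
  rw [le_div_iff₀ (by positivity)] at e4 e5
  refine ⟨ε₀, hpos, fun q γ hq hγ => ?_⟩
  obtain ⟨α, a, b, θ, y, z, hF, hcoord⟩ := hγ.exists_lift (by linarith)
  obtain ⟨q₁, ρ, c1, c2, c3, c4, c5, c6, c7⟩ := H hpos e2 hF.angleLift hF.subdivision hF.smooth_θ
    hF.periodic_θ (fun i t ht => (hF.near i t ht).1)
  obtain ⟨hcurve, A, B, hAB, hedge, hvertex⟩ := hq
  have hfc : P.IsFrontWithCurve ε₀ (D / 64) D M α a b θ y z q₁ ρ :=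
    ⟨hF, c1, c2, c3, c4, c5, c6, c7, hMv, hsep, e1, hD, by linarith, by linarith, by linarith⟩
  exact hfc.legendrianIsotopic hcoord hAB.rotate
    ((IsRectilinearCurve.isNearPolygon hpos hF.angleLift hcurve hedge hvertex).mono e3) hδ

end RectilinearPolygon

/-! ### Existence of rectilinear curves -/

lemma isSubdivision_arithmetic {n : ℕ} {r x y : ℝ} (hr : 0 < r) (hn : 4 * n * r = 1) (hxy : x < y)
    (hy : y < x + 4) : IsSubdivision n (fun i => (4 * i + x) * r) (fun i => (4 * i + y) * r) where
  lt i := by nlinarith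
  lt_next i := by push_cast; nlinarith
  shift_a i := by push_cast; linear_combination hn
  shift_b i := by push_cast; linear_combination hn

namespace RectilinearPolygon

variable (P : RectilinearPolygon)

/-- The moving phase `(a i, b i)` is the parameter that matters: curves with different phases are
later superposed so that they never all rest at once. -/
lemma exists_smooth_stopping_curve {a b : ℤ → ℝ} (hab : IsSubdivision P.n a b) :
    ∃ f f' : ℝ → ℝ × ℝ, ContDiff ℝ ∞ f ∧ Function.Periodic f 1 ∧ (∀ t, HasDerivAt f (f' t) t) ∧
      (∀ i, ∀ t ∈ Set.Icc (b (i - 1)) (a i), f t = P.vertex i) ∧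
      (∀ i, ∀ t ∈ Set.Icc (b (i - 1)) (a (i + 1)),
        f t ∈ segment ℝ (P.vertex i) (P.vertex (i + 1)) ∧
        ∃ r : ℝ, 0 ≤ r ∧ (t ∈ Set.Ioo (a i) (b i) → 0 < r) ∧ f' t = r • (P.dir i).vec) := by
  obtain ⟨f, hper, hf, hval⟩ := P.exists_stopping_curve hab
  set c : ℤ → ℝ → ℝ × ℝ := fun i _ => P.len i • (P.dir i).vec with hc
  have hcper : ∀ i, c (i + P.n) = c i := fun i => by
    simp only [hc, P.len_periodic, P.dir_periodic]
  have hf' : ∀ t, HasDerivAt f (bumpSum P.n a b c t) t := hf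
  have hrest : ∀ i, ∀ t ∈ Set.Icc (b (i - 1)) (a i), f t = P.vertex i := by
    intro i t ht
    have hai : a (i - 1 + 1) = a i := by rw [sub_add_cancel]
    have h1 := hval (i - 1) t ⟨(hab.lt _).le.trans ht.1, by rw [hai]; exact ht.2⟩
    rw [step_eq_one (hab.lt _) (hab.lt_add_one _)
      ⟨ht.1, (hai ▸ ht.2 : t ≤ a (i - 1 + 1)).trans (hab.next_le _)⟩, one_smul,
      ← (P.len_spec (i - 1)).2, sub_add_cancel] at h1
    exact h1
  refine ⟨f, bumpSum P.n a b c, ?_, hper, hf', hrest, fun i t ht => ⟨?_, ?_⟩⟩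
  · rw [contDiff_infty_iff_deriv]
    refine ⟨fun t => (hf' t).differentiableAt, ?_⟩
    rw [show deriv f = bumpSum P.n a b c from funext fun t => (hf' t).deriv]
    exact bumpSum_contDiff _ _ _ fun i => contDiff_const
  · rcases le_total t (a i) with h | h
    · rw [hrest i t ⟨ht.1, h⟩]
      exact left_mem_segment _ _ _
    · rw [hval i t ⟨h, ht.2⟩, segment_eq_image']
      refine ⟨step (a i) (b i) t, ⟨step_nonneg (hab.lt i) h,
        step_le_one (hab.lt i) (hab.lt_add_one i) (ht.2.trans (hab.next_le i))⟩, ?_⟩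
      simp only [(P.len_spec i).2, add_sub_cancel_left]
  · refine ⟨bump (a i) (b i) t * P.len i, mul_nonneg (bump_nonneg (hab.lt i) t)
      (P.len_spec i).1.le, fun h => mul_pos (bump_pos (hab.lt_add_one i) h) (P.len_spec i).1, ?_⟩
    rw [bumpSum_apply' hab hcper ht, mul_smul]

lemma smul_vec_add_smul_vec_ne_zero (i : ℤ) {r s : ℝ} (h : r ≠ 0 ∨ s ≠ 0) :
    r • (P.dir (i - 1)).vec + s • (P.dir i).vec ≠ 0 := by
  intro e
  have ht := P.turn_mul_self (i - 1)
  have h1 := congrArg Prod.fst e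
  have h2 := congrArg Prod.snd e
  simp only [Prod.fst_add, Prod.snd_add, Prod.smul_fst, Prod.smul_snd, smul_eq_mul, Prod.fst_zero,
    Prod.snd_zero] at h1 h2
  have hne : P.turn (i - 1) ≠ 0 := fun h0 => by rw [h0] at ht; simp at ht
  have ht' : P.turn (i - 1) = (P.dir (i - 1)).vec.1 * (P.dir i).vec.2
      - (P.dir (i - 1)).vec.2 * (P.dir i).vec.1 := by
    unfold turn; rw [sub_add_cancel]
  rcases h with h | h
  · refine mul_ne_zero h hne ?_
    rw [ht']
    linear_combination (P.dir i).vec.2 * h1 - (P.dir i).vec.1 * h2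
  · refine mul_ne_zero h hne ?_
    rw [ht']
    linear_combination (P.dir (i - 1)).vec.1 * h2 - (P.dir (i - 1)).vec.2 * h1

/-- The main curve `f` rests at each vertex. Adding a little of `g`, which sets out early, and of
`k`, which arrives late, keeps the velocity nonzero and turns the stop into a rounded corner, since
`g` already runs along the next edge while `k` still runs along the previous one. -/
theorem exists_isRectilinearCurve {ε : ℝ} (hε : 0 < ε) : ∃ q, P.IsRectilinearCurve ε q := by
  obtain ⟨L, hL, hLe⟩ := exists_common_bound P.n_pos
    (f := fun i => dist (P.vertex i) (P.vertex (i + 1))) (fun i => by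
      rw [show i + (P.n : ℤ) + 1 = i + 1 + P.n by ring, P.vertex_periodic, P.vertex_periodic])
  have hn : (0 : ℝ) < P.n := by exact_mod_cast P.n_pos
  set r : ℝ := 1 / (4 * P.n) with hr
  have hr0 : 0 < r := by positivity
  have hnr : 4 * P.n * r = 1 := by rw [hr]; field_simp
  -- At a corner `f` rests at the vertex, so the distance to it comes from `g` and `k` alone and is
  -- at most `2 η L`.
  set η : ℝ := min (1 / 4) (ε / (4 * L)) with hη
  have hη0 : 0 < η := by positivity
  have hη1 : η ≤ 1 / 4 := min_le_left _ _
  have hη2 : 2 * (η * L) < ε := by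
    have : η ≤ ε / (4 * L) := min_le_right _ _
    rw [le_div_iff₀ (by positivity)] at this
    linarith
  have hab := isSubdivision_arithmetic (n := P.n) (x := -1) (y := 1) hr0 hnr (by norm_num)
    (by norm_num)
  obtain ⟨f, f', hfs, hfp, hf, hfv, hfe⟩ := P.exists_smooth_stopping_curve
    (isSubdivision_arithmetic (n := P.n) (x := 1) (y := 3) hr0 hnr (by norm_num) (by norm_num))
  obtain ⟨g, g', hgs, hgp, hg, -, hge⟩ := P.exists_smooth_stopping_curve
    (isSubdivision_arithmetic (n := P.n) (x := -1) (y := 5 / 2) hr0 hnr (by norm_num)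
      (by norm_num))
  obtain ⟨k, k', hks, hkp, hk, -, hke⟩ := P.exists_smooth_stopping_curve
    (isSubdivision_arithmetic (n := P.n) (x := 3 / 2) (y := 5) hr0 hnr (by norm_num)
      (by norm_num))
  set q : ℝ → ℝ × ℝ := fun t => (1 - 2 * η) • f t + (η • g t + η • k t) with hq
  have hqd : ∀ t, deriv q t = (1 - 2 * η) • f' t + (η • g' t + η • k' t) := fun t =>
    (((hf t).fun_const_smul _).fun_add (((hg t).fun_const_smul _).fun_add
      ((hk t).fun_const_smul _))).deriv
  have hedge : ∀ i : ℤ, ∀ t ∈ Set.Icc ((4 * i + 1) * r) ((4 * (i + 1 : ℤ) + -1) * r),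
      q t ∈ segment ℝ (P.vertex i) (P.vertex (i + 1)) ∧
      ∃ r : ℝ, 0 < r ∧ deriv q t = r • (P.dir i).vec := by
    intro i t ⟨ht1, ht2⟩
    push_cast at ht2
    obtain ⟨m1, r1, h1, -, e1⟩ := hfe i t ⟨by push_cast; nlinarith, by push_cast; nlinarith⟩
    obtain ⟨m2, r2, h2, p2, e2⟩ := hge i t ⟨by push_cast; nlinarith, by push_cast; nlinarith⟩
    obtain ⟨m3, r3, h3, p3, e3⟩ := hke i t ⟨by push_cast; nlinarith, by push_cast; nlinarith⟩
    refine ⟨?_, (1 - 2 * η) * r1 + (η * r2 + η * r3), ?_, ?_⟩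
    · have hc := convex_segment (𝕜 := ℝ) (P.vertex i) (P.vertex (i + 1))
      have h4 := hc m2 m3 (show (0 : ℝ) ≤ 1 / 2 by norm_num) (show (0 : ℝ) ≤ 1 / 2 by norm_num)
        (by norm_num)
      have h5 := hc m1 h4 (show (0 : ℝ) ≤ 1 - 2 * η by linarith)
        (show (0 : ℝ) ≤ 2 * η by linarith) (by ring)
      convert h5 using 1
      simp only [hq]
      module
    -- The moving phases of `g` and `k` on this edge end at `5/2` and begin at `3/2`, in units of
    -- `r`, so they overlap and at every moment one of them is moving.
    · have : 0 < r2 ∨ 0 < r3 := by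
        rcases lt_or_ge t ((4 * i + 5 / 2) * r) with h | h
        · exact Or.inl (p2 ⟨by nlinarith, h⟩)
        · exact Or.inr (p3 ⟨by nlinarith, by nlinarith⟩)
      have h4 : 0 ≤ (1 - 2 * η) * r1 := mul_nonneg (by linarith) h1
      rcases this with h | h
      · linarith [mul_pos hη0 h, mul_nonneg hη0.le h3]
      · linarith [mul_pos hη0 h, mul_nonneg hη0.le h2]
    · rw [hqd, e1, e2, e3]
      module
  have hvertex : ∀ i : ℤ, ∀ t ∈ Set.Icc ((4 * i + -1) * r) ((4 * i + 1) * r),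
      dist (q t) (P.vertex i) < ε ∧ ∃ r s : ℝ, 0 ≤ r ∧ 0 ≤ s ∧ (r ≠ 0 ∨ s ≠ 0) ∧
        deriv q t = r • (P.dir (i - 1)).vec + s • (P.dir i).vec := by
    intro i t ⟨ht1, ht2⟩
    obtain ⟨-, r1, h1, -, e1⟩ := hfe i t ⟨by push_cast; nlinarith, by push_cast; nlinarith⟩
    obtain ⟨m2, r2, h2, p2, e2⟩ := hge i t ⟨by push_cast; nlinarith, by push_cast; nlinarith⟩
    obtain ⟨m3, r3, h3, p3, e3⟩ := hke (i - 1) t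
      ⟨by push_cast; nlinarith, by push_cast; nlinarith⟩
    have e0 := hfv i t ⟨by push_cast; nlinarith, by nlinarith⟩
    rw [sub_add_cancel] at m3
    have d2 : ‖g t - P.vertex i‖ ≤ L := by
      rw [← dist_eq_norm]
      exact (convex_closedBall (P.vertex i) L).segment_subset (Metric.mem_closedBall_self hL.le)
        (Metric.mem_closedBall'.2 (hLe i)) m2
    have d3 : ‖k t - P.vertex i‖ ≤ L := by
      rw [← dist_eq_norm]
      refine (convex_closedBall (P.vertex i) L).segment_subset ?_
        (Metric.mem_closedBall_self hL.le) m3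
      have := hLe (i - 1)
      rw [sub_add_cancel] at this
      exact Metric.mem_closedBall.2 this
    refine ⟨?_, η * r3, (1 - 2 * η) * r1 + η * r2, mul_nonneg hη0.le h3,
      add_nonneg (mul_nonneg (by linarith) h1) (mul_nonneg hη0.le h2), ?_, ?_⟩
    · rw [dist_eq_norm, show q t - P.vertex i
        = η • (g t - P.vertex i) + η • (k t - P.vertex i) by simp only [hq, e0]; module]
      refine (norm_add_le _ _).trans_lt ?_
      rw [norm_smul, norm_smul, Real.norm_eq_abs, abs_of_pos hη0]
      nlinarith
    · rcases lt_or_ge t ((4 * i + 1) * r) with h | h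
      · left
        exact (mul_pos hη0 (p3 ⟨by push_cast; nlinarith, by push_cast; nlinarith⟩)).ne'
      · right
        have := mul_pos hη0 (p2 ⟨by nlinarith, by nlinarith⟩)
        have h4 : 0 ≤ (1 - 2 * η) * r1 := mul_nonneg (by linarith) h1
        exact (by linarith : (0 : ℝ) < (1 - 2 * η) * r1 + η * r2).ne'
    · rw [hqd, e1, e2, e3]
      module
  refine ⟨q, ⟨(hfs.const_smul _).add ((hgs.const_smul _).add (hks.const_smul _)), fun t => ?_,
    fun t => ?_⟩, _, _, hab, hedge, fun i t ht => ?_⟩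
  · simp only [hq, hfp t, hgp t, hkp t]
  · obtain ⟨j, hj | hj⟩ := hab.exists_mem_Icc t
    · obtain ⟨-, r, s, -, -, h, e⟩ := hvertex j t hj
      rw [e]
      exact P.smul_vec_add_smul_vec_ne_zero j h
    · obtain ⟨-, r, h, e⟩ := hedge j t hj
      rw [e]
      have := P.smul_vec_add_smul_vec_ne_zero j (r := 0) (s := r) (Or.inr h.ne')
      rwa [zero_smul, zero_add] at this
  · obtain ⟨h1, r, s, h2, h3, -, h4⟩ := hvertex i t ht
    exact ⟨h1, r, s, h2, h3, h4⟩

end RectilinearPolygon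

/-! ### Existence of smoothings -/

lemma bump_add_add (x y c t : ℝ) : bump (x + c) (y + c) t = bump x y (t - c) := by
  have h : ∀ t, bumpProfile (x + c) (y + c) t = bumpProfile x y (t - c) := fun t => by
    unfold bumpProfile
    rw [show t - (x + c + (y + c)) / 2 = t - c - (x + y) / 2 by ring,
      show y + c - (x + c) = y - x by ring]
  unfold bump
  rw [h, ← intervalIntegral.integral_comp_add_right]
  simp only [h, add_sub_cancel_right]

/-- The mean of a function with respect to the bump function on `(x, y)`. -/
lemma exists_bump_mean {x y : ℝ} (hxy : x < y) (hy : y < x + 1) {w : ℝ → ℝ} (hw : ContDiff ℝ ∞ w)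
    {l u : ℝ} (hl : ∀ t ∈ Set.Icc x y, l ≤ w t) (hu : ∀ t ∈ Set.Icc x y, w t ≤ u) :
    ∃ k ∈ Set.Icc l u, ∃ K : ℝ → ℝ,
      (∀ t, HasDerivAt K (bump x y t * (w t - k)) t) ∧ K x = K y := by
  obtain ⟨G, -, hG, hG0⟩ := exists_primitive ((bump_contDiff x y).mul hw) x 0
  have hmono : ∀ (g : ℝ → ℝ), (∀ t, HasDerivAt G (g t) t) → ∀ c d : ℝ,
      (∀ t ∈ Set.Ioo x y, 0 ≤ c * bump x y t + d * g t) → 0 ≤ c + d * G y := by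
    intro g hg c d h
    have hd : ∀ t, HasDerivAt (fun t => c * step x y t + d * G t) (c * bump x y t + d * g t) t :=
      fun t => ((step_hasDerivAt x y t).const_mul c).fun_add ((hg t).const_mul d)
    have := monotoneOn_of_deriv_nonneg (convex_Icc x y)
      (fun t _ => (hd t).continuousAt.continuousWithinAt)
      (fun t _ => (hd t).differentiableAt.differentiableWithinAt) (fun t ht => by
        rw [interior_Icc] at ht
        rw [(hd t).deriv]
        exact h t ht) ⟨le_rfl, hxy.le⟩ ⟨hxy.le, le_rfl⟩ hxy.le
    simp only [step_left, step_right hxy hy, hG0] at this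
    linarith
  refine ⟨G y, ⟨?_, ?_⟩, fun t => G t - G y * step x y t, fun t => ?_, ?_⟩
  · have := hmono _ hG (-l) 1 (fun t ht => by
      have := mul_le_mul_of_nonneg_left (hl t ⟨ht.1.le, ht.2.le⟩) (bump_nonneg hxy t)
      linarith)
    linarith
  · have := hmono _ hG u (-1) (fun t ht => by
      have := mul_le_mul_of_nonneg_left (hu t ⟨ht.1.le, ht.2.le⟩) (bump_nonneg hxy t)
      linarith)
    linarith
  · exact ((hG t).fun_sub ((step_hasDerivAt x y t).const_mul (G y))).congr_deriv (by ring)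
  · simp only [hG0, step_left, step_right hxy hy]
    ring

/-- The shape of the angle function near a dot at which the direction of the polygonal path
changes from `τ'` to `τ`. -/
structure IsDotProfile (r τ' τ : ℝ) (ψ ψ' : ℝ → ℝ) : Prop where
  smooth : ContDiff ℝ ∞ ψ
  hasDerivAt : ∀ u, HasDerivAt ψ (ψ' u) u
  mean : ∃ K : ℝ → ℝ, (∀ u, HasDerivAt K (bump (-r) r u * ψ u) u) ∧ K (-r) = K r
  right : ∀ u ∈ Set.Icc r (3 * r), 0 ≤ τ * ψ u ∧ τ * ψ u ≤ 1 ∧ 0 < τ * ψ' u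
  left : ∀ u ∈ Set.Icc (-(3 * r)) (-r), -1 ≤ τ' * ψ u ∧ τ' * ψ u ≤ 0 ∧ 0 < τ' * ψ' u
  bound : ∀ u ∈ Set.Icc (-r) r, |ψ u| ≤ 1 ∧ |ψ' u| ≤ 1
  rounded : τ' = τ → ∀ u ∈ Set.Icc (-r) r, 0 < τ * ψ' u
  cusp : τ' ≠ τ → ∀ u, (u < 0 → 0 < τ' * ψ' u) ∧ (0 < u → 0 < τ * ψ' u)

/-- A linear profile serves for a rounded corner and a quadratic one for a cusp. Subtracting the
mean `k` with respect to the bump gives mean zero, and the bounds on `k` preserve the signs outside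
`[-r, r]`. -/
lemma exists_isDotProfile {r τ' τ : ℝ} (hr : 0 < r) (hr4 : 4 * r ≤ 1) (hτ' : τ' = 1 ∨ τ' = -1)
    (hτ : τ = 1 ∨ τ = -1) : ∃ ψ ψ', IsDotProfile r τ' τ ψ ψ' := by
  have hττ : τ * τ = 1 := by rcases hτ with h | h <;> rw [h] <;> norm_num
  have habs : |τ| = 1 := by rcases hτ with h | h <;> rw [h] <;> norm_num
  by_cases he : τ' = τ
  · subst he
    obtain ⟨k, ⟨hk1, hk2⟩, K, hK, hK'⟩ := exists_bump_mean (x := -r) (y := r) (by linarith)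
      (by linarith) (w := fun u => u) contDiff_id (l := -r) (u := r) (fun t ht => ht.1)
      (fun t ht => ht.2)
    have e : ∀ u, τ' * (τ' * (u - k)) = u - k := fun u => by linear_combination (u - k) * hττ
    refine ⟨fun u => τ' * (u - k), fun _ => τ', by fun_prop, fun u => ?_,
      ⟨fun u => τ' * K u, fun u => ?_, congrArg _ hK'⟩, fun u hu => ?_, fun u hu => ?_,
      fun u hu => ⟨?_, habs.le⟩, fun _ u _ => by rw [hττ]; norm_num, fun h => absurd rfl h⟩
    · simpa using ((hasDerivAt_id u).sub_const k).const_mul τ'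
    · exact ((hK u).const_mul τ').congr_deriv (by ring)
    · rw [e, hττ]
      exact ⟨by linarith [hu.1], by linarith [hu.2], one_pos⟩
    · rw [e, hττ]
      exact ⟨by linarith [hu.1], by linarith [hu.2], one_pos⟩
    · rw [abs_mul, habs, one_mul, abs_le]
      constructor <;> linarith [hu.1, hu.2]
  · have hneg : τ' = -τ := by
      rcases hτ with h | h <;> rcases hτ' with h' | h' <;> rw [h, h'] at he ⊢ <;> simp at he ⊢
    have hsq : ∀ u ∈ Set.Icc (-r) r, u ^ 2 ≤ r ^ 2 := fun u hu => sq_le_sq' hu.1 hu.2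
    obtain ⟨k, ⟨hk1, hk2⟩, K, hK, hK'⟩ := exists_bump_mean (x := -r) (y := r) (by linarith)
      (by linarith) (w := fun u => u ^ 2) (by fun_prop) (l := 0) (u := r ^ 2)
      (fun t _ => sq_nonneg t) hsq
    have e : ∀ u, τ * (τ * (u ^ 2 - k)) = u ^ 2 - k := fun u => by
      linear_combination (u ^ 2 - k) * hττ
    have e' : ∀ u, τ * (τ * (2 * u)) = 2 * u := fun u => by linear_combination 2 * u * hττ
    refine ⟨fun u => τ * (u ^ 2 - k), fun u => τ * (2 * u), by fun_prop, fun u => ?_,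
      ⟨fun u => τ * K u, fun u => ?_, congrArg _ hK'⟩, fun u hu => ?_, fun u hu => ?_,
      fun u hu => ⟨?_, ?_⟩, fun h => absurd h he, fun _ u => ?_⟩
    · simpa using (((hasDerivAt_id u).pow 2).sub_const k).const_mul τ
    · exact ((hK u).const_mul τ).congr_deriv (by ring)
    · rw [e, e']
      exact ⟨by nlinarith [hu.1], by nlinarith [hu.1, hu.2], by linarith [hu.1]⟩
    · rw [hneg, neg_mul, neg_mul, e, e']
      exact ⟨by nlinarith [hu.1, hu.2], by nlinarith [hu.2], by linarith [hu.2]⟩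
    · rw [abs_mul, habs, one_mul, abs_le]
      constructor <;> nlinarith [hsq u hu]
    · rw [abs_mul, habs, one_mul, abs_le]
      constructor <;> linarith [hu.1, hu.2]
    · rw [hneg, neg_mul, e']
      constructor <;> intro h <;> linarith

/-- Smooth functions which agree near the points of a subdivision can be glued. -/
lemma IsSubdivision.exists_glue {n : ℕ} {x y : ℤ → ℝ} (h : IsSubdivision n x y) {F : ℤ → ℝ → ℝ}
    (hF : ∀ j, ContDiff ℝ ∞ (F j)) (hFF : ∀ j, F j =ᶠ[𝓝 (x (j + 1))] F (j + 1)) :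
    ∃ f : ℝ → ℝ, ContDiff ℝ ∞ f ∧ ∀ j, ∀ t ∈ Set.Icc (x j) (x (j + 1)), f =ᶠ[𝓝 t] F j := by
  choose J hJ using h.exists_mem
  have hJe : ∀ {j t}, t ∈ Set.Ico (x j) (x (j + 1)) → J t = j := by
    intro j t ht
    have h1 := h.strictMono_a.lt_iff_lt.1 (ht.1.trans_lt (hJ t).2)
    have h2 := h.strictMono_a.lt_iff_lt.1 ((hJ t).1.trans_lt ht.2)
    omega
  set f : ℝ → ℝ := fun t => F (J t) t with hf
  have hfe : ∀ {j t}, t ∈ Set.Ico (x j) (x (j + 1)) → f t = F j t := fun ht => by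
    simp only [hf, hJe ht]
  have hend : ∀ j, f =ᶠ[𝓝 (x (j + 1))] F (j + 1) := by
    intro j
    have h1 : Set.Ioo (x j) (x (j + 1 + 1)) ∈ 𝓝 (x (j + 1)) :=
      Ioo_mem_nhds (h.strictMono_a (by omega)) (h.strictMono_a (by omega))
    filter_upwards [h1, hFF j] with t ht e
    rcases lt_or_ge t (x (j + 1)) with hlt | hle
    · rw [hfe ⟨ht.1.le, hlt⟩, e]
    · exact hfe ⟨hle, ht.2⟩
  have key : ∀ j, ∀ t ∈ Set.Icc (x j) (x (j + 1)), f =ᶠ[𝓝 t] F j := by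
    intro j t ht
    rcases eq_or_lt_of_le ht.1 with h1 | h1
    · have := hend (j - 1)
      rwa [sub_add_cancel, h1] at this
    · rcases eq_or_lt_of_le ht.2 with h2 | h2
      · rw [h2]
        exact (hend j).trans (hFF j).symm
      · filter_upwards [Ioo_mem_nhds h1 h2] with s hs
        exact hfe ⟨hs.1.le, hs.2⟩
  refine ⟨f, contDiff_iff_contDiffAt.2 fun t => ?_, key⟩
  exact (hF _).contDiffAt.congr_of_eventuallyEq (key (J t) t ⟨(hJ t).1, (hJ t).2.le⟩)

lemma exists_int_primitive (f : ℤ → ℝ) (c : ℝ) :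
    ∃ S : ℤ → ℝ, S 0 = c ∧ ∀ i, S (i + 1) = S i + f i := by
  refine ⟨fun i => c + ∑ k ∈ Finset.range i.toNat, f k
    - ∑ k ∈ Finset.range (-i).toNat, f (-(k + 1)), by simp, fun i => ?_⟩
  simp only
  rcases le_or_gt 0 i with h | h
  · obtain ⟨m, rfl⟩ := Int.eq_ofNat_of_zero_le h
    rw [show ((m : ℤ) + 1).toNat = m + 1 by omega, show (-((m : ℤ) + 1)).toNat = 0 by omega,
      show ((m : ℤ)).toNat = m by omega, show (-(m : ℤ)).toNat = 0 by omega,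
      Finset.sum_range_succ]
    ring
  · obtain ⟨m, hm⟩ := Int.eq_ofNat_of_zero_le (show 0 ≤ -(i + 1) by omega)
    obtain rfl : i = -((m : ℤ) + 1) := by omega
    rw [show (-((m : ℤ) + 1) + 1).toNat = 0 by omega,
      show (-(-((m : ℤ) + 1) + 1)).toNat = m by omega, show (-((m : ℤ) + 1)).toNat = 0 by omega,
      show (-(-((m : ℤ) + 1))).toNat = m + 1 by omega, Finset.sum_range_succ]
    ring

lemma dist_coe_le (x y : ℝ) : dist (x : Real.Angle) (y : Real.Angle) ≤ |x - y| := by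
  rw [dist_eq_norm, ← Real.Angle.coe_sub]
  exact QuotientAddGroup.norm_mk_le_norm

namespace RectilinearPolygon

variable (P : RectilinearPolygon)

lemma exists_isAngleLift : ∃ α, P.IsAngleLift α := by
  obtain ⟨α, h0, hα⟩ := exists_int_primitive (fun i => P.turn i * (Real.pi / 2))
    (P.dir 0).dotAngle
  refine ⟨α, fun i => ?_, hα⟩
  have := int_seq_const (f := fun i => (α i : Real.Angle) - (P.dir i).dotAngle) (fun i => by
    rw [hα, ← coe_dotAngle_step, Real.Angle.coe_add, Real.Angle.coe_add]
    abel) i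
  simp only [h0, sub_self] at this
  exact sub_eq_zero.1 this

lemma dot_succ_snd {α : ℤ → ℝ} (hα : P.IsAngleLift α) (i : ℤ) :
    (P.dot (i + 1)).2 = (P.dot i).2 + P.slope i * (α (i + 1) - α i) := by
  have h := P.turn_mul_self i
  have hpi := Real.pi_ne_zero
  rw [hα.step, slope]
  field_simp
  linear_combination -(((P.dot (i + 1)).2 - (P.dot i).2) * Real.pi) * h

/-- The angle function of a smoothing. The condition `mean` makes it possible to integrate the
contact form along a slope function whose derivative is a multiple of the bump function. -/
structure IsFrontAngle (η : ℝ) (α a b : ℤ → ℝ) (θ : ℝ → ℝ) : Prop where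
  smooth : ContDiff ℝ ∞ θ
  shift : ∃ c : ℝ, (c : Real.Angle) = 0 ∧ ∀ t, θ (t + 1) = θ t + c
  near : ∀ i, ∀ t ∈ Set.Icc (a i) (b i), |θ t - α i| ≤ η ∧ |deriv θ t| ≤ η
  mean : ∀ i, ∃ K : ℝ → ℝ, (∀ t ∈ Set.Icc (a i) (b i),
    HasDerivAt K (bump (a i) (b i) t * (θ t - α i)) t) ∧ K (a i) = K (b i)
  chord : ∀ i, ∀ t ∈ Set.Icc (b i) (a (i + 1)),
    0 ≤ P.turn i * (θ t - α i) ∧ P.turn i * (θ t - α i) ≤ Real.pi / 2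
  chord_deriv : ∀ i, ∀ t ∈ Set.Icc (b i) (a (i + 1)), 0 < P.turn i * deriv θ t
  rounded : ∀ i, P.turn (i - 1) = P.turn i →
    ∀ t ∈ Set.Icc (a i) (b i), 0 < P.turn i * deriv θ t
  cusp : ∀ i, P.turn (i - 1) ≠ P.turn i → ∃ c ∈ Set.Ioo (a i) (b i),
    (∀ t ∈ Set.Ico (a i) c, 0 < P.turn (i - 1) * deriv θ t) ∧
    (∀ t ∈ Set.Ioc c (b i), 0 < P.turn i * deriv θ t)

lemma IsAngleLift.exists_period {α : ℤ → ℝ} (hα : P.IsAngleLift α) :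
    ∃ c : ℝ, (c : Real.Angle) = 0 ∧ ∀ i, α (i + P.n) = α i + c := by
  refine ⟨α (0 + P.n) - α 0, ?_, fun i => ?_⟩
  · rw [Real.Angle.coe_sub, hα.coe, hα.coe, P.dir_periodic, sub_self]
  · have := int_seq_const (f := fun i => α (i + P.n) - α i) (fun i => by
      rw [show i + 1 + (P.n : ℤ) = i + P.n + 1 by ring, hα.step, hα.step, P.turn_periodic]
      ring) i
    linarith

set_option maxHeartbeats 800000 in
-- Around each dot `θ` is `α i` plus a small multiple of a profile, and along each chord a smooth
-- cutoff passes from one such function to the next.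
lemma exists_isFrontAngle {α : ℤ → ℝ} (hα : P.IsAngleLift α) {η : ℝ} (hη : 0 < η)
    (hη1 : η ≤ 1 / 2) : ∃ (a b : ℤ → ℝ) (θ : ℝ → ℝ), IsSubdivision P.n a b ∧
      P.IsFrontAngle η α a b θ := by
  have hn : (1 : ℝ) ≤ P.n := by exact_mod_cast P.n_pos
  obtain ⟨r, hr, hnr⟩ : ∃ r : ℝ, 0 < r ∧ 4 * P.n * r = 1 :=
    ⟨1 / (4 * P.n), by positivity, by field_simp⟩
  have hr4 : 4 * r ≤ 1 := by nlinarith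
  have hpi := Real.pi_gt_three
  have hab := isSubdivision_arithmetic (n := P.n) (x := -1) (y := 1) hr hnr (by norm_num)
    (by norm_num)
  have hx := isSubdivision_arithmetic (n := P.n) (x := 0) (y := 1) hr hnr (by norm_num)
    (by norm_num)
  choose ψ ψ' hψ using fun (τ' τ : {x : ℝ // x = 1 ∨ x = -1}) =>
    exists_isDotProfile hr hr4 τ'.2 τ.2
  set T : ℤ → {x : ℝ // x = 1 ∨ x = -1} := fun i => ⟨P.turn i, P.turn_eq_or i⟩ with hT
  have hTper : ∀ i, T (i + P.n) = T i := fun i => Subtype.ext (P.turn_periodic i)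
  set p : ℤ → ℝ → ℝ := fun i => ψ (T (i - 1)) (T i) with hp
  set p' : ℤ → ℝ → ℝ := fun i => ψ' (T (i - 1)) (T i) with hp'
  have hprof : ∀ i, IsDotProfile r (P.turn (i - 1)) (P.turn i) (p i) (p' i) := fun i =>
    hψ (T (i - 1)) (T i)
  have hpper : ∀ i, p (i + P.n) = p i := fun i => by
    simp only [hp]
    rw [show i + (P.n : ℤ) - 1 = i - 1 + P.n by ring, hTper, hTper]
  clear_value p p'
  set A : ℤ → ℝ → ℝ := fun i t => α i + η * p i (t - 4 * i * r) with hA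
  set A' : ℤ → ℝ → ℝ := fun i t => η * p' i (t - 4 * i * r) with hA'
  have hAs : ∀ i, ContDiff ℝ ∞ (A i) := fun i => contDiff_const.add
    (contDiff_const.mul ((hprof i).smooth.comp (contDiff_id.sub contDiff_const)))
  have hAd : ∀ i t, HasDerivAt (A i) (A' i t) t := fun i t => by
    have h1 := ((hprof i).hasDerivAt (t - 4 * i * r)).comp t
      ((hasDerivAt_id t).sub_const (4 * i * r))
    exact ((h1.const_mul η).const_add (α i)).congr_deriv (by simp only [hA', mul_one])
  -- The cutoff varies only between `5/4` and `11/4`, strictly inside the chord phase from `1` to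
  -- `3` (in units of `r`, relative to the dot). Thus the profile is unaltered on a neighbourhood of
  -- the dot interval and the pieces glue.
  set σ : ℤ → ℝ → ℝ := fun i t => Real.smoothTransition ((t - (4 * i + 5 / 4) * r) / (3 / 2 * r))
    with hσ
  have hσs : ∀ i, ContDiff ℝ ∞ (σ i) := fun i => Real.smoothTransition.contDiff.comp
    ((contDiff_id.sub contDiff_const).div_const _)
  have hσmono : ∀ i, Monotone (σ i) := fun i s t hst =>
    Real.smoothTransition.monotone (by
      refine div_le_div_of_nonneg_right ?_ (by positivity)
      linarith)
  have hσd : ∀ i t, HasDerivAt (σ i) (deriv (σ i) t) t := fun i t =>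
    ((hσs i).differentiable (by simp) t).hasDerivAt
  have hσd0 : ∀ i t, 0 ≤ deriv (σ i) t := fun i t => (hσmono i).deriv_nonneg
  have hσ0 : ∀ i t, 0 ≤ σ i t := fun i t => Real.smoothTransition.nonneg _
  have hσ1 : ∀ i t, σ i t ≤ 1 := fun i t => Real.smoothTransition.le_one _
  have hσl : ∀ {i : ℤ} {t : ℝ}, t ≤ (4 * i + 5 / 4) * r → σ i t = 0 := fun h =>
    Real.smoothTransition.zero_of_nonpos (div_nonpos_of_nonpos_of_nonneg (by linarith)
      (by positivity))
  have hσr : ∀ {i : ℤ} {t : ℝ}, (4 * i + 11 / 4) * r ≤ t → σ i t = 1 := fun h =>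
    Real.smoothTransition.one_of_one_le ((one_le_div (by positivity)).2 (by linarith))
  set F : ℤ → ℝ → ℝ := fun i t => A i t + σ i t * (A (i + 1) t - A i t) with hF
  have hFs : ∀ i, ContDiff ℝ ∞ (F i) := fun i =>
    (hAs i).add ((hσs i).mul ((hAs (i + 1)).sub (hAs i)))
  have hFd : ∀ i t, HasDerivAt (F i) (A' i t + (deriv (σ i) t * (A (i + 1) t - A i t)
      + σ i t * (A' (i + 1) t - A' i t))) t := fun i t =>
    (hAd i t).fun_add ((hσd i t).fun_mul ((hAd (i + 1) t).fun_sub (hAd i t)))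
  have hFl : ∀ {i : ℤ} {t : ℝ}, t ≤ (4 * i + 5 / 4) * r → F i t = A i t := fun h => by
    simp only [hF, hσl h]; ring
  have hFr : ∀ {i : ℤ} {t : ℝ}, (4 * i + 11 / 4) * r ≤ t → F i t = A (i + 1) t := fun h => by
    simp only [hF, hσr h]; ring
  obtain ⟨θ, hθs, hθ⟩ := hx.exists_glue hFs (fun j => by
    have h1 : Set.Ioo ((4 * (j + 1 : ℤ) + -1) * r) ((4 * (j + 1 : ℤ) + 1) * r)
        ∈ 𝓝 ((4 * ((j + 1 : ℤ) : ℝ) + 0) * r) := Ioo_mem_nhds (by nlinarith) (by nlinarith)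
    filter_upwards [h1] with t ht
    rw [hFr, hFl]
    · nlinarith [ht.2]
    · have := ht.1
      push_cast at this
      nlinarith)
  have hθA : ∀ (i : ℤ), ∀ t ∈ Set.Icc ((4 * (i : ℝ) + -1) * r) ((4 * i + 1) * r),
      θ =ᶠ[𝓝 t] A i := by
    intro i t ht
    rcases le_total (4 * i * r) t with h | h
    · refine (hθ i t ⟨by linarith, by push_cast; nlinarith [ht.2]⟩).trans ?_
      filter_upwards [Iio_mem_nhds (show t < (4 * i + 5 / 4) * r by nlinarith [ht.2])] with s hs
      exact hFl hs.le
    · refine (hθ (i - 1) t ⟨by push_cast; nlinarith [ht.1], by push_cast; linarith⟩).trans ?_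
      filter_upwards [Ioi_mem_nhds (show (4 * i - 5 / 4) * r < t by nlinarith [ht.1])] with s hs
      rw [Set.mem_Ioi] at hs
      rw [hFr (by push_cast; linarith), sub_add_cancel]
  have hmem : ∀ (i : ℤ), ∀ t ∈ Set.Icc ((4 * (i : ℝ) + -1) * r) ((4 * i + 1) * r),
      t - 4 * i * r ∈ Set.Icc (-r) r := fun i t ht =>
    ⟨by linarith [ht.1], by linarith [ht.2]⟩
  have hθd : ∀ (i : ℤ), ∀ t ∈ Set.Icc ((4 * (i : ℝ) + -1) * r) ((4 * i + 1) * r),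
      deriv θ t = A' i t := fun i t ht => by
    rw [(hθA i t ht).deriv_eq, (hAd i t).deriv]
  have hchord : ∀ (i : ℤ), ∀ t ∈ Set.Icc ((4 * (i : ℝ) + 1) * r) ((4 * (i + 1 : ℤ) + -1) * r),
      (0 ≤ P.turn i * (θ t - α i) ∧ P.turn i * (θ t - α i) ≤ Real.pi / 2) ∧
      0 < P.turn i * deriv θ t := by
    intro i t ⟨ht1, ht2⟩
    push_cast at ht2
    have hev := hθ i t ⟨by linarith, by push_cast; linarith⟩
    obtain ⟨x0, x1, x2⟩ := (hprof i).right (t - 4 * i * r) ⟨by linarith, by linarith⟩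
    obtain ⟨y0, y1, y2⟩ := (hprof (i + 1)).left (t - 4 * (i + 1 : ℤ) * r)
      ⟨by push_cast; linarith, by push_cast; linarith⟩
    rw [add_sub_cancel_right] at y0 y1 y2
    have hτ := P.turn_mul_self i
    have e1 : P.turn i * (θ t - α i) = (1 - σ i t) * (η * (P.turn i * p i (t - 4 * i * r)))
        + σ i t * (Real.pi / 2 + η * (P.turn i * p (i + 1) (t - 4 * (i + 1 : ℤ) * r))) := by
      rw [hev.eq_of_nhds]
      simp only [hF, hA, hα.step]
      linear_combination σ i t * (Real.pi / 2) * hτ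
    -- Both profiles move in the direction of the turn, and the cutoff moves between two values
    -- whose gap is at least `π / 2 - 2 η > 0`.
    have e2 : P.turn i * deriv θ t = ((1 - σ i t) * (η * (P.turn i * p' i (t - 4 * i * r)))
        + σ i t * (η * (P.turn i * p' (i + 1) (t - 4 * (i + 1 : ℤ) * r))))
        + deriv (σ i) t * ((Real.pi / 2 + η * (P.turn i * p (i + 1) (t - 4 * (i + 1 : ℤ) * r)))
          - η * (P.turn i * p i (t - 4 * i * r))) := by
      rw [hev.deriv_eq, (hFd i t).deriv]
      simp only [hA', hA, hα.step]
      linear_combination deriv (σ i) t * (Real.pi / 2) * hτ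
    have x0' := mul_nonneg hη.le x0
    have x1' := mul_le_mul_of_nonneg_left x1 hη.le
    have x2' := mul_pos hη x2
    have y0' := mul_le_mul_of_nonneg_left y0 hη.le
    have y1' := mul_le_mul_of_nonneg_left y1 hη.le
    have y2' := mul_pos hη y2
    rw [e1, e2]
    generalize η * (P.turn i * p i (t - 4 * i * r)) = X at *
    generalize η * (P.turn i * p' i (t - 4 * i * r)) = X' at *
    generalize η * (P.turn i * p (i + 1) (t - 4 * (i + 1 : ℤ) * r)) = Y at *
    generalize η * (P.turn i * p' (i + 1) (t - 4 * (i + 1 : ℤ) * r)) = Y' at *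
    have s0 := hσ0 i t
    have s1 := hσ1 i t
    have sd := hσd0 i t
    refine ⟨⟨?_, ?_⟩, ?_⟩
    · exact add_nonneg (mul_nonneg (by linarith) x0') (mul_nonneg s0 (by linarith))
    · nlinarith
    · refine add_pos_of_pos_of_nonneg ?_ (mul_nonneg sd (by linarith))
      rcases eq_or_lt_of_le s1 with h | h
      · rw [h]; linarith
      · exact add_pos_of_pos_of_nonneg (mul_pos (by linarith) x2') (mul_nonneg s0 y2'.le)
  refine ⟨_, _, θ, hab, hθs, ?_, fun i t ht => ?_, fun i => ?_, fun i t ht => (hchord i t ht).1,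
    fun i t ht => (hchord i t ht).2, fun i hi t ht => ?_, fun i hi => ?_⟩
  · obtain ⟨c, hc, hαc⟩ := hα.exists_period
    refine ⟨c, hc, fun t => ?_⟩
    have hAper : ∀ i t, A (i + P.n) (t + 1) = A i t + c := fun i t => by
      simp only [hA, hpper, hαc]
      rw [show t + 1 - 4 * ((i + P.n : ℤ) : ℝ) * r = t - 4 * i * r by
        push_cast; linear_combination -hnr]
      ring
    have hσper : ∀ i t, σ (i + P.n) (t + 1) = σ i t := fun i t => by
      simp only [hσ]
      rw [show t + 1 - (4 * ((i + P.n : ℤ) : ℝ) + 5 / 4) * r = t - (4 * i + 5 / 4) * r by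
        push_cast; linear_combination -hnr]
    obtain ⟨j, hj⟩ := hx.exists_mem t
    have h2 := hj.2
    push_cast at h2
    rw [(hθ j t ⟨hj.1, hj.2.le⟩).eq_of_nhds, (hθ (j + P.n) (t + 1)
      ⟨by push_cast; linarith [hj.1], by push_cast; linarith⟩).eq_of_nhds]
    simp only [hF, show j + (P.n : ℤ) + 1 = j + 1 + P.n by ring, hAper, hσper]
    ring
  · obtain ⟨h1, h2⟩ := (hprof i).bound _ (hmem i t ht)
    rw [hθd i t ht, (hθA i t ht).eq_of_nhds]
    simp only [hA, hA', add_sub_cancel_left, abs_mul, abs_of_pos hη]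
    exact ⟨by nlinarith, by nlinarith⟩
  · obtain ⟨K, hK, hK'⟩ := (hprof i).mean
    refine ⟨fun t => η * K (t - 4 * i * r), fun t ht => ?_, ?_⟩
    · have h1 := (hK (t - 4 * i * r)).comp t ((hasDerivAt_id t).sub_const (4 * i * r))
      refine (h1.const_mul η).congr_deriv ?_
      have h2 := bump_add_add (-r) r (4 * i * r) t
      rw [(hθA i t ht).eq_of_nhds, show (4 * (i : ℝ) + -1) * r = -r + 4 * i * r by ring,
        show (4 * (i : ℝ) + 1) * r = r + 4 * i * r by ring, h2]
      simp only [hA]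
      ring
    · simp only
      rw [show (4 * (i : ℝ) + -1) * r - 4 * i * r = -r by ring,
        show (4 * (i : ℝ) + 1) * r - 4 * i * r = r by ring, hK']
  · rw [hθd i t ht]
    simp only [hA']
    rw [mul_left_comm]
    exact mul_pos hη ((hprof i).rounded hi _ (hmem i t ht))
  · have hc := (hprof i).cusp hi
    refine ⟨4 * i * r, ⟨by linarith, by linarith⟩, fun t ht => ?_, fun t ht => ?_⟩
    · rw [hθd i t ⟨ht.1, by linarith [ht.2]⟩]
      simp only [hA']
      rw [mul_left_comm]
      exact mul_pos hη ((hc _).1 (by linarith [ht.2]))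
    · rw [hθd i t ⟨by linarith [ht.1], ht.2⟩]
      simp only [hA']
      rw [mul_left_comm]
      exact mul_pos hη ((hc _).2 (by linarith [ht.1]))

lemma slope_periodic (i : ℤ) : P.slope (i + P.n) = P.slope i := by
  unfold slope
  rw [P.turn_periodic, show i + (P.n : ℤ) + 1 = i + 1 + P.n by ring, P.dot_periodic,
    P.dot_periodic]

/-- A slope function which is constant along the chords. -/
lemma exists_front_slope {a b : ℤ → ℝ} (hab : IsSubdivision P.n a b) :
    ∃ y y' : ℝ → ℝ, ContDiff ℝ ∞ y ∧ Function.Periodic y 1 ∧ (∀ t, HasDerivAt y (y' t) t) ∧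
      (∀ i, ∀ t ∈ Set.Icc (a i) (a (i + 1)),
        y t = P.slope (i - 1) + step (a i) (b i) t * (P.slope i - P.slope (i - 1)) ∧
        y' t = bump (a i) (b i) t * (P.slope i - P.slope (i - 1))) := by
  set c : ℤ → ℝ → ℝ := fun i _ => P.slope i - P.slope (i - 1) with hc
  have hsper : ∀ i, P.slope (i + P.n - 1) = P.slope (i - 1) := fun i => by
    rw [show i + (P.n : ℤ) - 1 = i - 1 + P.n by ring, P.slope_periodic]
  have hcper : ∀ i, c (i + P.n) = c i := fun i => by
    simp only [hc, hsper, P.slope_periodic]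
  obtain ⟨y, hys, hy, hy0⟩ := exists_primitive
    (bumpSum_contDiff P.n a b (c := c) fun i => contDiff_const) (a 0) (P.slope (0 - 1))
  have hd : ∀ i, ∀ t ∈ Set.Icc (a i) (a (i + 1)),
      bumpSum P.n a b c t = bump (a i) (b i) t * (P.slope i - P.slope (i - 1)) :=
    fun i t ht => bumpSum_apply hab hcper ht
  have hwin : ∀ i, ∀ t ∈ Set.Icc (a i) (a (i + 1)),
      y t = y (a i) + step (a i) (b i) t * (P.slope i - P.slope (i - 1)) := by
    intro i t ht
    have := sub_eq_sub_of_hasDerivAt (F := y)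
      (G := fun t => step (a i) (b i) t * (P.slope i - P.slope (i - 1))) ht.1
      (fun s _ => hy s) (fun s hs => by
        rw [hd i s ⟨hs.1, hs.2.trans ht.2⟩]
        exact (step_hasDerivAt _ _ s).mul_const _)
    rw [step_left] at this
    linarith
  have hv : ∀ i, y (a i) = P.slope (i - 1) := by
    intro i
    have := int_seq_const (f := fun i => y (a i) - P.slope (i - 1)) (fun i => by
      rw [hwin i (a (i + 1)) ⟨hab.strictMono_a.monotone (by omega), le_rfl⟩,
        step_eq_one (hab.lt i) (hab.lt_add_one i) ⟨(hab.lt_next i).le, hab.next_le i⟩,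
        add_sub_cancel_right]
      ring) i
    linarith
  refine ⟨y, _, hys, fun t => ?_, hy, fun i t ht => ⟨by rw [hwin i t ht, hv], hd i t ht⟩⟩
  have h1 := shift_sub_eq hy (bumpSum_periodic _ _ _ fun i _ => rfl) (a 0) t
  rw [← hab.shift_a, hv, hv, hsper, sub_self] at h1
  exact sub_eq_zero.1 h1


/-- With `θ` and `y` prescribed, `z` is the integral of `y dθ`. What must be checked is that the
front reaches each chord's line exactly and closes up; both follow from the mean-zero property of
`θ` at the dots. -/
theorem exists_isSmoothedFront {ε : ℝ} (hε : 0 < ε) : ∃ γ, P.IsSmoothedFront ε γ := by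
  obtain ⟨α, hα⟩ := P.exists_isAngleLift
  obtain ⟨M, hM, hMs⟩ := exists_common_bound P.n_pos (f := fun i => |P.slope i|)
    (fun i => by rw [P.slope_periodic])
  set η : ℝ := min (1 / 2) (ε / (2 + 4 * M)) with hη
  have hη0 : 0 < η := by positivity
  have hη1 : η ≤ 1 / 2 := min_le_left _ _
  have hη2 : 2 * η + 4 * (M * η) ≤ ε := by
    have : η ≤ ε / (2 + 4 * M) := min_le_right _ _
    rw [le_div_iff₀ (by positivity)] at this
    linarith
  obtain ⟨a, b, θ, hab, hθ⟩ := P.exists_isFrontAngle hα hη0 hη1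
  obtain ⟨y, y', hys, hyper, hy, hyv⟩ := P.exists_front_slope hab
  have hθs := hθ.smooth
  have hθ's : ContDiff ℝ ∞ (deriv θ) := (contDiff_infty_iff_deriv.1 hθs).2
  have hθd : ∀ t, HasDerivAt θ (deriv θ t) t := fun t =>
    (hθs.differentiable (by simp) t).hasDerivAt
  obtain ⟨z, hzs, hz, hz0⟩ := exists_primitive (hys.mul hθ's) (b 0)
    ((P.dot 0).2 + P.slope 0 * (θ (b 0) - α 0))
  have hya : ∀ i, y (a i) = P.slope (i - 1) := fun i => by
    rw [(hyv i (a i) ⟨le_rfl, hab.strictMono_a.monotone (by omega)⟩).1, step_left]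
    ring
  have hyc : ∀ i, ∀ t ∈ Set.Icc (b i) (a (i + 1)), y t = P.slope i := fun i t ht => by
    rw [(hyv i t ⟨(hab.lt i).le.trans ht.1, ht.2⟩).1,
      step_eq_one (hab.lt i) (hab.lt_add_one i) ⟨ht.1, ht.2.trans (hab.next_le i)⟩]
    ring
  have hyd : ∀ i, ∀ t ∈ Set.Icc (a i) (b i),
      y t = P.slope (i - 1) + step (a i) (b i) t * (P.slope i - P.slope (i - 1)) ∧
      y' t = bump (a i) (b i) t * (P.slope i - P.slope (i - 1)) := fun i t ht =>
    hyv i t ⟨ht.1, ht.2.trans (hab.lt_next i).le⟩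
  have hchord : ∀ i, ∀ t ∈ Set.Icc (b i) (a (i + 1)),
      z t - P.slope i * θ t = z (b i) - P.slope i * θ (b i) := by
    intro i t ht
    refine eq_of_hasDerivAt_zero (F := fun t => z t - P.slope i * θ t) ht.1 fun s hs => ?_
    refine ((hz s).fun_sub ((hθd s).const_mul (P.slope i))).congr_deriv ?_
    rw [hyc i s ⟨hs.1, hs.2.trans ht.2⟩, sub_self]
  -- Integration by parts: `(z - y θ)' = -y' θ`, where `y'` is the slope jump times the bump. By the
  -- mean-zero condition `θ` may be replaced by `α i` in the integral, so the intercept changes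
  -- exactly as for two lines meeting at the dot.
  have hdot : ∀ i, z (b i) - P.slope i * θ (b i)
      = z (a i) - P.slope (i - 1) * θ (a i) - (P.slope i - P.slope (i - 1)) * α i := by
    intro i
    obtain ⟨K, hK, hKe⟩ := hθ.mean i
    have := eq_of_hasDerivAt_zero (F := fun t => z t - y t * θ t
      + (P.slope i - P.slope (i - 1)) * (step (a i) (b i) t * α i + K t)) (hab.lt i).le
      fun s hs => by
        refine (((hz s).fun_sub ((hy s).fun_mul (hθd s))).fun_add
          ((((step_hasDerivAt (a i) (b i) s).mul_const (α i)).fun_add (hK s hs)).const_mul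
            (P.slope i - P.slope (i - 1)))).congr_deriv ?_
        rw [(hyd i s hs).2]
        ring
    simp only [step_left, step_right (hab.lt i) (hab.lt_add_one i), hya, hKe,
      hyc i (b i) ⟨le_rfl, (hab.lt_next i).le⟩] at this
    linarith
  have hzb : ∀ i, z (b i) - P.slope i * θ (b i) = (P.dot i).2 - P.slope i * α i := by
    intro i
    have := int_seq_const (f := fun i => z (b i) - P.slope i * θ (b i)
      - ((P.dot i).2 - P.slope i * α i)) (fun i => by
        rw [hdot (i + 1), add_sub_cancel_right, hchord i (a (i + 1)) ⟨(hab.lt_next i).le, le_rfl⟩,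
          P.dot_succ_snd hα]
        ring) i
    linarith
  have hzc : ∀ i, ∀ t ∈ Set.Icc (b i) (a (i + 1)),
      z t = (P.dot i).2 + P.slope i * (θ t - α i) := fun i t ht => by
    linarith [hchord i t ht, hzb i]
  have hza : ∀ i, z (a i) = (P.dot i).2 + P.slope (i - 1) * (θ (a i) - α i) := fun i => by
    have h1 := hzc (i - 1) (a i) ⟨(hab.lt_of_lt (by omega)).le, by rw [sub_add_cancel]⟩
    have h2 := P.dot_succ_snd hα (i - 1)
    rw [sub_add_cancel] at h2
    rw [h1, h2]
    ring
  have hyM : ∀ i, ∀ t ∈ Set.Icc (a i) (b i), |y t| ≤ M := by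
    intro i t ht
    have h0 := step_nonneg (hab.lt i) ht.1
    have h1 := step_le_one (hab.lt i) (hab.lt_add_one i) (ht.2.trans (hab.lt_add_one i).le)
    have h2 := abs_le.1 (hMs i)
    have h3 := abs_le.1 (hMs (i - 1))
    rw [(hyd i t ht).1, abs_le]
    constructor <;> nlinarith
  have hnear : ∀ i, ∀ t ∈ Set.Icc (a i) (b i), |θ t - α i| < ε ∧ |z t - (P.dot i).2| < ε := by
    intro i t ht
    have hMη := mul_pos hM hη0
    refine ⟨(hθ.near i t ht).1.trans_lt (by linarith), ?_⟩
    have h1 := norm_sub_le_of_norm_deriv_le (F := z) (B := fun t => M * η * t)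
      (B' := fun _ => M * η) ht.1 hz (fun s => by
        simpa using (hasDerivAt_id s).const_mul (M * η)) (fun s hs => by
        have hs' : s ∈ Set.Icc (a i) (b i) := ⟨hs.1, hs.2.trans ht.2⟩
        rw [norm_mul, Real.norm_eq_abs, Real.norm_eq_abs]
        exact mul_le_mul (hyM i s hs') (hθ.near i s hs').2 (abs_nonneg _) hM.le)
    rw [Real.norm_eq_abs] at h1
    have h2 : |z (a i) - (P.dot i).2| ≤ M * η := by
      rw [hza, add_sub_cancel_left, abs_mul]
      exact mul_le_mul (hMs _) (hθ.near i (a i) ⟨le_rfl, (hab.lt i).le⟩).1 (abs_nonneg _) hM.le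
    have h3 : M * η * t - M * η * a i ≤ M * η := by
      have : t - a i ≤ 1 := by linarith [ht.2, hab.lt_add_one i]
      nlinarith
    linarith [abs_sub_le (z t) (z (a i)) (P.dot i).2]
  obtain ⟨c, hc, hshift⟩ := hθ.shift
  have hθ'per : Function.Periodic (deriv θ) 1 := fun t => by
    have h1 : HasDerivAt (fun s => θ (s + 1)) (deriv θ (t + 1)) t := by
      simpa using (hθd (t + 1)).comp_add_const t 1
    have h2 : (fun s => θ (s + 1)) = fun s => θ s + c := funext hshift
    rw [h2] at h1
    exact h1.unique ((hθd t).add_const c)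
  -- The increment of `z` over a period is constant, and it vanishes at `b 0` because chords `0` and
  -- `n` lie on the same line up to the shift of the angle by `c`.
  have hzper : Function.Periodic z 1 := fun t => by
    have h1 := shift_sub_eq hz (fun s => by simp only [hyper s, hθ'per s]) (b 0) t
    have h2 := hzb (0 + P.n)
    rw [hab.shift_b, P.slope_periodic, P.dot_periodic, hshift] at h2
    have h3 : α (0 + P.n) = α 0 + c := by
      have e1 := hθ.near (0 + P.n) (a 0 + 1) (by
        rw [hab.shift_a, hab.shift_b]; exact ⟨le_rfl, by linarith [hab.lt 0]⟩)
      have e2 := hθ.near 0 (a 0) ⟨le_rfl, (hab.lt 0).le⟩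
      refine eq_of_coe_eq_of_abs_lt ?_ ?_
      · rw [Real.Angle.coe_add, hc, add_zero, hα.coe, hα.coe, P.dir_periodic]
      · have f1 := abs_le.1 e1.1
        have f2 := abs_le.1 e2.1
        rw [hshift] at f1
        rw [abs_lt]
        constructor <;> linarith [Real.pi_gt_three, f1.1, f1.2, f2.1, f2.2]
    rw [h3] at h2
    linarith [hzb 0]
  have hdz : ∀ t, deriv z t = y t * deriv θ t := fun t => (hz t).deriv
  have himm : ∀ t, deriv θ t = 0 → y' t ≠ 0 := by
    intro t h0
    obtain ⟨i, hi | hi⟩ := hab.exists_mem_Icc t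
    · by_cases he : P.turn (i - 1) = P.turn i
      · exact absurd h0 (right_ne_zero_of_mul (hθ.rounded i he t hi).ne')
      · obtain ⟨c, hc, h1, h2⟩ := hθ.cusp i he
        rcases lt_trichotomy t c with h | h | h
        · exact absurd h0 (right_ne_zero_of_mul (h1 t ⟨hi.1, h⟩).ne')
        · rw [(hyd i t hi).2]
          -- At the cusp the bump is positive and the slope jump is nonzero, so the Legendrian curve
          -- is immersed there.
          exact mul_ne_zero (bump_pos (hab.lt_add_one i) (h ▸ hc)).ne'
            (sub_neg.2 (IsFrontLift.slope_lt_of_turn_ne P he)).ne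
        · exact absurd h0 (right_ne_zero_of_mul (h2 t ⟨h, hi.2⟩).ne')
    · exact absurd h0 (right_ne_zero_of_mul (hθ.chord_deriv i t hi).ne')
  refine ⟨fun t => ((θ t : Real.Angle), y t, z t), θ, y, z,
    ⟨fun t => rfl, fun t => ?_, hθs, hys, hzs, fun t => by rw [hdz, sub_self], fun t h => ?_⟩,
    a, b, hab, fun i t ht => ⟨?_, hθ.chord_deriv i t ht⟩, fun i t ht => ?_, hθ.rounded,
    fun i hi => ⟨hθ.cusp i hi, ?_⟩⟩
  · simp only [hshift, hyper t, hzper t, Real.Angle.coe_add, hc, add_zero]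
  · rw [Prod.mk_eq_zero, Prod.mk_eq_zero, (hy t).deriv] at h
    exact himm t h.1 h.2.1
  · obtain ⟨h1, h2⟩ := hθ.chord i t ht
    have hpi := Real.pi_pos
    have hτ := P.turn_mul_self i
    refine ⟨P.turn i * (θ t - α i) / (Real.pi / 2), ⟨by positivity,
      (div_le_one (by positivity)).2 h2⟩, ?_⟩
    have e : P.turn i * (θ t - α i) / (Real.pi / 2) * (P.turn i * (Real.pi / 2)) = θ t - α i := by
      rw [div_mul_eq_mul_div, div_eq_iff (by positivity)]
      linear_combination (θ t - α i) * (Real.pi / 2) * hτ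
    refine Prod.ext ?_ ?_
    · simp only [front, chord, e]
      rw [Real.Angle.coe_add, ← hα.coe, ← Real.Angle.coe_add, add_sub_cancel]
    · simp only [front, chord]
      rw [hzc i t ht, P.dot_succ_snd hα, hα.step]
      linear_combination (-P.slope i) * e
  · rw [Prod.dist_eq, max_lt_iff]
    refine ⟨lt_of_le_of_lt ?_ (hnear i t ht).1, ?_⟩
    · simp only [front, dot]
      rw [← hα.coe]
      exact dist_coe_le _ _
    · rw [Real.dist_eq]
      exact (hnear i t ht).2
  · refine Or.inr fun s hs t ht hst => ?_
    rw [(hyd i s hs).1, (hyd i t ht).1]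
    have h1 := step_mono (hab.lt i) hst (y := b i)
    have h2 := IsFrontLift.slope_lt_of_turn_ne P hi
    nlinarith

end RectilinearPolygon

end PlaneConormal

end

theorem mainTheorem4 (P : PlaneConormal.RectilinearPolygon) :
    (∀ ε : ℝ, 0 < ε → ∃ q : ℝ → ℝ × ℝ, P.IsRectilinearCurve ε q) ∧
    (∀ ε : ℝ, 0 < ε → ∃ γ : ℝ → PlaneConormal.JetSpace, P.IsSmoothedFront ε γ) ∧
    ∃ ε₀ : ℝ, 0 < ε₀ ∧
      ∀ (q : ℝ → ℝ × ℝ) (γ : ℝ → PlaneConormal.JetSpace),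
        P.IsRectilinearCurve ε₀ q → P.IsSmoothedFront ε₀ γ →
          PlaneConormal.LegendrianIsotopic γ (PlaneConormal.conormal q) := by
  exact ⟨fun _ hε => P.exists_isRectilinearCurve hε, fun _ hε => P.exists_isSmoothedFront hε,
    P.exists_legendrianIsotopic⟩
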